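/- Let $A\in \mathrm{SL}_3(\mathbb Z)$ have a real eigenvalue $\alpha>1$ and two non-real eigenvalues $\beta,\bar\beta$; let $(a_1,a_2,a_3)^t$ be a real eigenvector for $\alpha$ and $(b_1,b_2,b_3)^t$ a complex eigenvector for $\beta$. Let $\mathbb H$ be the upper half-plane and let $G_A$ be the group of transformations of $\mathbb C\times\mathbb H$ generated by $(z,w)\mapsto(\beta z,\alpha w)$ and $(z,w)\mapsto(z+b_i,w+a_i)$, $i=1,2,3$. Let $\mathcal S^0=(\mathbb C\times\mathbb H)/G_A$ be the associated Inoue surface, regarded as a smooth real $4$-manifold. Let $p:\mathcal S^0\to S^1$, $[z,w]\mapsto e^{2\pi \mathrm i\log_\alpha(\operatorname{Im} w)}$, and let $\vartheta$ be the pullback by $p$ of the volume form $\frac{d\zeta}{2\pi \mathrm i\,\zeta}$ of the circle of length $1$. For a closed one-form $\eta$ on a manifold $M$, let $H^i_\eta(M)$ be the $i$-th cohomology of the complex of smooth real forms on $M$ with the differential $d_\eta=d-\eta\wedge\cdot$ (Morse–Novikov cohomology). Then $\vartheta$ is a smooth closed one-form and: 1. If $t\in\mathbb R$ and $t\neq 0,\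 \ln\alpha,\ -\ln\alpha$, then $H^i_{t\vartheta}(\mathcal S^0)=0$ for all $i\ge 0$. 2. If $t=-\ln\alpha$, then $H^1_{t\vartheta}(\mathcal S^0)\simeq H^2_{t\vartheta}(\mathcal S^0)\simeq\mathbb R$ and all the other groups $H^i_{t\vartheta}(\mathcal S^0)$ vanish. 3. If $t=\ln\alpha$, then $H^2_{t\vartheta}(\mathcal S^0)\simeq H^3_{t\vartheta}(\mathcal S^0)\simeq\mathbb R$ and all the other groups $H^i_{t\vartheta}(\mathcal S^0)$ vanish. 4. If $t=0$, so that $H^i_{t\vartheta}(\mathcal S^0)$ is the de Rham cohomology $H^i_{dR}(\mathcal S^0)$, then $H^i_{dR}(\mathcal S^0)\simeq\mathbb R$ for $i=0,1,3,4$ and $H^i_{dR}(\mathcal S^0)=0$ for all other $i$. 5. For every smooth closed one-form $\eta$ on $\mathcal S^0$ there is exactly one $t\in\mathbb R$ such that $\eta=t\vartheta+df$ for some smooth function $f$, and then $H^i_\eta(\mathcal S^0)\simeq H^i_{t\vartheta}(\mathcal S^0)$ for all $i\ge0$. Hence 1–4 give the Morse–Novikov cohomology of $\mathcal S^0$ with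 respect to every closed one-form. -/

import Mathlib

open scoped Manifold ContDiff UpperHalfPlane ComplexConjugate

noncomputable section

/-! ### Differential forms on a manifold and the Morse–Novikov complex -/

namespace MorseNovikov

section Forms

variable {E : Type*} [NormedAddCommGroup E] [NormedSpace ℝ E]
  {H : Type*} [TopologicalSpace H] (I : ModelWithCorners ℝ E H)
  (M : Type*) [TopologicalSpace M] [ChartedSpace H M]

/-- Fields of alternating `k`-forms on the tangent spaces of `M`, without regularity. -/
def FormField (k : ℕ) : Type _ :=
  ∀ x : M, TangentSpace I x [⋀^Fin k]→L[ℝ] ℝ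

instance (k : ℕ) : AddCommGroup (FormField I M k) :=
  inferInstanceAs (AddCommGroup (∀ x : M, TangentSpace I x [⋀^Fin k]→L[ℝ] ℝ))

instance (k : ℕ) : Module ℝ (FormField I M k) :=
  inferInstanceAs (Module ℝ (∀ x : M, TangentSpace I x [⋀^Fin k]→L[ℝ] ℝ))

variable {I M}

/-- The expression of `σ` in the chart around `x₀`: its pullback by the inverse chart. -/
def FormField.inChart {k : ℕ} (σ : FormField I M k) (x₀ : M) : E → E [⋀^Fin k]→L[ℝ] ℝ :=
  fun u ↦ (σ ((extChartAt I x₀).symm u)).compContinuousLinearMap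
    (mfderivWithin 𝓘(ℝ, E) I (extChartAt I x₀).symm (Set.range I) u)

theorem FormField.inChart_add {k : ℕ} (σ τ : FormField I M k) (x₀ : M) :
    (σ + τ).inChart x₀ = σ.inChart x₀ + τ.inChart x₀ := rfl

theorem FormField.inChart_smul {k : ℕ} (c : ℝ) (σ : FormField I M k) (x₀ : M) :
    (c • σ).inChart x₀ = c • σ.inChart x₀ := rfl

variable (I M) in
/-- `Ω^k(M)`: the smooth `k`-forms, i.e. those with smooth coefficients in the charts. -/
def smoothForms (k : ℕ) : Submodule ℝ (FormField I M k) where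
  carrier := {σ | ∀ x₀ : M, ContDiffOn ℝ ∞ (σ.inChart x₀) (extChartAt I x₀).target}
  add_mem' := fun hσ hτ x₀ ↦ by
    rw [FormField.inChart_add]; exact (hσ x₀).add (hτ x₀)
  zero_mem' := fun _ ↦ contDiffOn_const (c := 0)
  smul_mem' := fun c σ hσ x₀ ↦ by
    rw [FormField.inChart_smul]; exact (hσ x₀).const_smul c

/-- The exterior derivative, computed at each point `x` in the chart around `x`. -/
def FormField.d {k : ℕ} (σ : FormField I M k) : FormField I M (k + 1) :=
  fun x ↦ ContinuousAlternatingMap.compContinuousLinearMap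
    (extDerivWithin (σ.inChart x) (Set.range I) (extChartAt I x x))
    (mfderiv I 𝓘(ℝ, E) (extChartAt I x) x)

/-- The wedge product of a `1`-form and a `k`-form,
`(η ∧ σ)(v₀, …, v_k) = ∑ i, (-1)^i η(v_i) σ(v₀, …, v̂_i, …, v_k)`. -/
def wedgeOne {k : ℕ} (η : E [⋀^Fin 1]→L[ℝ] ℝ) (σ : E [⋀^Fin k]→L[ℝ] ℝ) :
    E [⋀^Fin (k + 1)]→L[ℝ] ℝ :=
  .alternatizeUncurryFin
    (((ContinuousAlternatingMap.ofSubsingleton ℝ E ℝ (0 : Fin 1)).symm η).smulRight σ)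

theorem wedgeOne_apply {k : ℕ} (η : E [⋀^Fin 1]→L[ℝ] ℝ) (σ : E [⋀^Fin k]→L[ℝ] ℝ)
    (v : Fin (k + 1) → E) :
    wedgeOne η σ v = ∑ i : Fin (k + 1), (-1) ^ (i : ℕ) * (η ![v i] * σ (i.removeNth v)) := by
  have h (x : E) : (fun _ : Fin 1 ↦ x) = ![x] := by ext i; simp [Subsingleton.elim i 0]
  simp [wedgeOne, ContinuousAlternatingMap.alternatizeUncurryFin_apply,
    ContinuousAlternatingMap.ofSubsingleton, zsmul_eq_mul, h]

/-- The pointwise wedge product of a field of `1`-forms and a field of `k`-forms. -/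
def FormField.wedge {k : ℕ} (η : FormField I M 1) (σ : FormField I M k) :
    FormField I M (k + 1) :=
  fun x ↦ wedgeOne (E := E) (η x) (σ x)

theorem FormField.d_add {k : ℕ} {σ τ : FormField I M k}
    (hσ : σ ∈ smoothForms I M k) (hτ : τ ∈ smoothForms I M k) :
    (σ + τ).d = σ.d + τ.d := by
  funext x
  have key {ρ : FormField I M k} (hρ : ρ ∈ smoothForms I M k) :
      DifferentiableWithinAt ℝ (ρ.inChart x) (Set.range I) (extChartAt I x x) :=
    (((hρ x) _ (mem_extChartAt_target x)).differentiableWithinAt (by simp)).mono_of_mem_nhdsWithin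
      (extChartAt_target_mem_nhdsWithin x)
  have h := extDerivWithin_add (I.uniqueDiffOn _ (extChartAt_target_subset_range x
    (mem_extChartAt_target x))) (key hσ) (key hτ)
  simp only [FormField.d, FormField.inChart_add, h]
  rfl

theorem FormField.d_smul {k : ℕ} (c : ℝ) (σ : FormField I M k) : (c • σ).d = c • σ.d := by
  funext x
  have h := extDerivWithin_smul c (σ.inChart x) (I.uniqueDiffOn _ (extChartAt_target_subset_range x
    (mem_extChartAt_target x)))
  simp only [FormField.d, FormField.inChart_smul, h]
  rfl

theorem wedgeOne_add {k : ℕ} (η : E [⋀^Fin 1]→L[ℝ] ℝ) (σ τ : E [⋀^Fin k]→L[ℝ] ℝ) :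
    wedgeOne η (σ + τ) = wedgeOne η σ + wedgeOne η τ := by
  ext v; simp [wedgeOne_apply, mul_add, Finset.sum_add_distrib]

theorem wedgeOne_smul {k : ℕ} (c : ℝ) (η : E [⋀^Fin 1]→L[ℝ] ℝ) (σ : E [⋀^Fin k]→L[ℝ] ℝ) :
    wedgeOne η (c • σ) = c • wedgeOne η σ := by
  ext v; simp [wedgeOne_apply, Finset.mul_sum, mul_left_comm]

/-- The twisted differential `d_η = d - η ∧ ·` on smooth `k`-forms. -/
def twistedD (η : FormField I M 1) (k : ℕ) : smoothForms I M k →ₗ[ℝ] FormField I M (k + 1) where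
  toFun σ := (σ : FormField I M k).d - η.wedge (σ : FormField I M k)
  map_add' σ τ := by
    have h : η.wedge (σ.1 + τ.1) = η.wedge σ.1 + η.wedge τ.1 :=
      funext fun x ↦ wedgeOne_add (E := E) (η x) (σ.1 x) (τ.1 x)
    rw [Submodule.coe_add, FormField.d_add σ.2 τ.2, h]
    abel
  map_smul' c σ := by
    have h : η.wedge (c • (σ : FormField I M k)) = c • η.wedge σ.1 :=
      funext fun x ↦ wedgeOne_smul (E := E) c (η x) (σ.1 x)
    rw [Submodule.coe_smul, FormField.d_smul, h, RingHom.id_apply, smul_sub]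

/-- The smooth `d_η`-closed `k`-forms. -/
def cocycles (η : FormField I M 1) (k : ℕ) : Submodule ℝ (smoothForms I M k) :=
  LinearMap.ker (twistedD η k)

/-- The smooth `d_η`-exact `k`-forms: `d_η Ω^{k-1}(M)`, which is `0` for `k = 0`. -/
def coboundaries (η : FormField I M 1) : (k : ℕ) → Submodule ℝ (smoothForms I M k)
  | 0 => ⊥
  | k + 1 => (LinearMap.range (twistedD η k)).comap (smoothForms I M (k + 1)).subtype

/-- The Morse–Novikov cohomology `H^k_η(M)`: `d_η`-closed forms modulo `d_η`-exact forms. -/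
abbrev Cohomology (η : FormField I M 1) (k : ℕ) : Type _ :=
  cocycles η k ⧸ (coboundaries η k).submoduleOf (cocycles η k)

/-- Smooth closed `1`-forms. -/
def IsClosedOneForm (η : FormField I M 1) : Prop :=
  η ∈ smoothForms I M 1 ∧ η.d = 0

end Forms

end MorseNovikov

/-! ### The Inoue surface `S⁰` -/

/-- The data defining an Inoue surface `S⁰`: a matrix in `SL₃(ℤ)` with a real eigenvalue `α > 1`
and a non-real eigenvalue `β` (hence also the eigenvalue `conj β`), with a real eigenvector `a` for
`α` and a complex eigenvector `b` for `β`. -/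
structure InoueData where
  A : Matrix.SpecialLinearGroup (Fin 3) ℤ
  α : ℝ
  β : ℂ
  a : Fin 3 → ℝ
  b : Fin 3 → ℂ
  one_lt_α : 1 < α
  β_im_ne_zero : β.im ≠ 0
  a_ne_zero : a ≠ 0
  b_ne_zero : b ≠ 0
  mulVec_a : ((A : Matrix (Fin 3) (Fin 3) ℤ).map ((↑) : ℤ → ℝ)).mulVec a = α • a
  mulVec_b : ((A : Matrix (Fin 3) (Fin 3) ℤ).map ((↑) : ℤ → ℂ)).mulVec b = β • b

namespace InoueData

variable (D : InoueData)

theorem α_pos : 0 < D.α := zero_lt_one.trans D.one_lt_α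

theorem β_ne_zero : D.β ≠ 0 := fun h ↦ D.β_im_ne_zero (by simp [h])

/-- The transformation `(z, w) ↦ (β z, α w)` of `ℂ × ℍ`. -/
def scaling : Equiv.Perm (ℂ × ℍ) :=
  (Equiv.mulLeft₀ D.β D.β_ne_zero).prodCongr
    (MulAction.toPerm (⟨D.α, D.α_pos⟩ : {x : ℝ // 0 < x}))

/-- The transformation `(z, w) ↦ (z + bᵢ, w + aᵢ)` of `ℂ × ℍ`. -/
def translation (i : Fin 3) : Equiv.Perm (ℂ × ℍ) :=
  (Equiv.addRight (D.b i)).prodCongr (AddAction.toPerm (D.a i))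

/-- The group `G_A` of affine transformations of `ℂ × ℍ`. -/
def group : Subgroup (Equiv.Perm (ℂ × ℍ)) :=
  Subgroup.closure (insert D.scaling (Set.range D.translation))

/-- `g` is `(z, w) ↦ (β ^ n z + ∑ mᵢ bᵢ, α ^ n w + ∑ mᵢ aᵢ)`. -/
def IsNormalForm (g : Equiv.Perm (ℂ × ℍ)) (n : ℤ) (m : Fin 3 → ℤ) : Prop :=
  ∀ p : ℂ × ℍ, (g p).1 = D.β ^ n * p.1 + ∑ i, (m i : ℂ) * D.b i ∧
    ((g p).2 : ℂ) = ((D.α ^ n : ℝ) : ℂ) * p.2 + ((∑ i, (m i : ℝ) * D.a i : ℝ) : ℂ)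

theorem β_mul_sum (m : Fin 3 → ℤ) : D.β * ∑ i, (m i : ℂ) * D.b i =
    ∑ i, ((Matrix.vecMul m (D.A : Matrix (Fin 3) (Fin 3) ℤ) i : ℤ) : ℂ) * D.b i := by
  have h (i : Fin 3) := congrFun D.mulVec_b i
  simp only [Matrix.mulVec, dotProduct, Matrix.map_apply, Pi.smul_apply, smul_eq_mul] at h
  simp only [Finset.mul_sum, Matrix.vecMul, dotProduct, Int.cast_sum, Int.cast_mul, Finset.sum_mul]
  rw [Finset.sum_comm]
  refine Finset.sum_congr rfl fun i _ ↦ ?_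
  rw [mul_left_comm, ← h i, Finset.mul_sum]
  exact Finset.sum_congr rfl fun j _ ↦ by ring

theorem α_mul_sum (m : Fin 3 → ℤ) : D.α * ∑ i, (m i : ℝ) * D.a i =
    ∑ i, ((Matrix.vecMul m (D.A : Matrix (Fin 3) (Fin 3) ℤ) i : ℤ) : ℝ) * D.a i := by
  have h (i : Fin 3) := congrFun D.mulVec_a i
  simp only [Matrix.mulVec, dotProduct, Matrix.map_apply, Pi.smul_apply, smul_eq_mul] at h
  simp only [Finset.mul_sum, Matrix.vecMul, dotProduct, Int.cast_sum, Int.cast_mul, Finset.sum_mul]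
  rw [Finset.sum_comm]
  refine Finset.sum_congr rfl fun i _ ↦ ?_
  rw [mul_left_comm, ← h i, Finset.mul_sum]
  exact Finset.sum_congr rfl fun j _ ↦ by ring

theorem exists_zpow_mul_sum (n : ℤ) (m : Fin 3 → ℤ) : ∃ m' : Fin 3 → ℤ,
    D.β ^ n * ∑ i, (m i : ℂ) * D.b i = ∑ i, (m' i : ℂ) * D.b i ∧
    D.α ^ n * ∑ i, (m i : ℝ) * D.a i = ∑ i, (m' i : ℝ) * D.a i := by
  induction n with
  | zero => exact ⟨m, by simp, by simp⟩
  | succ n ih =>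
    obtain ⟨m', h₁, h₂⟩ := ih
    refine ⟨Matrix.vecMul m' (D.A : Matrix (Fin 3) (Fin 3) ℤ), ?_, ?_⟩
    · rw [← D.β_mul_sum, ← h₁, zpow_add_one₀ D.β_ne_zero]; ring
    · rw [← D.α_mul_sum, ← h₂, zpow_add_one₀ D.α_pos.ne']; ring
  | pred n ih =>
    obtain ⟨m', h₁, h₂⟩ := ih
    have hm : Matrix.vecMul (Matrix.vecMul m' ((D.A⁻¹ : Matrix.SpecialLinearGroup (Fin 3) ℤ) :
        Matrix (Fin 3) (Fin 3) ℤ)) (D.A : Matrix (Fin 3) (Fin 3) ℤ) = m' := by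
      rw [Matrix.vecMul_vecMul, ← Matrix.SpecialLinearGroup.coe_mul]; simp
    refine ⟨Matrix.vecMul m' ((D.A⁻¹ : Matrix.SpecialLinearGroup (Fin 3) ℤ) :
        Matrix (Fin 3) (Fin 3) ℤ), ?_, ?_⟩
    · apply mul_left_cancel₀ D.β_ne_zero
      rw [D.β_mul_sum, hm, ← h₁, zpow_sub_one₀ D.β_ne_zero]
      field_simp [D.β_ne_zero]
    · apply mul_left_cancel₀ D.α_pos.ne'
      rw [D.α_mul_sum, hm, ← h₂, zpow_sub_one₀ D.α_pos.ne']
      field_simp [D.α_pos.ne']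

theorem exists_isNormalForm {g : Equiv.Perm (ℂ × ℍ)} (hg : g ∈ D.group) :
    ∃ n m, D.IsNormalForm g n m := by
  induction hg using Subgroup.closure_induction with
  | mem g hg =>
    rcases hg with rfl | ⟨i, rfl⟩
    · exact ⟨1, 0, fun p ↦ by simp [scaling]⟩
    · refine ⟨0, Pi.single i 1, fun p ↦ ?_⟩
      simp [translation, Pi.single_apply, add_comm]
  | one => exact ⟨0, 0, fun p ↦ by simp⟩
  | mul g h _ _ hg hh =>
    obtain ⟨n, m, hg⟩ := hg
    obtain ⟨n', m', hh⟩ := hh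
    obtain ⟨m'', h₁, h₂⟩ := D.exists_zpow_mul_sum n m'
    refine ⟨n + n', m'' + m, fun p ↦ ⟨?_, ?_⟩⟩
    · rw [Equiv.Perm.mul_apply, (hg _).1, (hh _).1, mul_add, h₁, zpow_add₀ D.β_ne_zero]
      simp only [Pi.add_apply, Int.cast_add, add_mul, Finset.sum_add_distrib]; ring
    · have : (∑ i, ((m'' + m) i : ℝ) * D.a i) =
          D.α ^ n * ∑ i, (m' i : ℝ) * D.a i + ∑ i, (m i : ℝ) * D.a i := by
        rw [h₂]; simp only [Pi.add_apply, Int.cast_add, add_mul, Finset.sum_add_distrib]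
      rw [Equiv.Perm.mul_apply, (hg _).2, (hh _).2, mul_add, this, zpow_add₀ D.α_pos.ne']
      push_cast; ring
  | inv g _ hg =>
    obtain ⟨n, m, hg⟩ := hg
    obtain ⟨m', h₁, h₂⟩ := D.exists_zpow_mul_sum (-n) (-m)
    refine ⟨-n, m', fun p ↦ ?_⟩
    have hp := hg (g⁻¹ p)
    rw [show g (g⁻¹ p) = p from g.apply_symm_apply p] at hp
    rw [← h₁, ← h₂, hp.1, hp.2]
    have hβ := zpow_ne_zero n D.β_ne_zero
    have hα : ((D.α : ℂ) ^ n) ≠ 0 := zpow_ne_zero n (by exact_mod_cast D.α_pos.ne')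
    constructor
    · simp only [zpow_neg, Pi.neg_apply, Int.cast_neg, neg_mul, Finset.sum_neg_distrib]
      field_simp; ring
    · push_cast
      simp only [zpow_neg, Pi.neg_apply, Int.cast_neg, neg_mul, Finset.sum_neg_distrib]
      field_simp; ring

theorem IsNormalForm.ext {D : InoueData} {g h : Equiv.Perm (ℂ × ℍ)} {n : ℤ} {m : Fin 3 → ℤ}
    (hg : D.IsNormalForm g n m) (hh : D.IsNormalForm h n m) : g = h :=
  Equiv.ext fun p ↦ Prod.ext ((hg p).1.trans (hh p).1.symm)
    (UpperHalfPlane.ext ((hg p).2.trans (hh p).2.symm))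

theorem IsNormalForm.im {D : InoueData} {g : Equiv.Perm (ℂ × ℍ)} {n : ℤ} {m : Fin 3 → ℤ}
    (hg : D.IsNormalForm g n m) (p : ℂ × ℍ) : (g p).2.im = D.α ^ n * p.2.im := by
  have := congrArg Complex.im (hg p).2
  rwa [Complex.add_im, Complex.im_ofReal_mul, Complex.ofReal_im, add_zero] at this

/-- The linear map `x ↦ (∑ xᵢ bᵢ, ∑ xᵢ aᵢ)`. -/
def periodMap : (Fin 3 → ℝ) →ₗ[ℝ] ℂ × ℝ where
  toFun x := (∑ i, (x i : ℂ) * D.b i, ∑ i, x i * D.a i)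
  map_add' x y := by simp [add_mul, Finset.sum_add_distrib]
  map_smul' c x := by simp [Finset.mul_sum, mul_assoc]

theorem ker_periodMap : LinearMap.ker D.periodMap = ⊥ := by
  rw [LinearMap.ker_eq_bot']
  intro x hx
  obtain ⟨hb, ha⟩ := Prod.ext_iff.1 hx
  replace hb : ∑ i, (x i : ℂ) * D.b i = 0 := hb
  replace ha : ∑ i, x i * D.a i = 0 := ha
  set B : Matrix (Fin 3) (Fin 3) ℂ := (D.A : Matrix (Fin 3) (Fin 3) ℤ).map ((↑) : ℤ → ℂ) with hB
  let μ : Fin 3 → ℂ := ![D.α, D.β, conj D.β]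
  let v : Fin 3 → Fin 3 → ℂ := ![fun i ↦ (D.a i : ℂ), D.b, fun i ↦ conj (D.b i)]
  have hβ := D.β_im_ne_zero
  have hμ : Function.Injective μ := by
    have h₁ : (D.α : ℂ) ≠ D.β := fun h ↦ hβ (by simp [← h])
    have h₂ : (D.α : ℂ) ≠ conj D.β := fun h ↦ hβ (by simpa using congrArg Complex.im h)
    have h₃ : D.β ≠ conj D.β := fun h ↦ hβ (by
      have := congrArg Complex.im h
      rw [Complex.conj_im] at this
      linarith)
    intro i j hij
    fin_cases i <;> fin_cases j <;> simp_all [μ, eq_comm]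
  have hv (i : Fin 3) : Module.End.HasEigenvector (Matrix.toLin' B) (μ i) (v i) := by
    rw [Module.End.hasEigenvector_iff, Module.End.mem_eigenspace_iff, Matrix.toLin'_apply]
    have ea (j : Fin 3) := congrFun D.mulVec_a j
    have eb (j : Fin 3) := congrFun D.mulVec_b j
    simp only [Matrix.mulVec, dotProduct, Matrix.map_apply, Pi.smul_apply, smul_eq_mul] at ea eb
    fin_cases i
    · refine ⟨funext fun j ↦ ?_, fun h ↦ D.a_ne_zero (funext fun j ↦ ?_)⟩
      · have := congrArg ((↑) : ℝ → ℂ) (ea j)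
        push_cast at this
        simpa [μ, v, Matrix.mulVec, dotProduct, hB] using this
      · simpa [v] using congrFun h j
    · exact ⟨D.mulVec_b, D.b_ne_zero⟩
    · refine ⟨funext fun j ↦ ?_, fun h ↦ D.b_ne_zero (funext fun j ↦ ?_)⟩
      · have := congrArg conj (eb j)
        simpa [μ, v, Matrix.mulVec, dotProduct, hB] using this
      · simpa [v] using congrFun h j
  have hli := Module.End.eigenvectors_linearIndependent' _ μ hμ v hv
  have hunit : IsUnit (Matrix.of v) := Matrix.linearIndependent_rows_iff_isUnit.1 hli
  have hzero : (Matrix.of v).mulVec (fun i ↦ (x i : ℂ)) = 0 := by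
    funext j
    fin_cases j
    · have := congrArg ((↑) : ℝ → ℂ) ha
      push_cast at this
      simpa [v, Matrix.mulVec, dotProduct, mul_comm] using this
    · simpa [v, Matrix.mulVec, dotProduct, mul_comm] using hb
    · have := congrArg conj hb
      simpa [v, Matrix.mulVec, dotProduct, mul_comm] using this
  have := Matrix.mulVec_injective_of_isUnit hunit (hzero.trans (Matrix.mulVec_zero _).symm)
  funext i
  simpa using congrFun this i

instance : ContinuousConstSMul D.group (ℂ × ℍ) where
  continuous_const_smul g := by
    obtain ⟨n, m, h⟩ := D.exists_isNormalForm g.2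
    refine Continuous.prodMk ?_ (UpperHalfPlane.isEmbedding_coe.continuous_iff.2 ?_)
    · refine (?_ : Continuous fun p : ℂ × ℍ ↦ ((g : Equiv.Perm (ℂ × ℍ)) p).1)
      simp only [(h _).1]; fun_prop
    · refine (?_ : Continuous fun p : ℂ × ℍ ↦ (((g : Equiv.Perm (ℂ × ℍ)) p).2 : ℂ))
      simp only [(h _).2]; fun_prop

instance : IsCancelSMul D.group (ℂ × ℍ) where
  left_cancel' g _ _ h := MulAction.injective g h
  right_cancel' g h p hgh := by
    obtain ⟨n, m, hg⟩ := D.exists_isNormalForm g.2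
    obtain ⟨n', m', hh⟩ := D.exists_isNormalForm h.2
    replace hgh : (g : Equiv.Perm (ℂ × ℍ)) p = (h : Equiv.Perm (ℂ × ℍ)) p := hgh
    have hn : n = n' := by
      have := hg.im p
      rw [hgh, hh.im p] at this
      exact zpow_right_injective₀ D.α_pos D.one_lt_α.ne'
        (mul_right_cancel₀ p.2.im_pos.ne' this).symm
    subst hn
    have hm : m = m' := by
      have h₁ := (hg p).1
      have h₂ := (hg p).2
      rw [hgh, (hh p).1] at h₁
      rw [hgh, (hh p).2] at h₂
      replace h₁ := add_left_cancel h₁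
      replace h₂ := Complex.ofReal_injective (add_left_cancel h₂)
      have := LinearMap.ker_eq_bot.1 D.ker_periodMap
        (a₁ := fun i ↦ (m i : ℝ)) (a₂ := fun i ↦ (m' i : ℝ))
        (Prod.ext (by simpa [periodMap] using h₁.symm) (by simpa [periodMap] using h₂.symm))
      funext i
      exact_mod_cast congrFun this i
    subst hm
    exact Subtype.ext (hg.ext hh)

instance : ProperlyDiscontinuousSMul D.group (ℂ × ℍ) where
  finite_disjoint_inter_image := by
    intro K L hK hL
    obtain ⟨c, C, hc, hcC⟩ : ∃ c C : ℝ, 0 < c ∧ ∀ p ∈ K ∪ L, c ≤ p.2.im ∧ p.2.im ≤ C := by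
      have hKL := hK.union hL
      have hcont : Continuous fun p : ℂ × ℍ ↦ p.2.im :=
        UpperHalfPlane.continuous_im.comp continuous_snd
      rcases (K ∪ L).eq_empty_or_nonempty with h | h
      · exact ⟨1, 1, one_pos, by simp [h]⟩
      · obtain ⟨p, -, hp⟩ := hKL.exists_isMinOn h hcont.continuousOn
        obtain ⟨q, -, hq⟩ := hKL.exists_isMaxOn h hcont.continuousOn
        exact ⟨p.2.im, q.2.im, p.2.im_pos, fun r hr ↦ ⟨hp hr, hq hr⟩⟩
    obtain ⟨R, hR⟩ : ∃ R : ℝ, ∀ p ∈ K ∪ L, ‖p.1‖ ≤ R ∧ ‖(p.2 : ℂ)‖ ≤ R := by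
      have hcont : Continuous fun p : ℂ × ℍ ↦ (p.1, (p.2 : ℂ)) :=
        continuous_fst.prodMk (UpperHalfPlane.continuous_coe.comp continuous_snd)
      obtain ⟨R, hR⟩ := (hK.union hL).exists_bound_of_continuousOn hcont.continuousOn
      exact ⟨R, fun p hp ↦
        ⟨(norm_fst_le (p.1, (p.2 : ℂ))).trans (hR p hp),
          (norm_snd_le (p.1, (p.2 : ℂ))).trans (hR p hp)⟩⟩
    obtain ⟨N, hN⟩ := pow_unbounded_of_one_lt (C / c) D.one_lt_α
    obtain ⟨κ, -, hκ⟩ := D.periodMap.exists_antilipschitzWith D.ker_periodMap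
    let T (n : ℤ) : ℝ := max (R + ‖D.β‖ ^ n * R) (R + D.α ^ n * R)
    have hfin : (⋃ n ∈ Set.Icc (-(N : ℤ)) N, ⋃ m ∈ Set.Icc (fun _ : Fin 3 ↦ -⌈κ * T n⌉)
        (fun _ : Fin 3 ↦ ⌈κ * T n⌉),
        {g : D.group | D.IsNormalForm g n m}).Finite :=
      (Set.finite_Icc _ _).biUnion fun n _ ↦ (Set.finite_Icc _ _).biUnion fun m _ ↦
        Set.Subsingleton.finite fun g hg h hh ↦ Subtype.ext (IsNormalForm.ext hg hh)
    refine hfin.subset ?_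
    rintro g ⟨_, ⟨p, hpK, rfl⟩, hpL⟩
    replace hpL : (g : Equiv.Perm (ℂ × ℍ)) p ∈ L := hpL
    obtain ⟨n, m, hg⟩ := D.exists_isNormalForm g.2
    have hp := Or.inl (b := p ∈ L) hpK
    have hgp := Or.inr (a := (g : Equiv.Perm (ℂ × ℍ)) p ∈ K) hpL
    have him := hg.im p
    have hc₁ := hcC p hp
    have hc₂ := hcC _ hgp
    rw [him] at hc₂
    have hCpos : 0 < C := hc.trans_le (hc₁.1.trans hc₁.2)
    have hlt {k : ℤ} (hk : D.α ^ k ≤ C / c) : k ≤ N := by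
      by_contra hcon
      have : D.α ^ (N : ℤ) ≤ D.α ^ k := zpow_le_zpow_right₀ D.one_lt_α.le (by omega)
      rw [zpow_natCast] at this
      linarith
    have hαn := zpow_pos D.α_pos n
    have hn₁ : n ≤ N := hlt <| by
      rw [le_div_iff₀ hc]
      exact (mul_le_mul_of_nonneg_left hc₁.1 hαn.le).trans hc₂.2
    have hn₂ : -n ≤ N := hlt <| by
      rw [zpow_neg, le_div_iff₀ hc, inv_mul_le_iff₀ hαn]
      exact hc₂.1.trans (mul_le_mul_of_nonneg_left hc₁.2 hαn.le)
    have hnorm : ‖D.periodMap fun i ↦ (m i : ℝ)‖ ≤ T n := by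
      refine max_le ((le_max_left _ _).trans' ?_) ((le_max_right _ _).trans' ?_)
      · have h : (D.periodMap fun i ↦ (m i : ℝ)).1 =
            ((g : Equiv.Perm (ℂ × ℍ)) p).1 - D.β ^ n * p.1 := by
          rw [(hg p).1]; simp [periodMap]
        rw [h]
        refine (norm_sub_le _ _).trans (add_le_add (hR _ hgp).1 ?_)
        rw [norm_mul, norm_zpow]
        exact mul_le_mul_of_nonneg_left (hR p hp).1 (zpow_nonneg (norm_nonneg _) _)
      · have h : (((D.periodMap fun i ↦ (m i : ℝ)).2 : ℝ) : ℂ) =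
            (((g : Equiv.Perm (ℂ × ℍ)) p).2 : ℂ) - ((D.α ^ n : ℝ) : ℂ) * p.2 := by
          rw [(hg p).2]; simp [periodMap]
        rw [← Complex.norm_real, h]
        refine (norm_sub_le _ _).trans (add_le_add (hR _ hgp).2 ?_)
        rw [norm_mul, Complex.norm_real, Real.norm_of_nonneg hαn.le]
        exact mul_le_mul_of_nonneg_left (hR p hp).2 hαn.le
    have hm (i : Fin 3) : |m i| ≤ ⌈κ * T n⌉ := by
      have h₁ : ‖fun i ↦ (m i : ℝ)‖ ≤ κ * ‖D.periodMap fun i ↦ (m i : ℝ)‖ := by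
        simpa using hκ.le_mul_dist (fun i ↦ (m i : ℝ)) 0
      have h₂ : |(m i : ℝ)| ≤ κ * T n :=
        (norm_le_pi_norm (fun i ↦ (m i : ℝ)) i).trans
          (h₁.trans (mul_le_mul_of_nonneg_left hnorm κ.2))
      exact_mod_cast h₂.trans (Int.le_ceil _)
    simp only [Set.mem_iUnion]
    exact ⟨n, ⟨by omega, hn₁⟩, m, ⟨fun i ↦ (abs_le.1 (hm i)).1, fun i ↦ (abs_le.1 (hm i)).2⟩, hg⟩

/-- The Inoue surface `S⁰ = (ℂ × ℍ) / G_A`. -/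
abbrev Surface : Type := MulAction.orbitRel.Quotient D.group (ℂ × ℍ)

/-- The real model of the (complex two-dimensional) surface. -/
abbrev model : ModelWithCorners ℝ (ℂ × ℂ) (ModelProd ℂ ℂ) := 𝓘(ℝ, ℂ).prod 𝓘(ℝ, ℂ)

theorem isLocalHomeomorph_mk :
    IsLocalHomeomorph (Quotient.mk (MulAction.orbitRel D.group (ℂ × ℍ))) :=
  isQuotientCoveringMap_quotientMk_of_properlyDiscontinuousSMul.isCoveringMap.isLocalHomeomorph

/-- `S⁰` is a smooth manifold: the changes of charts are locally given by elements of `G_A`. -/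
instance : IsManifold model ∞ D.Surface := by
  refine isManifold_of_contDiffOn _ _ _ ?_
  rintro _ _ ⟨x, rfl⟩ ⟨y, rfl⟩
  generalize (Quotient.mk_surjective (s := MulAction.orbitRel D.group
    (ℂ × ℍ))).hasRightInverse.choose x = p
  generalize (Quotient.mk_surjective (s := MulAction.orbitRel D.group
    (ℂ × ℍ))).hasRightInverse.choose y = p'
  have hq := D.isLocalHomeomorph_mk
  rintro u ⟨hu, -⟩
  set s := hq.localInverseAt p
  set s' := hq.localInverseAt p'
  set e := chartAt (ModelProd ℂ ℂ) p
  set e' := chartAt (ModelProd ℂ ℂ) p'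
  have hu₁ : u ∈ e.target := hu.1.1
  have hu₂ : s.symm (e.symm u) ∈ s'.source := hu.2.1
  have hsym : s.symm = Quotient.mk (MulAction.orbitRel D.group (ℂ × ℍ)) :=
    hq.localInverseAt_symm p
  have hsym' : s'.symm = Quotient.mk (MulAction.orbitRel D.group (ℂ × ℍ)) :=
    hq.localInverseAt_symm p'
  obtain ⟨g, hg⟩ : s' (s.symm (e.symm u)) ∈ MulAction.orbit D.group (e.symm u) := by
    apply Quotient.exact (s := MulAction.orbitRel D.group (ℂ × ℍ))
    rw [← congrFun hsym', s'.left_inv hu₂, hsym]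
  obtain ⟨n, m, hnm⟩ := D.exists_isNormalForm g.2
  have hmem : ∀ᶠ v in nhds u, g • e.symm v ∈ s'.target := by
    have hcont : ContinuousAt (fun v ↦ g • e.symm v) u :=
      (e.continuousAt_symm hu₁).const_smul g
    refine hcont.eventually_mem (s'.open_target.mem_nhds ?_)
    exact (congrArg (· ∈ s'.target) hg).mpr (s'.map_source hu₂)
  have hev : ∀ᶠ v in nhds u, (model ∘ ((s.trans e).symm.trans (s'.trans e')) ∘ model.symm) v =
      (D.β ^ n * v.1 + ∑ i, (m i : ℂ) * D.b i,
        ((D.α ^ n : ℝ) : ℂ) * v.2 + ((∑ i, (m i : ℝ) * D.a i : ℝ) : ℂ)) := by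
    filter_upwards [hmem, e.open_target.mem_nhds hu₁] with v hv hve
    have h₁ : s' (s.symm (e.symm v)) = g • e.symm v := by
      have : s.symm (e.symm v) = s'.symm (g • e.symm v) := by
        rw [hsym, hsym']
        exact Quotient.sound (s := MulAction.orbitRel D.group (ℂ × ℍ)) ⟨g⁻¹, inv_smul_smul _ _⟩
      rw [this, s'.right_inv hv]
    have h₂ : (((e.symm v).1, ((e.symm v).2 : ℂ)) : ℂ × ℂ) = v := e.right_inv hve
    have h₃ := hnm (e.symm v)
    rw [show (e.symm v).1 = v.1 from (Prod.ext_iff.1 h₂).1,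
      show ((e.symm v).2 : ℂ) = v.2 from (Prod.ext_iff.1 h₂).2] at h₃
    change e' (s' (s.symm (e.symm v))) = _
    rw [h₁]
    exact Prod.ext h₃.1 h₃.2
  refine ContDiffAt.contDiffWithinAt (ContDiffAt.congr_of_eventuallyEq ?_ hev)
  fun_prop

/-- The fibration `S⁰ → S¹`, `[z, w] ↦ exp (2 π i log_α (Im w))`. -/
def proj : D.Surface → Circle :=
  Quotient.lift (fun p : ℂ × ℍ ↦ Circle.exp (2 * Real.pi * Real.logb D.α p.2.im)) <| by
    rintro p q ⟨g, hg⟩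
    obtain ⟨n, m, h⟩ := D.exists_isNormalForm g.2
    replace hg : (g : Equiv.Perm (ℂ × ℍ)) q = p := hg
    have hα := Real.log_pos D.one_lt_α
    have : Real.logb D.α p.2.im = n + Real.logb D.α q.2.im := by
      rw [← hg, h.im, Real.logb_mul (zpow_pos D.α_pos n).ne' q.2.im_pos.ne', Real.logb, Real.log_zpow,
        mul_div_assoc, div_self hα.ne', mul_one]
    simp only [this, mul_add, Circle.exp_add]
    rw [mul_comm (2 * Real.pi) (n : ℝ), Circle.exp_int_mul_two_pi, one_mul]

/-- The form `ϑ`: the pullback by `proj` of the volume form `dζ / (2 π i ζ)` of the circle of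
length `1`. -/
def vartheta : MorseNovikov.FormField model D.Surface 1 := fun x ↦
  ContinuousAlternatingMap.ofSubsingleton ℝ (TangentSpace model x) ℝ (0 : Fin 1)
    ((2 * Real.pi)⁻¹ • Complex.imCLM ∘L
      (ContinuousLinearMap.mul ℝ ℂ (conj (D.proj x : ℂ))) ∘L
      mvfderiv model (fun y : D.Surface ↦ (D.proj y : ℂ)) x)

end InoueData

end

open MeasureTheory Filter Topology Set

/-! ### Smooth families of alternating maps -/

section SmoothAlternating

variable {E F G : Type*} [NormedAddCommGroup E] [NormedSpace ℝ E]
  [NormedAddCommGroup F] [NormedSpace ℝ F] [NormedAddCommGroup G] [NormedSpace ℝ G] {k : ℕ}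

/-! In the coordinates `w = x + i α ^ s` the surface is the mapping torus of the linear map `B =
D.fiberMap`, `(z, x) ↦ (β z, α x)`, on the torus `W / L` with `W = ℂ × ℝ` and `L = D.lattice`, and
`ϑ` lifts to `ds`. Let `F` be a primitive of the lift of `η` on the universal covering `W × ℝ`, and
let `t` be its growth under `S (w, s) = (B w, s + 1)` (`IsPotential`). Multiplication by `exp (-F)`
turns `d_η` into `d`, and it turns forms on the surface into `L`-periodic forms `τ` on `W × ℝ` with
`S^* τ = c τ`, `c = exp (-t)`. Hence the cohomology depends on `t` alone.

The complex of these twisted forms is computed in the manner of the Wang sequence, from three facts.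
A closed periodic form of positive degree is a constant form on `W` plus `d` of a periodic form
(`exists_eq_cylinder_add_extDeriv`). A nonzero constant form is not `d` of a periodic one
(`eq_zero_of_cylinder_eq_extDeriv`). The operator `S^* - c` is onto on periodic forms
(`exists_shiftPullback_sub_smul_eq`). Let `E^k` be the kernel of `B^* - c` on the alternating
`k`-forms of `W`. If this kernel meets the image of `B^* - c` trivially, then the forms `e` and `ds
∧ e'` identify `H^(k+1)` with `E^(k+1) ⊕ E^k`; moreover `H^0 = E^0`.

It remains to find the real eigenvalues of `B^*`. Since `B` preserves the lattice through `A`, its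
determinant is `1`, so `|β|² = α⁻¹`. In degrees `0, 1, 2, 3` the only real eigenvalues are `1, α,
α⁻¹, 1`, each simple; the others are `β`, `α β` and their conjugates. Each of them contributes one
dimension in its own degree and one in the next, which gives all the groups. The same computation
for `c = 1` in degree one shows that a closed one-form is `t ϑ` up to an exact form, and `t` is the
growth of its primitive. -/

instance ContinuousAlternatingMap.finiteDimensional [FiniteDimensional ℝ E] :
    FiniteDimensional ℝ (E [⋀^Fin k]→L[ℝ] ℝ) :=
  Module.Finite.of_injective
    ({ toFun := fun f ↦ f.toContinuousMultilinearMap.toMultilinearMap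
       map_add' := fun _ _ ↦ rfl
       map_smul' := fun _ _ ↦ rfl } :
      (E [⋀^Fin k]→L[ℝ] ℝ) →ₗ[ℝ] MultilinearMap ℝ (fun _ : Fin k ↦ E) ℝ)
    fun _ _ h ↦ ContinuousAlternatingMap.ext fun v ↦ congrArg (fun g ↦ g v) h

/-- A family of alternating maps on a finite-dimensional space is smooth as soon as its values on
all tuples of vectors are. -/
theorem contDiffWithinAt_alternating_of_apply [FiniteDimensional ℝ E] {n : WithTop ℕ∞}
    {f : F → E [⋀^Fin k]→L[ℝ] ℝ} {s : Set F} {x : F}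
    (h : ∀ v : Fin k → E, ContDiffWithinAt ℝ n (fun y ↦ f y v) s x) :
    ContDiffWithinAt ℝ n f s x := by
  let b := Module.finBasis ℝ E
  let ev : (E [⋀^Fin k]→L[ℝ] ℝ) →ₗ[ℝ] ((Fin k → Fin (Module.finrank ℝ E)) → ℝ) :=
    { toFun := fun g r ↦ g fun i ↦ b (r i)
      map_add' := fun _ _ ↦ rfl
      map_smul' := fun _ _ ↦ rfl }
  have hev : LinearMap.ker ev = ⊥ := by
    refine LinearMap.ker_eq_bot'.2 fun g hg ↦ ?_
    have : g.toContinuousMultilinearMap.toMultilinearMap = 0 :=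
      Module.Basis.ext_multilinear (fun _ ↦ b) fun r ↦ congrFun hg r
    exact ContinuousAlternatingMap.ext fun v ↦ congrArg (fun g ↦ g v) this
  -- The left inverse rebuilds `f` linearly from its values on basis tuples, which are finitely many
  -- smooth scalar functions.
  obtain ⟨l, hl⟩ := ev.exists_leftInverse_of_injective hev
  have : f = fun y ↦ LinearMap.toContinuousLinearMap l (ev (f y)) := by
    funext y
    exact (LinearMap.congr_fun hl (f y)).symm
  rw [this]
  refine (LinearMap.toContinuousLinearMap l).contDiff.contDiffAt.comp_contDiffWithinAt x ?_
  exact contDiffWithinAt_pi.2 fun r ↦ h _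

/-- The composition of a smooth family of alternating maps with a smooth family of linear maps is
smooth. -/
theorem ContDiffWithinAt.compContinuousLinearMap [FiniteDimensional ℝ E] {n : WithTop ℕ∞}
    {f : F → G [⋀^Fin k]→L[ℝ] ℝ} {g : F → E →L[ℝ] G} {s : Set F} {x : F}
    (hf : ContDiffWithinAt ℝ n f s x) (hg : ContDiffWithinAt ℝ n g s x) :
    ContDiffWithinAt ℝ n (fun y ↦ (f y).compContinuousLinearMap (g y)) s x := by
  refine contDiffWithinAt_alternating_of_apply fun v ↦ ?_
  have h₁ : ContDiffWithinAt ℝ n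
      (fun y ↦ ContinuousMultilinearMap.compContinuousLinearMapContinuousMultilinear ℝ
        (fun _ : Fin k ↦ E) (fun _ ↦ G) ℝ (fun _ ↦ g y)) s x :=
    (ContinuousMultilinearMap.contDiff _).contDiffAt.comp_contDiffWithinAt x
      (contDiffWithinAt_pi.2 fun _ ↦ hg)
  have h₂ : ContDiffWithinAt ℝ n (fun y ↦ (f y).toContinuousMultilinearMap) s x :=
    (ContinuousAlternatingMap.toContinuousMultilinearMapLI (𝕜 := ℝ) (E := G) (F := ℝ)
      (ι := Fin k)).toContinuousLinearMap.contDiff.contDiffAt.comp_contDiffWithinAt x hf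
  exact (ContinuousMultilinearMap.apply ℝ (fun _ : Fin k ↦ E) ℝ v).contDiff.contDiffAt.comp_contDiffWithinAt
    x (h₁.clm_apply h₂)

theorem ContDiffAt.compContinuousLinearMap [FiniteDimensional ℝ E] {n : WithTop ℕ∞}
    {f : F → G [⋀^Fin k]→L[ℝ] ℝ} {g : F → E →L[ℝ] G} {x : F}
    (hf : ContDiffAt ℝ n f x) (hg : ContDiffAt ℝ n g x) :
    ContDiffAt ℝ n (fun y ↦ (f y).compContinuousLinearMap (g y)) x :=
  ContDiffWithinAt.compContinuousLinearMap hf hg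

theorem ContDiff.compContinuousLinearMap [FiniteDimensional ℝ E] {n : WithTop ℕ∞}
    {f : F → G [⋀^Fin k]→L[ℝ] ℝ} {g : F → E →L[ℝ] G}
    (hf : ContDiff ℝ n f) (hg : ContDiff ℝ n g) :
    ContDiff ℝ n (fun y ↦ (f y).compContinuousLinearMap (g y)) :=
  contDiff_iff_contDiffAt.2 fun _ ↦ hf.contDiffAt.compContinuousLinearMap hg.contDiffAt

theorem contDiff_curryLeft {n : WithTop ℕ∞} :
    ContDiff ℝ n fun f : E [⋀^Fin (k + 1)]→L[ℝ] ℝ ↦ f.curryLeft :=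
  IsBoundedLinearMap.contDiff ⟨⟨fun _ _ ↦ rfl, fun _ _ ↦ rfl⟩, 1, one_pos, fun f ↦ by simp⟩

theorem contDiff_extDeriv {σ : E → E [⋀^Fin k]→L[ℝ] ℝ} (hσ : ContDiff ℝ ∞ σ) :
    ContDiff ℝ ∞ (extDeriv σ) := by
  have h : ContDiff ℝ ∞ (fderiv ℝ σ) := hσ.fderiv_right (by simp)
  exact (ContinuousAlternatingMap.alternatizeUncurryFinCLM ℝ E ℝ (n := k)).contDiff.comp h

end SmoothAlternating

/-! ### Integrals depending smoothly on a parameter -/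

section ParametricIntegral

universe u

variable {P : Type*} [NormedAddCommGroup P] [NormedSpace ℝ P] [SecondCountableTopology P]
  [MeasurableSpace P] [OpensMeasurableSpace P]
  {E F : Type u} [NormedAddCommGroup E] [NormedSpace ℝ E] [FiniteDimensional ℝ E]
  [NormedAddCommGroup F] [NormedSpace ℝ F]
  {μ : Measure P} [IsFiniteMeasure μ] {K : Set P}

omit [NormedSpace ℝ P] [NormedSpace ℝ F] in
theorem integrable_of_continuous_of_ae_mem (hK : IsCompact K) (hμ : ∀ᵐ p ∂μ, p ∈ K) {f : P → F}
    (hf : Continuous f) : Integrable f μ := by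
  obtain ⟨C, hC⟩ := hK.exists_bound_of_continuousOn hf.continuousOn
  exact (integrable_const C).mono' hf.aestronglyMeasurable (hμ.mono fun p hp ↦ hC p hp)

omit [FiniteDimensional ℝ E] [SecondCountableTopology P] [MeasurableSpace P]
  [OpensMeasurableSpace P] in
theorem fderiv_partial_eq {f : E → P → F} (hf : ContDiff ℝ ∞ fun x : E × P ↦ f x.1 x.2)
    (x : E) (p : P) : HasFDerivAt (f · p)
      ((fderiv ℝ (fun x : E × P ↦ f x.1 x.2) (x, p)) ∘L ContinuousLinearMap.inl ℝ E P) x := by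
  have h₁ := ((hf.differentiable (by simp)) (x, p)).hasFDerivAt
  have h₂ : HasFDerivAt (fun y : E ↦ (y, p)) (ContinuousLinearMap.inl ℝ E P) x :=
    hasFDerivAt_prodMk_left x p
  exact h₁.comp x h₂

omit [FiniteDimensional ℝ E] [SecondCountableTopology P] [MeasurableSpace P]
  [OpensMeasurableSpace P] in
theorem contDiff_fderiv_partial {f : E → P → F} (hf : ContDiff ℝ ∞ fun x : E × P ↦ f x.1 x.2) :
    ContDiff ℝ ∞ fun x : E × P ↦ fderiv ℝ (f · x.2) x.1 := by
  have : (fun x : E × P ↦ fderiv ℝ (f · x.2) x.1) = fun x ↦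
      (fderiv ℝ (fun x : E × P ↦ f x.1 x.2) x) ∘L ContinuousLinearMap.inl ℝ E P :=
    funext fun x ↦ (fderiv_partial_eq hf x.1 x.2).fderiv
  rw [this]
  exact (hf.fderiv_right (m := ∞) (by simp)).clm_comp contDiff_const

/-- Differentiation under the integral sign for smooth integrands and compactly supported finite
measures. -/
theorem hasFDerivAt_integral_of_contDiff (hK : IsCompact K) (hμ : ∀ᵐ p ∂μ, p ∈ K)
    {f : E → P → F} (hf : ContDiff ℝ ∞ fun x : E × P ↦ f x.1 x.2) (x : E) :
    HasFDerivAt (fun x ↦ ∫ p, f x p ∂μ) (∫ p, fderiv ℝ (f · p) x ∂μ) x := by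
  have hf' := (contDiff_fderiv_partial hf).continuous
  -- The unit ball is compact because `E` is finite-dimensional, so the derivative is bounded on the
  -- ball times `K`; a constant is integrable for a finite measure and serves as the dominating
  -- function.
  obtain ⟨C, hC⟩ := ((isCompact_closedBall x 1).prod hK).exists_bound_of_continuousOn
    hf'.continuousOn
  have hc (y : E) : Continuous (f y) := hf.continuous.comp (by fun_prop : Continuous fun p ↦ (y, p))
  have hc' : Continuous fun p ↦ fderiv ℝ (f · p) x :=
    hf'.comp (by fun_prop : Continuous fun p : P ↦ (x, p))
  refine hasFDerivAt_integral_of_dominated_of_fderiv_le (bound := fun _ ↦ C)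
    (F' := fun x p ↦ fderiv ℝ (f · p) x)
    (Metric.closedBall_mem_nhds x one_pos) (.of_forall fun y ↦ (hc y).aestronglyMeasurable)
    (integrable_of_continuous_of_ae_mem hK hμ (hc x)) hc'.aestronglyMeasurable
    (hμ.mono fun p hp y hy ↦ hC (y, p) ⟨hy, hp⟩) (integrable_const C)
    (.of_forall fun p y _ ↦ (fderiv_partial_eq hf y p).differentiableAt.hasFDerivAt)

/-- Differentiation under the integral gives an integral of the same kind with values in `E →L[ℝ]
F`, so induction on the order works once `F` is allowed to vary. This is why `E` and `F` share a
universe. -/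
theorem contDiff_integral_of_contDiff (hK : IsCompact K) (hμ : ∀ᵐ p ∂μ, p ∈ K)
    {f : E → P → F} (hf : ContDiff ℝ ∞ fun x : E × P ↦ f x.1 x.2) :
    ContDiff ℝ ∞ fun x ↦ ∫ p, f x p ∂μ := by
  refine contDiff_infty.2 fun n ↦ ?_
  induction n generalizing F with
  | zero =>
    exact contDiff_zero.2 (continuous_iff_continuousAt.2 fun x ↦
      (hasFDerivAt_integral_of_contDiff hK hμ hf x).continuousAt)
  | succ n ih =>
    have h : fderiv ℝ (fun x ↦ ∫ p, f x p ∂μ) = fun x ↦ ∫ p, fderiv ℝ (f · p) x ∂μ :=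
      funext fun x ↦ (hasFDerivAt_integral_of_contDiff hK hμ hf x).fderiv
    push_cast
    refine contDiff_succ_iff_fderiv.2 ⟨fun x ↦
      (hasFDerivAt_integral_of_contDiff hK hμ hf x).differentiableAt, by simp, ?_⟩
    rw [h]
    exact ih (f := fun x p ↦ fderiv ℝ (f · p) x) (contDiff_fderiv_partial hf)

theorem clm_fderiv_integral [CompleteSpace F] {G : Type*} [NormedAddCommGroup G] [NormedSpace ℝ G]
    [CompleteSpace G] (hK : IsCompact K) (hμ : ∀ᵐ p ∂μ, p ∈ K)
    {f : E → P → F} (hf : ContDiff ℝ ∞ fun x : E × P ↦ f x.1 x.2) (T : (E →L[ℝ] F) →L[ℝ] G) (x : E) :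
    T (fderiv ℝ (fun x ↦ ∫ p, f x p ∂μ) x) = ∫ p, T (fderiv ℝ (f · p) x) ∂μ := by
  have hc' : Continuous fun p ↦ fderiv ℝ (f · p) x :=
    (contDiff_fderiv_partial hf).continuous.comp (by fun_prop : Continuous fun p : P ↦ (x, p))
  rw [(hasFDerivAt_integral_of_contDiff hK hμ hf x).fderiv]
  exact (T.integral_comp_comm (integrable_of_continuous_of_ae_mem hK hμ hc')).symm

/-- The exterior derivative commutes with integration over parameters. -/
theorem extDeriv_integral {k : ℕ} (hK : IsCompact K) (hμ : ∀ᵐ p ∂μ, p ∈ K)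
    {f : E → P → E [⋀^Fin k]→L[ℝ] ℝ} (hf : ContDiff ℝ ∞ fun x : E × P ↦ f x.1 x.2) (x : E) :
    extDeriv (fun x ↦ ∫ p, f x p ∂μ) x = ∫ p, extDeriv (f · p) x ∂μ :=
  clm_fderiv_integral hK hμ hf (ContinuousAlternatingMap.alternatizeUncurryFinCLM ℝ E ℝ (n := k)) x

end ParametricIntegral

/-! ### A homotopy formula -/

section Homotopy

variable {V : Type*} [NormedAddCommGroup V] [NormedSpace ℝ V] {k : ℕ}

/-- The contraction of the form `σ` with the velocity of the homotopy `u ↦ u + τ • (x - p u)`,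
pulled back by this homotopy at time `τ`. -/
noncomputable def homotopyContraction (p : V →L[ℝ] V) (σ : V → V [⋀^Fin (k + 1)]→L[ℝ] ℝ) (x : V) (τ : ℝ) (u : V) :
    V [⋀^Fin k]→L[ℝ] ℝ :=
  ((σ (u + τ • (x - p u))).curryLeft (x - p u)).compContinuousLinearMap
    (ContinuousLinearMap.id ℝ V - τ • p)

/-- Cartan's formula for a homotopy `φ_τ`: the derivative of `φ_τ^* σ` is `d` of the contracted
pullback plus the contraction of `dσ`, and the second term vanishes for closed `σ`. -/
theorem hasDerivAt_homotopy {p : V →L[ℝ] V} {σ : V → V [⋀^Fin (k + 1)]→L[ℝ] ℝ}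
    (hσ : Differentiable ℝ σ) (hd : extDeriv σ = 0) (x u : V) (τ : ℝ) :
    HasDerivAt (fun τ : ℝ ↦ (σ (u + τ • (x - p u))).compContinuousLinearMap
      (ContinuousLinearMap.id ℝ V - τ • p)) (extDeriv (homotopyContraction p σ x τ) u) τ := by
  set A : V →L[ℝ] V := ContinuousLinearMap.id ℝ V - τ • p with hA
  set y := u + τ • (x - p u) with hy
  have h₁ : HasDerivAt (fun τ : ℝ ↦ σ (u + τ • (x - p u))) (fderiv ℝ σ y (x - p u)) τ := by
    have : HasDerivAt (fun τ : ℝ ↦ u + τ • (x - p u)) (x - p u) τ := by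
      simpa using ((hasDerivAt_id τ).smul_const (x - p u)).const_add u
    exact (hσ y).hasFDerivAt.comp_hasDerivAt τ this
  have h₂ : HasDerivAt (fun τ : ℝ ↦ ContinuousLinearMap.id ℝ V - τ • p) (-p) τ := by
    simpa using ((hasDerivAt_id τ).smul_const p).const_sub (ContinuousLinearMap.id ℝ V)
  have h₃ := (HasFDerivAt.continuousAlternatingMapCompContinuousLinearMap
    h₁.hasFDerivAt h₂.hasFDerivAt).hasDerivAt
  refine h₃.congr_deriv ?_
  have h₄ : HasFDerivAt (homotopyContraction p σ x τ)
      (ContinuousAlternatingMap.compContinuousLinearMapCLM A ∘L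
        (((ContinuousAlternatingMap.curryLeftLI (𝕜 := ℝ) (E := V) (F := ℝ)
          (n := k)).toContinuousLinearMap ∘L
          (fderiv ℝ σ y ∘L A)).flip (x - p u) + (σ y).curryLeft ∘L (-p))) u := by
    have h₅ : HasFDerivAt (fun u ↦ u + τ • (x - p u)) A u := by
      have := (hasFDerivAt_id u).fun_add ((p.hasFDerivAt.const_sub x).fun_const_smul τ)
      rwa [smul_neg, ← sub_eq_add_neg] at this
    have h₆ : HasFDerivAt (fun u ↦ x - p u) (-p) u := p.hasFDerivAt.const_sub x
    have h₇ : HasFDerivAt (fun u ↦ (σ (u + τ • (x - p u))).curryLeft)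
        ((ContinuousAlternatingMap.curryLeftLI (𝕜 := ℝ) (E := V) (F := ℝ)
          (n := k)).toContinuousLinearMap ∘L (fderiv ℝ σ y ∘L A)) u := by
      have h₈ : HasFDerivAt (fun u ↦ σ (u + τ • (x - p u))) (fderiv ℝ σ y ∘L A) u :=
        (hσ y).hasFDerivAt.comp u h₅
      refine HasFDerivAt.comp (g := fun f : V [⋀^Fin (k + 1)]→L[ℝ] ℝ ↦ f.curryLeft) u ?_ h₈
      exact ContinuousLinearMap.hasFDerivAt
        (ContinuousAlternatingMap.curryLeftLI (𝕜 := ℝ) (E := V) (F := ℝ)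
          (n := k)).toContinuousLinearMap
    have h₈ := h₇.clm_apply h₆
    rw [add_comm] at h₈
    exact (ContinuousAlternatingMap.compContinuousLinearMapCLM A).hasFDerivAt.comp u h₈
  rw [extDeriv, h₄.fderiv]
  simp only [← hA, ← hy]
  clear h₄ h₃ h₂ h₁
  clear_value A y
  generalize x - p u = X
  ext v
  -- Closedness on the tuple `X, A v₀, …, A v_k` exchanges the derivative of `σ` along `X` for the
  -- derivatives along the `A v_i`. The terms containing `-p` occur alike on both sides: they come
  -- from the linear part of the homotopy and from its velocity.
  have hzero := congrArg (fun f ↦ f (Fin.cons X (A ∘ v))) (congrFun hd y)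
  have hrem (i : Fin (k + 1)) : i.succ.removeNth (Fin.cons X (A ∘ v) : Fin (k + 2) → V) =
      Matrix.vecCons X (A ∘ i.removeNth v) := by
    funext j
    refine Fin.cases ?_ (fun j ↦ ?_) j <;> simp [Fin.removeNth]
  simp [extDeriv, ContinuousAlternatingMap.alternatizeUncurryFin_apply,
    Fin.sum_univ_succ (n := k + 1), pow_succ, hrem] at hzero
  simp [ContinuousAlternatingMap.fderivCompContinuousLinearMap_eq_alternatizeUncurryFin,
    ContinuousAlternatingMap.alternatizeUncurryFin_apply]
  linarith

end Homotopy

/-! ### Periodic forms on `W × ℝ` -/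

namespace MappingTorus

section Periodic

variable {W : Type*} [NormedAddCommGroup W] [NormedSpace ℝ W] {k : ℕ}

/-- The smooth forms on `W × ℝ` that are invariant under the translations by the vectors of the
lattice `L` of `W`. -/
def periodicForms (L : Submodule ℤ W) (k : ℕ) :
    Submodule ℝ (W × ℝ → (W × ℝ) [⋀^Fin k]→L[ℝ] ℝ) where
  carrier := {σ | ContDiff ℝ ∞ σ ∧ ∀ m ∈ L, ∀ v, σ (v + (m, 0)) = σ v}
  add_mem' := fun hσ hτ ↦ ⟨hσ.1.add hτ.1, fun m hm v ↦ by
    rw [Pi.add_apply, Pi.add_apply, hσ.2 m hm, hτ.2 m hm]⟩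
  zero_mem' := ⟨contDiff_const (c := 0), fun _ _ _ ↦ rfl⟩
  smul_mem' := fun c σ hσ ↦ ⟨hσ.1.const_smul c, fun m hm v ↦ by
    rw [Pi.smul_apply, Pi.smul_apply, hσ.2 m hm]⟩

/-- An alternating map on `W` as a form on `W × ℝ` with constant coefficients. -/
noncomputable def cylinder (k : ℕ) :
    (W [⋀^Fin k]→L[ℝ] ℝ) →ₗ[ℝ] (W × ℝ → (W × ℝ) [⋀^Fin k]→L[ℝ] ℝ) where
  toFun c := fun _ ↦ c.compContinuousLinearMap (ContinuousLinearMap.fst ℝ W ℝ)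
  map_add' _ _ := rfl
  map_smul' _ _ := rfl

theorem cylinder_apply (c : W [⋀^Fin k]→L[ℝ] ℝ) (v : W × ℝ) :
    cylinder k c v = c.compContinuousLinearMap (ContinuousLinearMap.fst ℝ W ℝ) := rfl

theorem cylinder_mem_periodicForms (L : Submodule ℤ W) (c : W [⋀^Fin k]→L[ℝ] ℝ) :
    cylinder k c ∈ periodicForms L k :=
  ⟨contDiff_const, fun _ _ _ ↦ rfl⟩

theorem extDeriv_cylinder (c : W [⋀^Fin k]→L[ℝ] ℝ) : extDeriv (cylinder k c) = 0 := by
  funext v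
  have : fderiv ℝ (cylinder k c) v = 0 := fderiv_const_apply _
  rw [extDeriv, this]
  exact map_zero (ContinuousAlternatingMap.alternatizeUncurryFinCLM ℝ (W × ℝ) ℝ (n := k))

theorem extDeriv_mem_periodicForms {L : Submodule ℤ W}
    {σ : W × ℝ → (W × ℝ) [⋀^Fin k]→L[ℝ] ℝ} (hσ : σ ∈ periodicForms L k) :
    extDeriv σ ∈ periodicForms L (k + 1) := by
  refine ⟨contDiff_extDeriv hσ.1, fun m hm v ↦ ?_⟩
  have h : (fun v ↦ σ (v + (m, 0))) = σ := funext fun v ↦ hσ.2 m hm v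
  rw [extDeriv, extDeriv, ← fderiv_comp_add_right, h]

theorem extDeriv_add_of_contDiff {E : Type*} [NormedAddCommGroup E] [NormedSpace ℝ E]
    {σ τ : E → E [⋀^Fin k]→L[ℝ] ℝ} (hσ : ContDiff ℝ ∞ σ) (hτ : ContDiff ℝ ∞ τ) :
    extDeriv (σ + τ) = extDeriv σ + extDeriv τ :=
  funext fun v ↦ extDeriv_add (hσ.differentiable (by simp) v) (hτ.differentiable (by simp) v)

theorem extDeriv_const_smul {E : Type*} [NormedAddCommGroup E] [NormedSpace ℝ E]
    (c : ℝ) (σ : E → E [⋀^Fin k]→L[ℝ] ℝ) : extDeriv (c • σ) = c • extDeriv σ :=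
  funext fun _ ↦ extDeriv_smul c σ

theorem extDeriv_sub_of_contDiff {E : Type*} [NormedAddCommGroup E] [NormedSpace ℝ E]
    {σ τ : E → E [⋀^Fin k]→L[ℝ] ℝ} (hσ : ContDiff ℝ ∞ σ) (hτ : ContDiff ℝ ∞ τ) :
    extDeriv (σ - τ) = extDeriv σ - extDeriv τ := by
  rw [sub_eq_add_neg, ← neg_one_smul ℝ τ,
    extDeriv_add_of_contDiff (τ := (-1 : ℝ) • τ) hσ (hτ.const_smul (-1 : ℝ)),
    extDeriv_const_smul, neg_one_smul, sub_eq_add_neg]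

theorem extDeriv_extDeriv_of_contDiff {E : Type*} [NormedAddCommGroup E] [NormedSpace ℝ E]
    {σ : E → E [⋀^Fin k]→L[ℝ] ℝ} (hσ : ContDiff ℝ ∞ σ) : extDeriv (extDeriv σ) = 0 :=
  extDeriv_extDeriv hσ (by simpa using WithTop.coe_le_coe.2 (le_top : (2 : ℕ∞) ≤ ⊤))

/-- A closed `0`-form is constant. -/
theorem eq_const_of_extDeriv_eq_zero {E : Type*} [NormedAddCommGroup E] [NormedSpace ℝ E]
    {σ : E → E [⋀^Fin 0]→L[ℝ] ℝ} (hσ : ContDiff ℝ ∞ σ) (hd : extDeriv σ = 0) (v w : E) :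
    σ v = σ w := by
  refine is_const_of_fderiv_eq_zero (hσ.differentiable (by simp)) (fun x ↦ ?_) v w
  ext y u
  have := congrArg (fun f ↦ f ![y]) (congrFun hd x)
  simpa [extDeriv, ContinuousAlternatingMap.alternatizeUncurryFin_apply,
    Subsingleton.elim _ u] using this

/-! ### Closed periodic forms modulo exact ones, by averaging over the torus -/

section Average

variable {ι : Type*} [Fintype ι] [MeasurableSpace W] [BorelSpace W] (b : Module.Basis ι ℝ W)

/-- The Haar measure on a fundamental domain of the lattice spanned by `b`. -/
noncomputable def torusMeasure : Measure W := b.addHaar.restrict (ZSpan.fundamentalDomain b)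

instance : IsProbabilityMeasure (torusMeasure b) where
  measure_univ := by
    rw [torusMeasure, Measure.restrict_apply_univ,
      measure_congr (ZSpan.fundamentalDomain_ae_parallelepiped b _), b.addHaar_self]

theorem ae_mem_torusMeasure : ∀ᵐ y ∂torusMeasure b, y ∈ parallelepiped b := by
  have : FiniteDimensional ℝ W := b.finiteDimensional_of_finite
  refine (ae_restrict_mem (ZSpan.fundamentalDomain_measurableSet b)).mono fun y hy ↦ ?_
  exact ZSpan.fundamentalDomain_subset_parallelepiped b hy

/-- The mean value of a periodic function is translation invariant. -/
theorem integral_torusMeasure_add {F : Type*} [NormedAddCommGroup F] [NormedSpace ℝ F] {f : W → F}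
    (hf : ∀ m ∈ Submodule.span ℤ (range b), ∀ y, f (y + m) = f y) (w : W) :
    ∫ y, f (w + y) ∂torusMeasure b = ∫ y, f y ∂torusMeasure b := by
  have : FiniteDimensional ℝ W := b.finiteDimensional_of_finite
  have : VAddInvariantMeasure (Submodule.span ℤ (range b)) W b.addHaar :=
    ⟨fun m _ _ ↦ measure_preimage_add b.addHaar (m : W) _⟩
  have h := ZSpan.isAddFundamentalDomain b b.addHaar
  -- A translate of a fundamental domain is again one, and a periodic function has the same integral
  -- over both.
  have h₁ := (h.vadd_of_comm w).setIntegral_eq h (f := f) fun g y ↦ by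
    rw [Submodule.vadd_def, vadd_eq_add, add_comm]; exact hf g g.2 y
  rw [torusMeasure, ← h₁]
  exact ((measurePreserving_add_left b.addHaar w).setIntegral_image_emb
    (measurableEmbedding_addLeft w) f _).symm

/-- The projection of `W × ℝ` onto its second factor. -/
noncomputable def vertical (W : Type*) [NormedAddCommGroup W] [NormedSpace ℝ W] :
    W × ℝ →L[ℝ] W × ℝ :=
  ContinuousLinearMap.inr ℝ W ℝ ∘L ContinuousLinearMap.snd ℝ W ℝ

/-- The average over the lattice of the homotopy operators that contract `W × ℝ` to `W`. -/
noncomputable def averagedContraction (σ : W × ℝ → (W × ℝ) [⋀^Fin (k + 1)]→L[ℝ] ℝ) (v : W × ℝ) :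
    (W × ℝ) [⋀^Fin k]→L[ℝ] ℝ :=
  ∫ q : W × ℝ, homotopyContraction (vertical W) σ (q.1, 0) q.2 v
    ∂((torusMeasure b).prod (volume.restrict (Icc 0 1)))

omit [MeasurableSpace W] [BorelSpace W] in
theorem contDiff_homotopyContraction {σ : W × ℝ → (W × ℝ) [⋀^Fin (k + 1)]→L[ℝ] ℝ}
    [FiniteDimensional ℝ W] (hσ : ContDiff ℝ ∞ σ) :
    ContDiff ℝ ∞ fun x : (W × ℝ) × (W × ℝ) ↦
      homotopyContraction (vertical W) σ (x.2.1, 0) x.2.2 x.1 := by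
  have h₀ : ContDiff ℝ ∞ fun x : (W × ℝ) × (W × ℝ) ↦ ((x.2.1, (0 : ℝ)) - vertical W x.1) := by
    fun_prop
  have h₁ : ContDiff ℝ ∞ fun x : (W × ℝ) × (W × ℝ) ↦
      (σ (x.1 + x.2.2 • ((x.2.1, (0 : ℝ)) - vertical W x.1))).curryLeft := by
    have : ContDiff ℝ ∞ fun x : (W × ℝ) × (W × ℝ) ↦
        (σ (x.1 + x.2.2 • ((x.2.1, (0 : ℝ)) - vertical W x.1))) := hσ.comp (by fun_prop)
    exact contDiff_curryLeft.comp this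
  have h₂ : ContDiff ℝ ∞ fun x : (W × ℝ) × (W × ℝ) ↦
      ContinuousLinearMap.id ℝ (W × ℝ) - x.2.2 • vertical W := by fun_prop
  exact (h₁.clm_apply h₀).compContinuousLinearMap h₂

omit [MeasurableSpace W] [BorelSpace W] in
theorem isCompact_parallelepiped_prod_Icc : IsCompact (parallelepiped b ×ˢ Icc (0 : ℝ) 1) :=
  b.parallelepiped.isCompact.prod isCompact_Icc

theorem ae_mem_parallelepiped_prod_Icc :
    ∀ᵐ q ∂((torusMeasure b).prod (volume.restrict (Icc (0 : ℝ) 1))),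
      q ∈ parallelepiped b ×ˢ Icc (0 : ℝ) 1 := by
  have h₁ : ∀ᵐ q ∂((torusMeasure b).prod (volume.restrict (Icc (0 : ℝ) 1))),
      q.1 ∈ parallelepiped b := Measure.quasiMeasurePreserving_fst.ae (ae_mem_torusMeasure b)
  have h₂ : ∀ᵐ q ∂((torusMeasure b).prod (volume.restrict (Icc (0 : ℝ) 1))),
      q.2 ∈ Icc (0 : ℝ) 1 :=
    Measure.quasiMeasurePreserving_snd.ae (ae_restrict_mem measurableSet_Icc)
  filter_upwards [h₁, h₂] with q hq₁ hq₂ using ⟨hq₁, hq₂⟩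

/-- Periodicity survives because `vertical W` kills lattice vectors: the homotopy only translates in
the direction of `W`, so it commutes with lattice translations. -/
theorem averagedContraction_mem {σ : W × ℝ → (W × ℝ) [⋀^Fin (k + 1)]→L[ℝ] ℝ}
    {L : Submodule ℤ W} (hσ : σ ∈ periodicForms L (k + 1)) :
    averagedContraction b σ ∈ periodicForms L k := by
  have : FiniteDimensional ℝ W := b.finiteDimensional_of_finite
  refine ⟨contDiff_integral_of_contDiff (isCompact_parallelepiped_prod_Icc b)
    (ae_mem_parallelepiped_prod_Icc b)
    (f := fun v q ↦ homotopyContraction (vertical W) σ (q.1, 0) q.2 v)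
    (contDiff_homotopyContraction hσ.1), fun m hm v ↦ ?_⟩
  refine integral_congr_ae (.of_forall fun q ↦ ?_)
  have h₁ : vertical W (v + (m, 0)) = vertical W v := by simp [vertical]
  simp only [homotopyContraction, h₁]
  rw [add_right_comm, hσ.2 m hm]

/-- The mean value over the torus fibre of the restriction of a form to the fibre. -/
noncomputable def fiberMean (σ : W × ℝ → (W × ℝ) [⋀^Fin k]→L[ℝ] ℝ) : W [⋀^Fin k]→L[ℝ] ℝ :=
  ∫ y, (σ (y, 0)).compContinuousLinearMap (ContinuousLinearMap.inl ℝ W ℝ) ∂torusMeasure b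

/-- For each `y` the homotopy joins the identity to `(w, s) ↦ (w + y, 0)`. Integration in `τ`
compares `σ` with its pullback by that map, and the mean over `y` makes the pullback independent of
`w`. Contraction of the `ℝ`-factor and averaging over the torus thus happen in one formula. -/
theorem extDeriv_averagedContraction {σ : W × ℝ → (W × ℝ) [⋀^Fin (k + 1)]→L[ℝ] ℝ}
    (hσ : σ ∈ periodicForms (Submodule.span ℤ (range b)) (k + 1)) (hd : extDeriv σ = 0) :
    extDeriv (averagedContraction b σ) = cylinder (k + 1) (fiberMean b σ) - σ := by
  have : FiniteDimensional ℝ W := b.finiteDimensional_of_finite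
  funext v
  have hK := isCompact_parallelepiped_prod_Icc b
  have hμ := ae_mem_parallelepiped_prod_Icc b
  have hs := contDiff_homotopyContraction hσ.1
  have h₁ : extDeriv (averagedContraction b σ) v = ∫ q : W × ℝ,
      extDeriv (homotopyContraction (vertical W) σ (q.1, 0) q.2) v
        ∂((torusMeasure b).prod (volume.restrict (Icc 0 1))) :=
    extDeriv_integral hK hμ
      (f := fun v q ↦ homotopyContraction (vertical W) σ (q.1, 0) q.2 v) hs v
  have hc : Continuous fun q : W × ℝ ↦
      extDeriv (homotopyContraction (vertical W) σ (q.1, 0) q.2) v := by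
    have h := (contDiff_fderiv_partial
      (f := fun v (q : W × ℝ) ↦ homotopyContraction (vertical W) σ (q.1, 0) q.2 v) hs).continuous.comp
      (by fun_prop : Continuous fun q : W × ℝ ↦ (v, q))
    exact (ContinuousAlternatingMap.alternatizeUncurryFinCLM ℝ (W × ℝ) ℝ (n := k)).continuous.comp h
  rw [h₁, integral_prod _ (integrable_of_continuous_of_ae_mem hK hμ hc)]
  -- The fundamental theorem of calculus applied to `hasDerivAt_homotopy`.
  have h₂ (y : W) : ∫ τ in Icc (0 : ℝ) 1,
      extDeriv (homotopyContraction (vertical W) σ (y, 0) τ) v =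
        (σ (v.1 + y, 0)).compContinuousLinearMap
          (ContinuousLinearMap.inl ℝ W ℝ ∘L ContinuousLinearMap.fst ℝ W ℝ) - σ v := by
    rw [integral_Icc_eq_integral_Ioc, ← intervalIntegral.integral_of_le zero_le_one,
      intervalIntegral.integral_eq_sub_of_hasDerivAt
        (fun τ _ ↦ hasDerivAt_homotopy (hσ.1.differentiable (by simp)) hd (y, 0) v τ)
        ((hc.comp (by fun_prop : Continuous fun τ : ℝ ↦ (y, τ))).intervalIntegrable _ _)]
    congr 1
    · have e₁ : v + (1 : ℝ) • ((y, (0 : ℝ)) - vertical W v) = (v.1 + y, 0) := by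
        ext <;> simp [vertical]
      have e₂ : ContinuousLinearMap.id ℝ (W × ℝ) - (1 : ℝ) • vertical W =
          ContinuousLinearMap.inl ℝ W ℝ ∘L ContinuousLinearMap.fst ℝ W ℝ := by
        ext <;> simp [vertical]
      rw [e₁, e₂]
    · rw [zero_smul, zero_smul, add_zero, sub_zero]
      rfl
  have hc₁ : Continuous fun y ↦ (σ (y, 0)).compContinuousLinearMap
      (ContinuousLinearMap.inl ℝ W ℝ) :=
    (ContinuousAlternatingMap.compContinuousLinearMapCLM (ContinuousLinearMap.inl ℝ W ℝ)).continuous.comp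
      (hσ.1.continuous.comp (by fun_prop))
  have hKW := b.parallelepiped.isCompact
  have hi := integrable_of_continuous_of_ae_mem hKW (ae_mem_torusMeasure b) hc₁
  have hi' : Integrable (fun y ↦ (σ (v.1 + y, 0)).compContinuousLinearMap
      (ContinuousLinearMap.inl ℝ W ℝ)) (torusMeasure b) :=
    integrable_of_continuous_of_ae_mem hKW (ae_mem_torusMeasure b) (hc₁.comp (by fun_prop : Continuous fun y ↦ v.1 + y))
  let T := ContinuousAlternatingMap.compContinuousLinearMapCLM (𝕜 := ℝ) (F := ℝ) (ι := Fin (k + 1))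
    (ContinuousLinearMap.fst ℝ W ℝ)
  have h₃ (y : W) : (σ (v.1 + y, 0)).compContinuousLinearMap
      (ContinuousLinearMap.inl ℝ W ℝ ∘L ContinuousLinearMap.fst ℝ W ℝ) =
      T ((σ (v.1 + y, 0)).compContinuousLinearMap (ContinuousLinearMap.inl ℝ W ℝ)) := rfl
  simp only [h₂, h₃]
  rw [integral_sub (T.integrable_comp hi') (integrable_const _), integral_const, probReal_univ,
    one_smul, T.integral_comp_comm hi',
    integral_torusMeasure_add b (f := fun y ↦ (σ (y, 0)).compContinuousLinearMap
      (ContinuousLinearMap.inl ℝ W ℝ)) (fun m hm y ↦ ?_) v.1]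
  · rfl
  · have := hσ.2 m hm (y, 0)
    rw [Prod.mk_add_mk, add_zero] at this
    simp only [this]

theorem exists_eq_cylinder_add_extDeriv {σ : W × ℝ → (W × ℝ) [⋀^Fin (k + 1)]→L[ℝ] ℝ}
    (hσ : σ ∈ periodicForms (Submodule.span ℤ (range b)) (k + 1)) (hd : extDeriv σ = 0) :
    ∃ c, ∃ η ∈ periodicForms (Submodule.span ℤ (range b)) k,
      σ = cylinder (k + 1) c + extDeriv η := by
  refine ⟨fiberMean b σ, -averagedContraction b σ, neg_mem (averagedContraction_mem b hσ), ?_⟩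
  rw [← neg_one_smul ℝ (averagedContraction b σ), extDeriv_const_smul,
    extDeriv_averagedContraction b hσ hd, neg_one_smul]
  abel

/-- Averaging `η` over translations along the torus does not change `dη`, which is constant, but
makes `η` constant along `W`; so `dη` vanishes on tuples of vectors of `W`, where it equals `c`. -/
theorem eq_zero_of_cylinder_eq_extDeriv {c : W [⋀^Fin (k + 1)]→L[ℝ] ℝ}
    {η : W × ℝ → (W × ℝ) [⋀^Fin k]→L[ℝ] ℝ}
    (hη : η ∈ periodicForms (Submodule.span ℤ (range b)) k)
    (h : cylinder (k + 1) c = extDeriv η) : c = 0 := by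
  have : FiniteDimensional ℝ W := b.finiteDimensional_of_finite
  have hs : ContDiff ℝ ∞ fun x : (W × ℝ) × W ↦ η ((x.2, 0) + x.1) := hη.1.comp (by fun_prop)
  have hK := b.parallelepiped.isCompact
  have hμ := ae_mem_torusMeasure b
  have h₁ := extDeriv_integral hK hμ (f := fun v y ↦ η ((y, 0) + v)) hs 0
  have h₂ (y : W) : extDeriv (fun v ↦ η ((y, 0) + v)) 0 =
      c.compContinuousLinearMap (ContinuousLinearMap.fst ℝ W ℝ) := by
    rw [← cylinder_apply c ((y, 0) + 0), h, extDeriv, extDeriv, fderiv_comp_add_left]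
  simp only [h₂] at h₁
  rw [integral_const, probReal_univ, one_smul] at h₁
  have h₃ (w : W) : fderiv ℝ (fun v ↦ ∫ y, η ((y, 0) + v) ∂torusMeasure b) 0 (w, 0) = 0 := by
    have hd := (hasFDerivAt_integral_of_contDiff hK hμ
      (f := fun v y ↦ η ((y, 0) + v)) hs 0).differentiableAt.hasFDerivAt
    have hl : HasDerivAt (fun t : ℝ ↦ t • ((w, 0) : W × ℝ)) (w, 0) 0 := by
      simpa using (hasDerivAt_id (0 : ℝ)).smul_const ((w, 0) : W × ℝ)
    -- The base point is written as the value of `t ↦ t • (w, 0)` at `0`, the form that the chain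
    -- rule needs.
    rw [← zero_smul ℝ ((w, 0) : W × ℝ)] at hd
    have h₄ := hd.comp_hasDerivAt 0 hl
    rw [zero_smul] at h₄
    have hconst : ((fun v ↦ ∫ y, η ((y, 0) + v) ∂torusMeasure b) ∘
        fun t : ℝ ↦ t • ((w, 0) : W × ℝ)) = fun _ ↦ ∫ y, η (y, 0) ∂torusMeasure b := by
      funext t
      rw [← integral_torusMeasure_add b (f := fun y ↦ η (y, 0)) (fun m hm y ↦ ?_) (t • w)]
      · simp [add_comm]
      · have := hη.2 m hm (y, 0)
        rwa [Prod.mk_add_mk, add_zero] at this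
    rw [hconst] at h₄
    exact h₄.unique (hasDerivAt_const _ _)
  ext u
  have h₅ := congrArg (fun f ↦ f fun i ↦ ((u i, 0) : W × ℝ)) h₁
  simp only [extDeriv, ContinuousAlternatingMap.alternatizeUncurryFin_apply] at h₅
  simpa [h₃, Function.comp_def] using h₅.symm

end Average

end Periodic

/-! ### Solving a cohomological equation by locally finite sums -/

section LocallyFiniteSum

variable {V F : Type*} [NormedAddCommGroup V] [NormedSpace ℝ V] [NormedAddCommGroup F]
  [NormedSpace ℝ F]

/-- The sum `∑ Tⁿ (η (gⁿ v))`, where `h` decreases by one under `g` and `η` vanishes for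
`h v ≤ 0`. -/
noncomputable def orbitSum (T : F →L[ℝ] F) (g : V → V) (h : V → ℝ) (η : V → F) (v : V) : F :=
  ∑ n ∈ Finset.range ⌈h v⌉₊, (T ^ n) (η (g^[n] v))

variable {T : F →L[ℝ] F} {g : V → V} {h : V → ℝ} {η : V → F}

-- Passing from `v` to `g v` drops exactly one term of the sum. If `h v ≤ 0`, both sums are empty
-- and `η v = 0`.
omit [NormedAddCommGroup V] [NormedSpace ℝ V] in
theorem orbitSum_eq (hg : ∀ v, h (g v) = h v - 1) (hη : ∀ v, h v ≤ 0 → η v = 0) (v : V) :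
    orbitSum T g h η v = η v + T (orbitSum T g h η (g v)) := by
  rcases le_or_gt (h v) 0 with hv | hv
  · have h₁ : ⌈h v⌉₊ = 0 := Nat.ceil_eq_zero.2 hv
    have h₂ : ⌈h (g v)⌉₊ = 0 := Nat.ceil_eq_zero.2 (by rw [hg]; linarith)
    simp [orbitSum, h₁, h₂, hη v hv]
  · have h₁ : ⌈h v⌉₊ = ⌈h (g v)⌉₊ + 1 := by
      rw [hg, Nat.ceil_sub_one, Nat.sub_add_cancel (Nat.one_le_ceil_iff.2 hv)]
    rw [orbitSum, h₁, Finset.sum_range_succ', add_comm, orbitSum, map_sum]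
    simp [pow_succ']

theorem contDiff_orbitSum (hg : ∀ v, h (g v) = h v - 1) (hη : ∀ v, h v ≤ 0 → η v = 0)
    (hc : Continuous h) (hgs : ContDiff ℝ ∞ g) (hηs : ContDiff ℝ ∞ η) :
    ContDiff ℝ ∞ (orbitSum T g h η) := by
  have hit (n : ℕ) : ContDiff ℝ ∞ g^[n] := by
    induction n with
    | zero => exact contDiff_id
    | succ n ih => rw [Function.iterate_succ]; exact ih.comp hgs
  have hh (n : ℕ) (v : V) : h (g^[n] v) = h v - n := by
    induction n with
    | zero => simp
    | succ n ih => rw [Function.iterate_succ_apply', hg, ih]; push_cast; ring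
  refine contDiff_iff_contDiffAt.2 fun v ↦ ?_
  -- One term more than needed at `v`: then `h w < ⌈h v⌉₊ + 1` near `v`, and one fixed number of
  -- terms suffices on a neighbourhood.
  have hs : ContDiff ℝ ∞ fun w ↦ ∑ n ∈ Finset.range (⌈h v⌉₊ + 1), (T ^ n) (η (g^[n] w)) :=
    ContDiff.sum fun n _ ↦ (T ^ n).contDiff.comp (hηs.comp (hit n))
  refine hs.contDiffAt.congr_of_eventuallyEq ?_
  have hlt : h v < (⌈h v⌉₊ + 1 : ℕ) := by
    push_cast
    linarith [Nat.le_ceil (h v)]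
  filter_upwards [hc.continuousAt.eventually_lt continuousAt_const hlt] with w hw
  refine Finset.sum_subset (Finset.range_subset_range.2 (Nat.ceil_le.2 hw.le)) fun n _ hn ↦ ?_
  rw [Finset.mem_range, not_lt] at hn
  rw [hη _ (by rw [hh]; linarith [Nat.ceil_le.1 hn]), map_zero]

omit [NormedSpace ℝ V] in
theorem orbitSum_add {S : Set V} (hS : ∀ m ∈ S, ∃ m' ∈ S, ∀ v, g (v + m) = g v + m')
    (hhS : ∀ m ∈ S, ∀ v, h (v + m) = h v) (hηS : ∀ m ∈ S, ∀ v, η (v + m) = η v) {m : V} (hm : m ∈ S)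
    (v : V) : orbitSum T g h η (v + m) = orbitSum T g h η v := by
  rw [orbitSum, hhS m hm, orbitSum]
  refine Finset.sum_congr rfl fun n hn ↦ ?_
  congr 1
  clear hn
  induction n generalizing v m with
  | zero => exact hηS m hm v
  | succ n ih =>
    obtain ⟨m', hm', h'⟩ := hS m hm
    rw [Function.iterate_succ_apply, Function.iterate_succ_apply, h', ih hm']

end LocallyFiniteSum

/-! ### Forms on the mapping torus -/

section Twisted

variable {W : Type*} [NormedAddCommGroup W] [NormedSpace ℝ W] {k : ℕ} (B : W ≃L[ℝ] W)
  {L : Submodule ℤ W}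

/-- The affine map `(w, s) ↦ (B w, s + 1)`. -/
def shift (v : W × ℝ) : W × ℝ := (B v.1, v.2 + 1)

/-- The linear part of `shift B`. -/
noncomputable def shiftLinear : (W × ℝ) ≃L[ℝ] (W × ℝ) := B.prodCongr (ContinuousLinearEquiv.refl ℝ ℝ)

theorem hasFDerivAt_shift (v : W × ℝ) :
    HasFDerivAt (shift B) (shiftLinear B : W × ℝ →L[ℝ] W × ℝ) v := by
  have h : shift B = fun v ↦ shiftLinear B v + (0, 1) := by
    funext v
    simp [shift, shiftLinear]
  rw [h]
  exact (shiftLinear B).hasFDerivAt.add_const _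

theorem contDiff_shift : ContDiff ℝ ∞ (shift B) := by
  unfold shift
  exact (B.contDiff.comp contDiff_fst).prodMk (contDiff_snd.add contDiff_const)

/-- The pullback of forms by `shift B`. -/
noncomputable def shiftPullback (k : ℕ) : (W × ℝ → (W × ℝ) [⋀^Fin k]→L[ℝ] ℝ) →ₗ[ℝ]
    (W × ℝ → (W × ℝ) [⋀^Fin k]→L[ℝ] ℝ) where
  toFun σ v := (σ (shift B v)).compContinuousLinearMap (shiftLinear B : W × ℝ →L[ℝ] W × ℝ)
  map_add' _ _ := rfl
  map_smul' _ _ := rfl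

/-- The pullback of alternating maps by `B`. -/
noncomputable def altPullback (k : ℕ) : (W [⋀^Fin k]→L[ℝ] ℝ) →ₗ[ℝ] (W [⋀^Fin k]→L[ℝ] ℝ) where
  toFun c := c.compContinuousLinearMap (B : W →L[ℝ] W)
  map_add' _ _ := rfl
  map_smul' _ _ := rfl

theorem shiftPullback_cylinder (c : W [⋀^Fin k]→L[ℝ] ℝ) :
    shiftPullback B k (cylinder k c) = cylinder k (altPullback B k c) := rfl

theorem extDeriv_shiftPullback {σ : W × ℝ → (W × ℝ) [⋀^Fin k]→L[ℝ] ℝ} (hσ : ContDiff ℝ ∞ σ) :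
    extDeriv (shiftPullback B k σ) = shiftPullback B (k + 1) (extDeriv σ) := by
  funext v
  have h := extDeriv_pullback (x := v) (f := shift B) (r := ∞)
    (hσ.differentiable (by simp) (shift B v)) (contDiff_shift B).contDiffAt
    (by simpa using WithTop.coe_le_coe.2 (le_top : (2 : ℕ∞) ≤ ⊤))
  simp only [(hasFDerivAt_shift B _).fderiv] at h
  exact h

theorem shiftPullback_mem_periodicForms (hB : ∀ m ∈ L, B m ∈ L)
    {σ : W × ℝ → (W × ℝ) [⋀^Fin k]→L[ℝ] ℝ} (hσ : σ ∈ periodicForms L k) :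
    shiftPullback B k σ ∈ periodicForms L k := by
  refine ⟨?_, fun m hm v ↦ ?_⟩
  · exact (ContinuousAlternatingMap.compContinuousLinearMapCLM
      (shiftLinear B : W × ℝ →L[ℝ] W × ℝ)).contDiff.comp (hσ.1.comp (contDiff_shift B))
  · have : shift B (v + (m, 0)) = shift B v + (B m, 0) := by simp [shift]
    change (σ (shift B (v + (m, 0)))).compContinuousLinearMap _ = _
    rw [this, hσ.2 _ (hB m hm)]
    rfl

/-- The operator `S^* - c` on periodic forms is surjective, where `S` is `shift B`. -/
theorem exists_shiftPullback_sub_smul_eq (hB : ∀ m, B m ∈ L ↔ m ∈ L) {c : ℝ} (hc : c ≠ 0)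
    {η : W × ℝ → (W × ℝ) [⋀^Fin k]→L[ℝ] ℝ} (hη : η ∈ periodicForms L k) :
    ∃ ξ ∈ periodicForms L k, shiftPullback B k ξ - c • ξ = η := by
  let S : Set (W × ℝ) := {m | m.1 ∈ L ∧ m.2 = 0}
  have hsm : ContDiff ℝ ∞ fun v : W × ℝ ↦ Real.smoothTransition v.2 :=
    Real.smoothTransition.contDiff.comp contDiff_snd
  -- The form is cut into a piece vanishing for `s ≤ 0` and a piece vanishing for `s ≥ 1`. The
  -- geometric series inverting `S^* - c` is summed along backward iterates for the first piece and
  -- along forward iterates for the second, so that both sums are locally finite and the size of `c`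
  -- is irrelevant.
  let ηp : W × ℝ → (W × ℝ) [⋀^Fin k]→L[ℝ] ℝ := fun v ↦ Real.smoothTransition v.2 • η v
  let ηm : W × ℝ → (W × ℝ) [⋀^Fin k]→L[ℝ] ℝ := fun v ↦ (1 - Real.smoothTransition v.2) • η v
  have hηp : ContDiff ℝ ∞ ηp := hsm.smul hη.1
  have hηm : ContDiff ℝ ∞ ηm := (contDiff_const.sub hsm).smul hη.1
  let gp : W × ℝ → W × ℝ := fun v ↦ (B.symm v.1, v.2 - 1)
  let gm : W × ℝ → W × ℝ := shift B
  let Tp : (W × ℝ) [⋀^Fin k]→L[ℝ] ℝ →L[ℝ] (W × ℝ) [⋀^Fin k]→L[ℝ] ℝ :=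
    c • ContinuousAlternatingMap.compContinuousLinearMapCLM
      ((shiftLinear B).symm : W × ℝ →L[ℝ] W × ℝ)
  let Tm : (W × ℝ) [⋀^Fin k]→L[ℝ] ℝ →L[ℝ] (W × ℝ) [⋀^Fin k]→L[ℝ] ℝ :=
    c⁻¹ • ContinuousAlternatingMap.compContinuousLinearMapCLM
      (shiftLinear B : W × ℝ →L[ℝ] W × ℝ)
  let hp : W × ℝ → ℝ := fun v ↦ v.2
  let hm : W × ℝ → ℝ := fun v ↦ 1 - v.2
  have hgp (v) : hp (gp v) = hp v - 1 := rfl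
  have hgm (v) : hm (gm v) = hm v - 1 := by simp only [hm, gm, shift]; ring
  have hp0 (v) (hv : hp v ≤ 0) : ηp v = 0 := by
    change Real.smoothTransition v.2 • η v = 0
    rw [Real.smoothTransition.zero_of_nonpos hv, zero_smul]
  have hm0 (v) (hv : hm v ≤ 0) : ηm v = 0 := by
    simp only [ηm, Real.smoothTransition.one_of_one_le (sub_nonpos.1 hv), sub_self, zero_smul]
  let X := orbitSum Tp gp hp ηp
  let Y := orbitSum Tm gm hm ηm
  have hX : X ∈ periodicForms L k := by
    refine ⟨contDiff_orbitSum hgp hp0 continuous_snd ?_ hηp, fun m hmL v ↦ ?_⟩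
    · exact (B.symm.contDiff.comp contDiff_fst).prodMk (contDiff_snd.sub contDiff_const)
    · refine orbitSum_add (S := S) ?_ ?_ ?_ ⟨hmL, rfl⟩ v
      · rintro ⟨m, _⟩ ⟨hm, rfl⟩
        refine ⟨(B.symm m, 0), ⟨(hB _).1 (by simpa using hm), rfl⟩, fun v ↦ ?_⟩
        simp [gp]
      · rintro ⟨m, _⟩ ⟨hm, rfl⟩ v
        simp [hp]
      · rintro ⟨m, _⟩ ⟨hm, rfl⟩ v
        simp [ηp, hη.2 m hm]
  have hY : Y ∈ periodicForms L k := by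
    refine ⟨contDiff_orbitSum hgm hm0 (by fun_prop) (contDiff_shift B) hηm, fun m hmL v ↦ ?_⟩
    refine orbitSum_add (S := S) ?_ ?_ ?_ ⟨hmL, rfl⟩ v
    · rintro ⟨m, _⟩ ⟨hm, rfl⟩
      exact ⟨(B m, 0), ⟨(hB _).2 hm, rfl⟩, fun v ↦ by simp [gm, shift]⟩
    · rintro ⟨m, _⟩ ⟨hm', rfl⟩ v
      simp [hm]
    · rintro ⟨m, _⟩ ⟨hm, rfl⟩ v
      simp [ηm, hη.2 m hm]
  have hXeq (v) : X v = ηp v + Tp (X (gp v)) := orbitSum_eq hgp hp0 v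
  have hYeq (v) : Y v = ηm v + Tm (Y (gm v)) := orbitSum_eq hgm hm0 v
  -- `Z = (S⁻¹)^* X` satisfies `S^* Z = X` and `c Z = X - ηp`, hence solves the equation for `ηp`;
  -- likewise `-c⁻¹ Y` solves it for `ηm`.
  let Z : W × ℝ → (W × ℝ) [⋀^Fin k]→L[ℝ] ℝ := fun v ↦
    (X (gp v)).compContinuousLinearMap ((shiftLinear B).symm : W × ℝ →L[ℝ] W × ℝ)
  have hZ : Z ∈ periodicForms L k := by
    have : Z = c⁻¹ • (X - ηp) := by
      funext v
      rw [Pi.smul_apply, Pi.sub_apply, hXeq, add_sub_cancel_left]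
      change _ = c⁻¹ • c • Z v
      rw [inv_smul_smul₀ hc]
    rw [this]
    refine Submodule.smul_mem _ _ (sub_mem hX ⟨hηp, fun m hm v ↦ ?_⟩)
    simp [ηp, hη.2 m hm]
  refine ⟨Z - c⁻¹ • Y, sub_mem hZ (Submodule.smul_mem _ _ hY), ?_⟩
  have e₁ : shiftPullback B k Z = X := by
    funext v
    have : gp (shift B v) = v := by simp [gp, shift]
    change ((X (gp (shift B v))).compContinuousLinearMap _).compContinuousLinearMap _ = _
    rw [this]
    ext u
    simp [Function.comp_def]
  have e₂ : c • Z = X - ηp := by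
    funext v
    rw [Pi.sub_apply, hXeq, add_sub_cancel_left]
    rfl
  have e₃ : c⁻¹ • shiftPullback B k Y = Y - ηm := by
    funext v
    rw [Pi.sub_apply, hYeq, add_sub_cancel_left]
    rfl
  have e₄ : ηp + ηm = η := by
    funext v
    simp only [ηp, ηm, Pi.add_apply, ← add_smul, add_sub_cancel, one_smul]
  rw [map_sub, map_smul, e₁, e₃, smul_sub, e₂, smul_inv_smul₀ hc, ← e₄]
  abel

end Twisted

/-! ### Cohomology of the complex of twisted forms -/

section Cohomology

variable {W : Type*} [NormedAddCommGroup W] [NormedSpace ℝ W] {k : ℕ}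

/-- The smooth forms on `W × ℝ` that are invariant under translations by `L` and are multiplied by
`c` under the pullback by `shift B`. -/
noncomputable def twistedForms (L : Submodule ℤ W) (B : W ≃L[ℝ] W) (c : ℝ) (k : ℕ) :
    Submodule ℝ (W × ℝ → (W × ℝ) [⋀^Fin k]→L[ℝ] ℝ) :=
  periodicForms L k ⊓ LinearMap.eqLocus (shiftPullback B k) (c • LinearMap.id)

/-- The operator `B^* - c` on alternating maps. -/
noncomputable def altDefect (B : W ≃L[ℝ] W) (c : ℝ) (k : ℕ) :
    (W [⋀^Fin k]→L[ℝ] ℝ) →ₗ[ℝ] (W [⋀^Fin k]→L[ℝ] ℝ) :=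
  altPullback B k - c • LinearMap.id

/-- The alternating maps on `W` that are multiplied by `c` under the pullback by `B`. -/
noncomputable def eigenforms (B : W ≃L[ℝ] W) (c : ℝ) (k : ℕ) : Submodule ℝ (W [⋀^Fin k]→L[ℝ] ℝ) :=
  LinearMap.ker (altDefect B c k)

variable {L : Submodule ℤ W} {B : W ≃L[ℝ] W} {c : ℝ}

theorem mem_twistedForms {σ : W × ℝ → (W × ℝ) [⋀^Fin k]→L[ℝ] ℝ} :
    σ ∈ twistedForms L B c k ↔ σ ∈ periodicForms L k ∧ shiftPullback B k σ = c • σ :=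
  Iff.rfl

theorem mem_eigenforms {e : W [⋀^Fin k]→L[ℝ] ℝ} :
    e ∈ eigenforms B c k ↔ altPullback B k e = c • e := by
  rw [eigenforms, LinearMap.mem_ker, altDefect, LinearMap.sub_apply, sub_eq_zero]
  rfl

theorem altDefect_apply (e : W [⋀^Fin k]→L[ℝ] ℝ) :
    altDefect B c k e = altPullback B k e - c • e := rfl

theorem extDeriv_add_of_mem {σ τ : W × ℝ → (W × ℝ) [⋀^Fin k]→L[ℝ] ℝ}
    (hσ : σ ∈ periodicForms L k) (hτ : τ ∈ periodicForms L k) :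
    extDeriv (σ + τ) = extDeriv σ + extDeriv τ :=
  extDeriv_add_of_contDiff hσ.1 hτ.1

theorem extDeriv_sub_of_mem {σ τ : W × ℝ → (W × ℝ) [⋀^Fin k]→L[ℝ] ℝ}
    (hσ : σ ∈ periodicForms L k) (hτ : τ ∈ periodicForms L k) :
    extDeriv (σ - τ) = extDeriv σ - extDeriv τ :=
  extDeriv_sub_of_contDiff hσ.1 hτ.1

theorem extDeriv_shiftPullback_sub_smul (hB : ∀ m ∈ L, B m ∈ L)
    {τ : W × ℝ → (W × ℝ) [⋀^Fin k]→L[ℝ] ℝ} (hτ : τ ∈ periodicForms L k) :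
    extDeriv (shiftPullback B k τ - c • τ) =
      shiftPullback B (k + 1) (extDeriv τ) - c • extDeriv τ := by
  rw [extDeriv_sub_of_mem (shiftPullback_mem_periodicForms B hB hτ) (Submodule.smul_mem _ c hτ),
    extDeriv_shiftPullback B hτ.1, extDeriv_const_smul]

theorem extDeriv_zero_form {E : Type*} [NormedAddCommGroup E] [NormedSpace ℝ E] :
    extDeriv (0 : E → E [⋀^Fin k]→L[ℝ] ℝ) = 0 := by
  have := extDeriv_const_smul (0 : ℝ) (0 : E → E [⋀^Fin k]→L[ℝ] ℝ)
  rwa [zero_smul, zero_smul] at this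

theorem extDeriv_mem_twistedForms {σ : W × ℝ → (W × ℝ) [⋀^Fin k]→L[ℝ] ℝ}
    (hσ : σ ∈ twistedForms L B c k) : extDeriv σ ∈ twistedForms L B c (k + 1) := by
  refine ⟨extDeriv_mem_periodicForms hσ.1, ?_⟩
  have h := (mem_twistedForms.1 hσ).2
  change shiftPullback B (k + 1) (extDeriv σ) = c • extDeriv σ
  rw [← extDeriv_shiftPullback B hσ.1.1, h, extDeriv_const_smul]

theorem cylinder_mem_twistedForms {e : W [⋀^Fin k]→L[ℝ] ℝ} (he : e ∈ eigenforms B c k) :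
    cylinder k e ∈ twistedForms L B c k := by
  refine ⟨cylinder_mem_periodicForms L e, ?_⟩
  change shiftPullback B k (cylinder k e) = c • cylinder k e
  rw [shiftPullback_cylinder, mem_eigenforms.1 he, map_smul]

/-- The form `s e` on `W × ℝ`, where `s` is the second coordinate. -/
noncomputable def slant (k : ℕ) :
    (W [⋀^Fin k]→L[ℝ] ℝ) →ₗ[ℝ] (W × ℝ → (W × ℝ) [⋀^Fin k]→L[ℝ] ℝ) where
  toFun e := fun v ↦ v.2 • cylinder k e v
  map_add' e e' := by
    funext v
    rw [map_add, Pi.add_apply, smul_add]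
    rfl
  map_smul' t e := by
    funext v
    rw [map_smul, Pi.smul_apply, smul_comm]
    rfl

theorem slant_mem_periodicForms (e : W [⋀^Fin k]→L[ℝ] ℝ) : slant k e ∈ periodicForms L k := by
  refine ⟨contDiff_snd.smul contDiff_const, fun m _ v ↦ ?_⟩
  change (v.2 + 0) • cylinder k e v = v.2 • cylinder k e v
  rw [add_zero]

theorem shiftPullback_slant (e : W [⋀^Fin k]→L[ℝ] ℝ) :
    shiftPullback B k (slant k e) = slant k (altPullback B k e) + cylinder k (altPullback B k e) := by
  funext v
  change (v.2 + 1) • cylinder k (altPullback B k e) v =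
    v.2 • cylinder k (altPullback B k e) v + cylinder k (altPullback B k e) v
  rw [add_smul, one_smul]

/-- The form `ds ∧ e` on `W × ℝ`, where `s` is the second coordinate. -/
noncomputable def dsWedge (k : ℕ) :
    (W [⋀^Fin k]→L[ℝ] ℝ) →ₗ[ℝ] (W × ℝ → (W × ℝ) [⋀^Fin (k + 1)]→L[ℝ] ℝ) where
  toFun e := extDeriv (slant k e)
  map_add' e e' := by
    -- Only smoothness is needed here, so any lattice will do.
    rw [map_add, extDeriv_add_of_contDiff (slant_mem_periodicForms (L := ⊥) e).1
      (slant_mem_periodicForms (L := ⊥) e').1]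
  map_smul' t e := by rw [map_smul, extDeriv_const_smul, RingHom.id_apply]

theorem dsWedge_apply (e : W [⋀^Fin k]→L[ℝ] ℝ) : dsWedge k e = extDeriv (slant k e) := rfl

theorem extDeriv_dsWedge (e : W [⋀^Fin k]→L[ℝ] ℝ) : extDeriv (dsWedge k e) = 0 :=
  extDeriv_extDeriv_of_contDiff (slant_mem_periodicForms (L := ⊥) e).1

/-- The form `s e` itself is not twisted: `S^*` adds the error `c e`. That error is closed, so it
disappears after applying `d`. -/
theorem dsWedge_mem_twistedForms {e : W [⋀^Fin k]→L[ℝ] ℝ} (he : e ∈ eigenforms B c k) :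
    dsWedge k e ∈ twistedForms L B c (k + 1) := by
  have h := slant_mem_periodicForms (L := L) e
  refine ⟨extDeriv_mem_periodicForms h, ?_⟩
  change shiftPullback B (k + 1) (extDeriv (slant k e)) = c • extDeriv (slant k e)
  rw [← extDeriv_shiftPullback B h.1, shiftPullback_slant, mem_eigenforms.1 he, map_smul, map_smul,
    extDeriv_add_of_mem (Submodule.smul_mem _ c h)
      (Submodule.smul_mem _ c (cylinder_mem_periodicForms L e)),
    extDeriv_const_smul, extDeriv_const_smul, extDeriv_cylinder, smul_zero, add_zero]

theorem cylinder_injective : Function.Injective (cylinder (W := W) k) := by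
  intro e e' h
  ext u
  have := congrArg (fun f ↦ f fun i ↦ ((u i, 0) : W × ℝ)) (congrFun h 0)
  simpa [cylinder_apply, Function.comp_def] using this

theorem exists_eq_cylinder_of_closed {σ : W × ℝ → (W × ℝ) [⋀^Fin 0]→L[ℝ] ℝ}
    (hσ : ContDiff ℝ ∞ σ) (hd : extDeriv σ = 0) : ∃ e, σ = cylinder 0 e := by
  refine ⟨(σ 0).compContinuousLinearMap (ContinuousLinearMap.inl ℝ W ℝ), ?_⟩
  funext v
  ext u
  rw [eq_const_of_extDeriv_eq_zero hσ hd v 0]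
  exact congrArg (σ 0) (Subsingleton.elim _ _)

theorem mem_eigenforms_of_cylinder {e : W [⋀^Fin k]→L[ℝ] ℝ}
    (h : shiftPullback B k (cylinder k e) = c • cylinder k e) : e ∈ eigenforms B c k := by
  rw [mem_eigenforms]
  apply cylinder_injective
  rw [← shiftPullback_cylinder, h, map_smul]

theorem exists_eq_cylinder_of_extDeriv_eq_zero {σ : W × ℝ → (W × ℝ) [⋀^Fin 0]→L[ℝ] ℝ}
    (hσ : σ ∈ twistedForms L B c 0) (hd : extDeriv σ = 0) :
    ∃ e ∈ eigenforms B c 0, σ = cylinder 0 e := by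
  obtain ⟨e, rfl⟩ := exists_eq_cylinder_of_closed hσ.1.1 hd
  exact ⟨e, mem_eigenforms_of_cylinder (mem_twistedForms.1 hσ).2, rfl⟩

variable {ι : Type*} [Fintype ι] {b : Module.Basis ι ℝ W}

/-- The classes of the forms `e` and `ds ∧ e'` span the cohomology of the complex of twisted
forms. -/
theorem exists_eq_cylinder_add_dsWedge_add_extDeriv (hc : c ≠ 0)
    (hB : ∀ m, B m ∈ Submodule.span ℤ (range b) ↔ m ∈ Submodule.span ℤ (range b))
    (hss : Disjoint (eigenforms B c k) (LinearMap.range (altDefect B c k)))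
    {σ : W × ℝ → (W × ℝ) [⋀^Fin (k + 1)]→L[ℝ] ℝ}
    (hσ : σ ∈ twistedForms (Submodule.span ℤ (range b)) B c (k + 1)) (hd : extDeriv σ = 0) :
    ∃ e ∈ eigenforms B c (k + 1), ∃ e' ∈ eigenforms B c k,
      ∃ η ∈ twistedForms (Submodule.span ℤ (range b)) B c k,
        σ = cylinder (k + 1) e + dsWedge k e' + extDeriv η := by
  borelize W
  have : FiniteDimensional ℝ W := b.finiteDimensional_of_finite
  have hB' : ∀ m ∈ Submodule.span ℤ (range b), B m ∈ Submodule.span ℤ (range b) :=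
    fun m hm ↦ (hB m).2 hm
  obtain ⟨e, η, hη, hσe⟩ := exists_eq_cylinder_add_extDeriv b hσ.1 hd
  have hφη : shiftPullback B k η - c • η ∈ periodicForms (Submodule.span ℤ (range b)) k :=
    sub_mem (shiftPullback_mem_periodicForms B hB' hη) (Submodule.smul_mem _ _ hη)
  -- Here `η` is periodic but need not be twisted. Applying `S^* - c` to `σ = e + dη` makes the
  -- constant form `(B^* - c) e` exact, hence zero, and then shows that the defect `S^* η - c η` is
  -- closed. The rest of the proof corrects `η` so as to remove this defect.
  have hσS := (mem_twistedForms.1 hσ).2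
  have he : e ∈ eigenforms B c (k + 1) := by
    refine LinearMap.mem_ker.2 (eq_zero_of_cylinder_eq_extDeriv b (neg_mem hφη) ?_)
    rw [← neg_one_smul ℝ (_ - _), extDeriv_const_smul, extDeriv_shiftPullback_sub_smul hB' hη, neg_one_smul]
    rw [hσe, map_add, smul_add, shiftPullback_cylinder] at hσS
    rw [altDefect_apply, map_sub, map_smul, neg_sub, sub_eq_sub_iff_add_eq_add, hσS]
    abel
  have hclosed : extDeriv (shiftPullback B k η - c • η) = 0 := by
    rw [extDeriv_shiftPullback_sub_smul hB' hη]
    rw [hσe, map_add, smul_add, shiftPullback_cylinder, mem_eigenforms.1 he, map_smul] at hσS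
    rw [add_left_cancel hσS, sub_self]
  -- The defect is constant up to the defect of a closed form: its exact part is `d` of some `(S^* -
  -- c) η''` by surjectivity, which is the defect of `dη''`. In degree zero a closed form is already
  -- constant.
  obtain ⟨e₂, η', hη', hφη'⟩ : ∃ e₂, ∃ η' ∈ periodicForms (Submodule.span ℤ (range b)) k,
      shiftPullback B k η - c • η = cylinder k e₂ + (shiftPullback B k η' - c • η') ∧
        extDeriv η' = 0 := by
    cases k with
    | zero =>
      obtain ⟨e₂, he₂⟩ := exists_eq_cylinder_of_closed hφη.1 hclosed
      exact ⟨e₂, 0, zero_mem _, by rw [map_zero, smul_zero, sub_zero, add_zero, he₂],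
        extDeriv_zero_form⟩
    | succ k =>
      obtain ⟨e₂, η', hη', h⟩ := exists_eq_cylinder_add_extDeriv b hφη hclosed
      obtain ⟨η'', hη'', rfl⟩ := exists_shiftPullback_sub_smul_eq B hB hc hη'
      refine ⟨e₂, extDeriv η'', extDeriv_mem_periodicForms hη'', ?_,
        extDeriv_extDeriv_of_contDiff hη''.1⟩
      rw [h, extDeriv_shiftPullback_sub_smul hB' hη'']
  -- Kernel and image are disjoint and have complementary dimensions, so `e₂ = e₃ + (B^* - c) e₄`.
  -- The second summand is the defect of the constant form `e₄`; the first is the defect of `s c⁻¹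
  -- e₃`, because `S^*` sends it to `(s + 1) e₃`. Removing `s c⁻¹ e₃` from `η` is what produces the
  -- term `ds ∧ e'`.
  have htop : eigenforms B c k ⊔ LinearMap.range (altDefect B c k) = ⊤ :=
    Submodule.eq_top_of_disjoint _ _
      (by rw [add_comm]; exact (LinearMap.finrank_range_add_finrank_ker _).ge) hss
  obtain ⟨e₃, he₃, _, ⟨e₄, rfl⟩, he₂⟩ := Submodule.mem_sup.1 (htop ▸ Submodule.mem_top (x := e₂))
  have he' : c⁻¹ • e₃ ∈ eigenforms B c k := Submodule.smul_mem _ _ he₃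
  have hs := slant_mem_periodicForms (L := Submodule.span ℤ (range b)) (c⁻¹ • e₃)
  have he₄ := cylinder_mem_periodicForms (Submodule.span ℤ (range b)) e₄
  refine ⟨e, he, c⁻¹ • e₃, he', η - slant k (c⁻¹ • e₃) - cylinder k e₄ - η',
    mem_twistedForms.2 ⟨sub_mem (sub_mem (sub_mem hη hs) he₄) hη', ?_⟩, ?_⟩
  · have h₁ := hφη'.1
    rw [← he₂] at h₁
    rw [altDefect_apply, map_add, map_sub, map_smul] at h₁
    rw [map_sub, map_sub, map_sub, shiftPullback_slant, mem_eigenforms.1 he', map_smul,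
      map_smul (cylinder k), map_smul (cylinder k), smul_inv_smul₀ hc, shiftPullback_cylinder,
      smul_sub, smul_sub, smul_sub, ← sub_eq_zero]
    rw [← sub_eq_zero] at h₁
    rw [← h₁]
    abel
  · rw [extDeriv_sub_of_mem (sub_mem (sub_mem hη hs) he₄) hη',
      extDeriv_sub_of_mem (sub_mem hη hs) he₄, extDeriv_sub_of_mem hη hs,
      extDeriv_cylinder, hφη'.2, dsWedge_apply, hσe]
    abel

/-- The classes of the forms `e` and `ds ∧ e'` are linearly independent in the cohomology of the
complex of twisted forms. -/
theorem eq_zero_of_cylinder_add_dsWedge_eq_extDeriv (hc : c ≠ 0)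
    (hB : ∀ m, B m ∈ Submodule.span ℤ (range b) ↔ m ∈ Submodule.span ℤ (range b))
    (hss : Disjoint (eigenforms B c k) (LinearMap.range (altDefect B c k)))
    {e : W [⋀^Fin (k + 1)]→L[ℝ] ℝ} {e' : W [⋀^Fin k]→L[ℝ] ℝ} (he' : e' ∈ eigenforms B c k)
    {η : W × ℝ → (W × ℝ) [⋀^Fin k]→L[ℝ] ℝ}
    (hη : η ∈ twistedForms (Submodule.span ℤ (range b)) B c k)
    (h : cylinder (k + 1) e + dsWedge k e' = extDeriv η) : e = 0 ∧ e' = 0 := by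
  borelize W
  have : FiniteDimensional ℝ W := b.finiteDimensional_of_finite
  have hs := slant_mem_periodicForms (L := Submodule.span ℤ (range b)) e'
  have h₁ : cylinder (k + 1) e = extDeriv (η - slant k e') := by
    rw [extDeriv_sub_of_contDiff hη.1.1 hs.1, ← h, dsWedge_apply, add_sub_cancel_right]
  have he : e = 0 := eq_zero_of_cylinder_eq_extDeriv b (sub_mem hη.1 hs) h₁
  refine ⟨he, ?_⟩
  have hB' : ∀ m ∈ Submodule.span ℤ (range b), B m ∈ Submodule.span ℤ (range b) :=
    fun m hm ↦ (hB m).2 hm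
  rw [he, map_zero] at h₁
  -- The form `η - s e'` is closed with constant defect `-c e'`. Being itself a constant form up to
  -- an exact one, it forces `c e'` into the image of `B^* - c`, which meets the kernel only in
  -- zero.
  have hφ : shiftPullback B k (η - slant k e') - c • (η - slant k e') = -(c • cylinder k e') := by
    rw [map_sub, (mem_twistedForms.1 hη).2, shiftPullback_slant, mem_eigenforms.1 he', map_smul,
      map_smul, smul_sub]
    abel
  suffices ∃ e₁, -(c • e') = altDefect B c k e₁ by
    obtain ⟨e₁, he₁⟩ := this
    have h₂ : c • e' ∈ LinearMap.range (altDefect B c k) :=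
      ⟨-e₁, by rw [map_neg, ← he₁, neg_neg]⟩
    have h₃ := Submodule.disjoint_def.1 hss _ (Submodule.smul_mem _ c he') h₂
    exact (smul_eq_zero.1 h₃).resolve_left hc
  cases k with
  | zero =>
    obtain ⟨e₁, he₁⟩ := exists_eq_cylinder_of_closed (σ := η - slant 0 e') (hη.1.1.sub hs.1) h₁.symm
    refine ⟨e₁, cylinder_injective ?_⟩
    rw [map_neg, map_smul, ← hφ, he₁, altDefect_apply, map_sub, map_smul, shiftPullback_cylinder]
  | succ k =>
    obtain ⟨e₁, η₁, hη₁, h₂⟩ := exists_eq_cylinder_add_extDeriv b (sub_mem hη.1 hs) h₁.symm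
    refine ⟨e₁, ?_⟩
    have hφη : shiftPullback B k η₁ - c • η₁ ∈ periodicForms (Submodule.span ℤ (range b)) k :=
      sub_mem (shiftPullback_mem_periodicForms B hB' hη₁) (Submodule.smul_mem _ _ hη₁)
    have h₃ : cylinder (k + 1) (-(c • e') - altDefect B c (k + 1) e₁) =
        extDeriv (shiftPullback B k η₁ - c • η₁) := by
      rw [extDeriv_shiftPullback_sub_smul hB' hη₁]
      rw [h₂, map_add, shiftPullback_cylinder] at hφ
      rw [altDefect_apply, map_sub, map_neg, map_smul, ← hφ, map_sub, map_smul, smul_add]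
      abel
    exact sub_eq_zero.1 (eq_zero_of_cylinder_eq_extDeriv b hφη h₃)

end Cohomology

/-! ### Detecting eigenforms by their value on one tuple of vectors -/

section EigenEvaluation

variable {W : Type*} [NormedAddCommGroup W] [NormedSpace ℝ W]

/-- The evaluation of alternating maps on the tuple `u` is an eigenvector for the eigenvalue `c₀` of
the transpose of `B^*`, and it detects the real eigenvectors of `B^*`. -/
structure IsEigenEvaluation (B : W ≃L[ℝ] W) {k : ℕ} (u : Fin k → W) (c₀ : ℝ) : Prop where
  apply_eq : ∀ e : W [⋀^Fin k]→L[ℝ] ℝ, altPullback B k e u = c₀ * e u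
  eq_zero : ∀ (c : ℝ), ∀ e ∈ eigenforms B c k, e u = 0 → e = 0
  exists_ne_zero : ∃ e ∈ eigenforms B c₀ k, e u ≠ 0

variable {B : W ≃L[ℝ] W} {k : ℕ} {u : Fin k → W} {c₀ c : ℝ}

/-- An eigenform `(B^* - c) e` takes the value `(c₀ - c) e(u)` on `u`, which is zero for `c = c₀`;
for `c ≠ c₀` every eigenform vanishes on `u`. Either way the evaluation detects that it is zero. -/
theorem IsEigenEvaluation.disjoint (h : IsEigenEvaluation B u c₀) (c : ℝ) :
    Disjoint (eigenforms B c k) (LinearMap.range (altDefect B c k)) := by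
  rw [Submodule.disjoint_def]
  rintro _ he ⟨e, rfl⟩
  refine h.eq_zero c _ he ?_
  have h₁ : altDefect B c k e u = (c₀ - c) * e u := by
    rw [altDefect_apply, ContinuousAlternatingMap.sub_apply, h.apply_eq,
      ContinuousAlternatingMap.smul_apply, smul_eq_mul, sub_mul]
  have h₂ := congrArg (fun f ↦ f u) (mem_eigenforms.1 he)
  simp only [h.apply_eq, ContinuousAlternatingMap.smul_apply, smul_eq_mul] at h₂
  rcases eq_or_ne c₀ c with hc | hc
  · rw [h₁, hc, sub_self, zero_mul]
  · exact (mul_eq_mul_right_iff.1 h₂).resolve_left hc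

theorem IsEigenEvaluation.eigenforms_eq_bot (h : IsEigenEvaluation B u c₀) (hc : c ≠ c₀) :
    eigenforms B c k = ⊥ := by
  rw [eq_bot_iff]
  intro e he
  refine h.eq_zero c e he ?_
  have h₂ := congrArg (fun f ↦ f u) (mem_eigenforms.1 he)
  simp only [h.apply_eq, ContinuousAlternatingMap.smul_apply, smul_eq_mul] at h₂
  exact (mul_eq_mul_right_iff.1 h₂).resolve_left hc.symm

theorem IsEigenEvaluation.nonempty_equiv (h : IsEigenEvaluation B u c₀) :
    Nonempty (eigenforms B c₀ k ≃ₗ[ℝ] ℝ) := by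
  let ev : eigenforms B c₀ k →ₗ[ℝ] ℝ :=
    { toFun := fun e ↦ e.1 u
      map_add' := fun _ _ ↦ rfl
      map_smul' := fun _ _ ↦ rfl }
  refine ⟨LinearEquiv.ofBijective ev ⟨?_, ?_⟩⟩
  · refine fun e e' he ↦ sub_eq_zero.1 (Subtype.ext (h.eq_zero c₀ _ (e - e').2 ?_))
    exact sub_eq_zero.2 he
  · obtain ⟨e, he, hne⟩ := h.exists_ne_zero
    refine fun t ↦ ⟨(t / e u) • ⟨e, he⟩, ?_⟩
    change (t / e u) * e u = t
    field_simp

end EigenEvaluation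

/-- The determinant in a basis as a continuous alternating map. -/
noncomputable def detForm {W : Type*} [NormedAddCommGroup W] [NormedSpace ℝ W]
    [FiniteDimensional ℝ W] {k : ℕ} (b : Module.Basis (Fin k) ℝ W) : W [⋀^Fin k]→L[ℝ] ℝ where
  __ := b.det
  cont := by
    change Continuous fun v ↦ b.det v
    simp only [Module.Basis.det_apply]
    refine Continuous.matrix_det (continuous_matrix fun i j ↦ ?_)
    exact (LinearMap.continuous_of_finiteDimensional (b.coord i)).comp (continuous_apply j)

theorem detForm_apply {W : Type*} [NormedAddCommGroup W] [NormedSpace ℝ W]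
    [FiniteDimensional ℝ W] {k : ℕ} (b : Module.Basis (Fin k) ℝ W) (v : Fin k → W) :
    detForm b v = b.det v := rfl

end MappingTorus

/-! ### Real eigenvalues of the monodromy on alternating forms -/

namespace InoueData

open MappingTorus MorseNovikov

variable (D : InoueData)

/-- The linear map `(z, x) ↦ (β z, α x)`. -/
noncomputable def fiberMap : (ℂ × ℝ) ≃L[ℝ] (ℂ × ℝ) :=
  LinearEquiv.toContinuousLinearEquiv
    { toFun := fun p ↦ (D.β * p.1, D.α * p.2)
      map_add' := fun p q ↦ by simp [mul_add]
      map_smul' := fun t p ↦ by simp [mul_left_comm]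
      invFun := fun p ↦ (D.β⁻¹ * p.1, D.α⁻¹ * p.2)
      left_inv := fun p ↦ by simp [D.β_ne_zero, D.α_pos.ne']
      right_inv := fun p ↦ by simp [D.β_ne_zero, D.α_pos.ne'] }

@[simp]
theorem fiberMap_apply (p : ℂ × ℝ) : D.fiberMap p = (D.β * p.1, D.α * p.2) := rfl

/-- The basis `(bᵢ, aᵢ)` of `ℂ × ℝ`. -/
noncomputable def latticeBasis : Module.Basis (Fin 3) ℝ (ℂ × ℝ) :=
  Module.Basis.ofEquivFun (D.periodMap.linearEquivOfInjective
    (LinearMap.ker_eq_bot.1 D.ker_periodMap) (by simp)).symm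

theorem latticeBasis_apply (i : Fin 3) : D.latticeBasis i = (D.b i, D.a i) := by
  rw [latticeBasis, Module.Basis.coe_ofEquivFun]
  change D.periodMap (Pi.single i 1) = _
  have h (j : Fin 3) : (((Pi.single i 1 : Fin 3 → ℝ) j : ℝ) : ℂ) = if j = i then 1 else 0 := by
    rw [Pi.single_apply]; split_ifs <;> simp
  refine Prod.ext ?_ ?_
  · change ∑ j, (((Pi.single i 1 : Fin 3 → ℝ) j : ℝ) : ℂ) * D.b j = _
    simp [h]
  · change ∑ j, (Pi.single i 1 : Fin 3 → ℝ) j * D.a j = _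
    simp [Pi.single_apply]

/-- The lattice spanned by the vectors `(bᵢ, aᵢ)`. -/
noncomputable abbrev lattice : Submodule ℤ (ℂ × ℝ) := Submodule.span ℤ (range D.latticeBasis)

theorem mem_lattice {p : ℂ × ℝ} : p ∈ D.lattice ↔ ∃ m : Fin 3 → ℤ,
    p = (∑ i, (m i : ℂ) * D.b i, ∑ i, (m i : ℝ) * D.a i) := by
  rw [lattice, Submodule.mem_span_range_iff_exists_fun]
  have h (m : Fin 3 → ℤ) : ∑ i, m i • D.latticeBasis i =
      (∑ i, (m i : ℂ) * D.b i, ∑ i, (m i : ℝ) * D.a i) := by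
    simp [latticeBasis_apply, Prod.ext_iff, Prod.fst_sum, Prod.snd_sum]
  simp only [h, eq_comm]

theorem fiberMap_mem_lattice (p : ℂ × ℝ) : D.fiberMap p ∈ D.lattice ↔ p ∈ D.lattice := by
  rw [mem_lattice, mem_lattice]
  constructor
  · rintro ⟨m, hm⟩
    obtain ⟨m', h₁, h₂⟩ := D.exists_zpow_mul_sum (-1) m
    refine ⟨m', ?_⟩
    have hm₁ : D.β * p.1 = ∑ i, (m i : ℂ) * D.b i := congrArg Prod.fst hm
    have hm₂ : D.α * p.2 = ∑ i, (m i : ℝ) * D.a i := congrArg Prod.snd hm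
    rw [← h₁, ← h₂, ← hm₁, ← hm₂]
    simp [D.β_ne_zero, D.α_pos.ne']
  · rintro ⟨m, rfl⟩
    obtain ⟨m', h₁, h₂⟩ := D.exists_zpow_mul_sum 1 m
    refine ⟨m', ?_⟩
    rw [← h₁, ← h₂]
    simp

/-- In the lattice basis `(bᵢ, aᵢ)` the map has matrix `Aᵗ`, by the two eigenvector equations. -/
theorem det_fiberMap : LinearMap.det (D.fiberMap : (ℂ × ℝ) →ₗ[ℝ] (ℂ × ℝ)) = 1 := by
  rw [← LinearMap.det_toMatrix D.latticeBasis]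
  have h : LinearMap.toMatrix D.latticeBasis D.latticeBasis
      (D.fiberMap : (ℂ × ℝ) →ₗ[ℝ] (ℂ × ℝ)) =
      ((D.A : Matrix (Fin 3) (Fin 3) ℤ).map (Int.castRingHom ℝ)).transpose := by
    ext i j
    rw [LinearMap.toMatrix_apply]
    have h₁ : (D.fiberMap : (ℂ × ℝ) →ₗ[ℝ] (ℂ × ℝ)) (D.latticeBasis j) =
        ∑ l, ((D.A : Matrix (Fin 3) (Fin 3) ℤ) j l : ℝ) • D.latticeBasis l := by
      have ha := congrFun D.mulVec_a j
      have hb := congrFun D.mulVec_b j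
      simp only [Matrix.mulVec, dotProduct, Matrix.map_apply, Pi.smul_apply, smul_eq_mul] at ha hb
      simp [latticeBasis_apply, Prod.ext_iff, Prod.fst_sum, Prod.snd_sum, ha, hb]
    rw [h₁, map_sum]
    simp [Finsupp.single_apply]
  rw [h, Matrix.det_transpose]
  have := (Int.castRingHom ℝ).map_det (D.A : Matrix (Fin 3) (Fin 3) ℤ)
  rw [RingHom.mapMatrix_apply] at this
  rw [← this, D.A.2, map_one]

/-- Both sides are the determinant of `fiberMap`; multiplication by `β` on the real plane `ℂ` has
determinant `|β|²`. -/
theorem normSq_β_mul_α : Complex.normSq D.β * D.α = 1 := by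
  rw [← D.det_fiberMap]
  have h : (D.fiberMap : (ℂ × ℝ) →ₗ[ℝ] (ℂ × ℝ)) =
      LinearMap.prodMap (LinearMap.mul ℝ ℂ D.β) (LinearMap.mul ℝ ℝ D.α) := by
    ext <;> simp
  rw [h, LinearMap.det_prodMap]
  have h₁ : LinearMap.det (LinearMap.mul ℝ ℂ D.β) = Complex.normSq D.β :=
    Algebra.norm_complex_apply D.β
  have h₂ : LinearMap.det (LinearMap.mul ℝ ℝ D.α) = D.α := by
    rw [LinearMap.det_ring]; simp
  rw [h₁, h₂]

/-- The basis `(1, 0), (i, 0), (0, 1)` of `ℂ × ℝ`. -/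
noncomputable def stdBasis : Module.Basis (Fin 3) ℝ (ℂ × ℝ) :=
  Module.Basis.ofEquivFun
    { toFun := fun p ↦ ![p.1.re, p.1.im, p.2]
      map_add' := fun p q ↦ by ext i; fin_cases i <;> rfl
      map_smul' := fun t p ↦ by ext i; fin_cases i <;> simp
      invFun := fun v ↦ (⟨v 0, v 1⟩, v 2)
      left_inv := fun p ↦ rfl
      right_inv := fun v ↦ by ext i; fin_cases i <;> rfl }

theorem stdBasis_apply (i : Fin 3) : stdBasis i =
    (⟨(Pi.single i 1 : Fin 3 → ℝ) 0, (Pi.single i 1 : Fin 3 → ℝ) 1⟩,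
      (Pi.single i 1 : Fin 3 → ℝ) 2) := by
  rw [stdBasis, Module.Basis.coe_ofEquivFun]
  rfl

theorem stdBasis_zero : stdBasis 0 = (1, 0) := by
  simp [stdBasis_apply, Complex.ext_iff]

theorem stdBasis_one : stdBasis 1 = (Complex.I, 0) := by
  simp [stdBasis_apply, Complex.ext_iff]

theorem stdBasis_two : stdBasis 2 = (0, 1) := by
  simp [stdBasis_apply, Complex.ext_iff]

/-- The functional kills the multiples of `β - c`, which is invertible because `β` is not real. This
excludes real eigenforms belonging to the eigenvalues `β` and `α β`. -/
theorem eq_zero_of_mul_invariant {f : ℂ → ℝ} (hf : ∀ z w, f (z + w) = f z + f w)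
    (hs : ∀ (t : ℝ) z, f (t * z) = t * f z) {β : ℂ} (hβ : β.im ≠ 0) {c : ℝ}
    (h : ∀ z, f (β * z) = c * f z) (z : ℂ) : f z = 0 := by
  have hne : β - c ≠ 0 := fun h0 ↦ hβ (by simpa using congrArg Complex.im h0)
  have h₁ (z : ℂ) : f ((β - c) * z) = 0 := by
    have h₂ := hf ((β - c) * z) (c * z)
    rw [← add_mul, sub_add_cancel, h, hs] at h₂
    linarith
  have := h₁ ((β - c)⁻¹ * z)
  rwa [mul_inv_cancel_left₀ hne] at this

/-- Alternating maps of degree zero on `ℂ × ℝ`. -/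
theorem isEigenEvaluation_zero : IsEigenEvaluation D.fiberMap (k := 0) ![] 1 where
  apply_eq e := by
    change e _ = _
    rw [one_mul]; congr 1; exact Subsingleton.elim _ _
  eq_zero c e _ h := by
    ext v; rw [Subsingleton.elim v ![], h]; rfl
  exists_ne_zero := by
    refine ⟨ContinuousAlternatingMap.constOfIsEmpty ℝ (ℂ × ℝ) (Fin 0) 1, ?_, ?_⟩
    · rw [mem_eigenforms, one_smul]; rfl
    · simp

theorem apply_fst_eq_zero {c : ℝ} (f : (ℂ × ℝ) →ₗ[ℝ] ℝ)
    (h : ∀ z : ℂ, f (D.β * z, 0) = c * f (z, 0)) (z : ℂ) : f (z, 0) = 0 := by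
  refine eq_zero_of_mul_invariant (f := fun z ↦ f (z, 0)) (fun z w ↦ ?_) (fun t z ↦ ?_)
    D.β_im_ne_zero h z
  · rw [← map_add]; simp
  · rw [← smul_eq_mul t, ← map_smul]; simp

theorem isEigenEvaluation_one : IsEigenEvaluation D.fiberMap (k := 1) ![(0, 1)] D.α where
  apply_eq e := by
    have h : e (Function.update ![(0, 1)] 0 (D.α • (0, 1))) =
        D.α • e (Function.update ![(0, 1)] 0 (0, 1)) := e.map_update_smul _ _ _ _
    have hu : Function.update ![((0, 1) : ℂ × ℝ)] 0 (0, 1) = ![(0, 1)] := by simp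
    rw [smul_eq_mul, hu] at h
    rw [← h]
    change e _ = e _
    congr 1; ext i <;> simp [Subsingleton.elim i 0]
  eq_zero c e he h := by
    rw [mem_eigenforms] at he
    have h₁ (v : ℂ × ℝ) : e ![D.fiberMap v] = c * e ![v] := by
      have := congrArg (fun f ↦ f ![v]) he
      refine Eq.trans ?_ this
      change e _ = e _
      congr 1; ext i <;> simp [Subsingleton.elim i 0]
    let f : (ℂ × ℝ) →ₗ[ℝ] ℝ :=
      ((ContinuousAlternatingMap.ofSubsingleton ℝ (ℂ × ℝ) ℝ (0 : Fin 1)).symm e).toLinearMap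
    have hf (v : ℂ × ℝ) : f v = e ![v] := by
      change e _ = e _
      congr 1; ext i <;> simp [Subsingleton.elim i 0]
    ext v
    have hv : v = ![((v 0).1, 0) + (v 0).2 • (0, 1)] := by
      ext i <;> simp [Subsingleton.elim i 0]
    have hz := D.apply_fst_eq_zero (c := c) f (fun z ↦ by
      rw [hf, hf, ← h₁]; simp) (v 0).1
    rw [hv, ← hf, map_add, hz, map_smul, hf, h]
    simp
  exists_ne_zero := by
    refine ⟨ContinuousAlternatingMap.ofSubsingleton ℝ (ℂ × ℝ) ℝ (0 : Fin 1)
      (ContinuousLinearMap.snd ℝ ℂ ℝ), ?_, ?_⟩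
    · rw [mem_eigenforms]; rfl
    · simp

/-- Top-degree forms are multiples of the determinant, on which the pullback acts by `det B = 1`. -/
theorem isEigenEvaluation_three : IsEigenEvaluation D.fiberMap (k := 3) stdBasis 1 where
  apply_eq e := by
    have h := congrArg (fun f ↦ f (D.fiberMap ∘ stdBasis))
      (e.toAlternatingMap.eq_smul_basis_det stdBasis)
    change e _ = e _ * stdBasis.det _ at h
    have h₁ := stdBasis.det_comp (D.fiberMap : (ℂ × ℝ) →ₗ[ℝ] (ℂ × ℝ)) stdBasis
    rw [det_fiberMap, one_mul, Module.Basis.det_self] at h₁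
    change stdBasis.det (D.fiberMap ∘ stdBasis) = 1 at h₁
    rw [h₁, mul_one] at h
    rw [one_mul]; exact h
  eq_zero c e _ h := by
    have h₁ := e.toAlternatingMap.eq_smul_basis_det stdBasis
    ext v
    have := congrArg (fun f ↦ f v) h₁
    change e v = e _ * stdBasis.det _ at this
    rw [this, h, zero_mul]; rfl
  exists_ne_zero := by
    refine ⟨detForm stdBasis, ?_, ?_⟩
    · rw [mem_eigenforms, one_smul]; ext v
      have h₁ := stdBasis.det_comp (D.fiberMap : (ℂ × ℝ) →ₗ[ℝ] (ℂ × ℝ)) v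
      rw [det_fiberMap, one_mul] at h₁
      exact h₁
    · rw [detForm_apply, Module.Basis.det_self]; exact one_ne_zero

theorem normSq_β : Complex.normSq D.β = D.α⁻¹ :=
  eq_inv_of_mul_eq_one_left D.normSq_β_mul_α

/-- The area form of `ℂ`, pulled back to `ℂ × ℝ`. -/
noncomputable def areaForm : (ℂ × ℝ) [⋀^Fin 2]→L[ℝ] ℝ :=
  (detForm Complex.basisOneI).compContinuousLinearMap (ContinuousLinearMap.fst ℝ ℂ ℝ)

theorem areaForm_apply (v : Fin 2 → ℂ × ℝ) :
    areaForm v = (v 0).1.re * (v 1).1.im - (v 1).1.re * (v 0).1.im := by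
  change Complex.basisOneI.det (fun i ↦ (v i).1) = _
  rw [Module.Basis.det_apply, Matrix.det_fin_two]
  simp [Module.Basis.toMatrix_apply]

theorem apply_fst_fst (e : (ℂ × ℝ) [⋀^Fin 2]→L[ℝ] ℝ) (z w : ℂ) :
    e ![(z, 0), (w, 0)] = (z.re * w.im - w.re * z.im) * e ![(1, 0), (Complex.I, 0)] := by
  let i : ℂ →L[ℝ] (ℂ × ℝ) := ContinuousLinearMap.inl ℝ ℂ ℝ
  have h := congrArg (fun f ↦ f ![z, w])
    ((e.compContinuousLinearMap i).toAlternatingMap.eq_smul_basis_det Complex.basisOneI)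
  change e _ = e _ * Complex.basisOneI.det _ at h
  rw [Module.Basis.det_apply, Matrix.det_fin_two] at h
  simp only [Module.Basis.toMatrix_apply, Complex.coe_basisOneI_repr] at h
  have h₁ : (⇑i ∘ ![z, w] : Fin 2 → ℂ × ℝ) = ![(z, 0), (w, 0)] := by
    funext j; fin_cases j <;> rfl
  have h₂ : (⇑i ∘ Complex.basisOneI : Fin 2 → ℂ × ℝ) = ![(1, 0), (Complex.I, 0)] := by
    funext j; fin_cases j <;> simp [i]
  rw [← h₁, ← h₂, mul_comm]
  exact h

/-- A two-form splits into a multiple of the area form of `ℂ`, scaled by `|β|² = α⁻¹`, and the mixed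
part `z ↦ e((z, 0), (0, 1))`, which has no real eigenvalue. -/
theorem isEigenEvaluation_two :
    IsEigenEvaluation D.fiberMap (k := 2) ![(1, 0), (Complex.I, 0)] D.α⁻¹ where
  apply_eq e := by
    have h₁ : (⇑D.fiberMap ∘ ![(1, 0), (Complex.I, 0)] : Fin 2 → ℂ × ℝ) =
        ![(D.β, 0), (D.β * Complex.I, 0)] := by
      funext j; fin_cases j <;> simp
    change e (⇑D.fiberMap ∘ _) = _
    rw [h₁, apply_fst_fst, ← D.normSq_β, Complex.normSq_apply]
    simp
  eq_zero c e he h := by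
    rw [mem_eigenforms] at he
    have h₁ (v w : ℂ × ℝ) : e ![D.fiberMap v, D.fiberMap w] = c * e ![v, w] := by
      refine Eq.trans ?_ (congrArg (fun f ↦ f ![v, w]) he)
      change e _ = e (⇑D.fiberMap ∘ _)
      congr 1; funext j; fin_cases j <;> rfl
    let f : (ℂ × ℝ) →ₗ[ℝ] ℝ := e.toMultilinearMap.toLinearMap ![0, (0, 1)] 0
    have hf (v : ℂ × ℝ) : f v = e ![v, (0, 1)] := by
      change e _ = e _
      congr 1; funext j; fin_cases j <;> rfl
    have hz (z : ℂ) : e ![(z, 0), (0, 1)] = 0 := by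
      rw [← hf]
      -- The vector `(0, 1)` is scaled by `α`, so on `ℂ` the functional has the factor `α⁻¹ c` in
      -- place of `c`.
      refine D.apply_fst_eq_zero (c := D.α⁻¹ * c) f (fun z ↦ ?_) z
      have h₂ := h₁ (z, 0) (0, 1)
      have h₃ : (![D.fiberMap (z, 0), D.fiberMap (0, 1)] : Fin 2 → ℂ × ℝ) =
          Function.update ![(D.β * z, 0), (0, 1)] 1 (D.α • (0, 1)) := by
        funext j; fin_cases j <;> simp
      have h₄ : Function.update ![(D.β * z, 0), (0, 1)] 1 ((0, 1) : ℂ × ℝ) =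
          ![(D.β * z, 0), (0, 1)] := by
        funext j; fin_cases j <;> simp
      rw [h₃, e.map_update_smul, h₄, smul_eq_mul] at h₂
      rw [hf, hf, mul_assoc, ← h₂, inv_mul_cancel_left₀ D.α_pos.ne']
    have hswap (v w : ℂ × ℝ) : e ![v, w] = - e ![w, v] := by
      have := e.toAlternatingMap.map_swap ![w, v] (i := 0) (j := 1) (by decide)
      refine Eq.trans ?_ this
      change e _ = e _
      congr 1; funext j; fin_cases j <;> simp
    have hzero : e.toAlternatingMap = 0 := by
      refine Module.Basis.ext_alternating stdBasis fun j hj ↦ ?_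
      change e _ = 0
      have hj' : (fun i ↦ stdBasis (j i)) = ![stdBasis (j 0), stdBasis (j 1)] := by
        funext i; fin_cases i <;> rfl
      have hne : j 0 ≠ j 1 := fun h ↦ absurd (hj h) (by decide)
      rw [hj']
      generalize j 0 = p at hne
      generalize j 1 = q at hne
      fin_cases p <;> fin_cases q <;>
        simp only [Fin.zero_eta, Fin.mk_one, Fin.reduceFinMk, stdBasis_zero, stdBasis_one,
          stdBasis_two] at hne ⊢
      all_goals first
        | exact absurd rfl hne
        | exact hz _
        | exact h
        | rw [hswap, hz, neg_zero]
        | rw [hswap, h, neg_zero]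
    ext v
    exact congrArg (fun f ↦ f v) hzero
  exists_ne_zero := by
    refine ⟨areaForm, ?_, ?_⟩
    · rw [mem_eigenforms]; ext v
      change areaForm (⇑D.fiberMap ∘ v) = D.α⁻¹ * areaForm v
      rw [areaForm_apply, areaForm_apply, ← D.normSq_β, Complex.normSq_apply]
      simp; ring
    · rw [areaForm_apply]; simp

theorem alternatingMap_eq_zero {k : ℕ} (hk : 3 < k) (e : (ℂ × ℝ) [⋀^Fin k]→L[ℝ] ℝ) : e = 0 := by
  have hzero : e.toAlternatingMap = 0 := by
    refine Module.Basis.ext_alternating stdBasis fun j hj ↦ ?_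
    have := Fintype.card_le_of_injective j hj
    simp only [Fintype.card_fin] at this
    omega
  ext v
  exact congrArg (fun f ↦ f v) hzero

/-- The eigenvalue of `fiberMap` on the alternating maps of degree `k` that has a real
eigenvector. -/
noncomputable def eigenvalue : ℕ → ℝ
  | 1 => D.α
  | 2 => D.α⁻¹
  | _ => 1

/-- The value `1` of `eigenvalue` is meaningful in degrees `0` and `3`; above degree three it is a
placeholder, since there are no nonzero forms. -/
theorem exists_isEigenEvaluation {k : ℕ} (hk : k ≤ 3) :
    ∃ u, IsEigenEvaluation D.fiberMap (k := k) u (D.eigenvalue k) := by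
  interval_cases k
  · exact ⟨_, D.isEigenEvaluation_zero⟩
  · exact ⟨_, D.isEigenEvaluation_one⟩
  · exact ⟨_, D.isEigenEvaluation_two⟩
  · exact ⟨_, D.isEigenEvaluation_three⟩

theorem disjoint_eigenforms (c : ℝ) (k : ℕ) :
    Disjoint (eigenforms D.fiberMap c k) (LinearMap.range (altDefect D.fiberMap c k)) := by
  rcases le_or_gt k 3 with hk | hk
  · obtain ⟨u, hu⟩ := D.exists_isEigenEvaluation hk
    exact hu.disjoint c
  · rw [Submodule.disjoint_def]
    exact fun e _ _ ↦ alternatingMap_eq_zero hk e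

theorem subsingleton_eigenforms {c : ℝ} {k : ℕ} (h : k ≤ 3 → c ≠ D.eigenvalue k) :
    Subsingleton (eigenforms D.fiberMap c k) := by
  rcases le_or_gt k 3 with hk | hk
  · obtain ⟨u, hu⟩ := D.exists_isEigenEvaluation hk
    rw [hu.eigenforms_eq_bot (h hk)]
    infer_instance
  · exact ⟨fun e e' ↦ Subtype.ext <|
      (alternatingMap_eq_zero hk e.1).trans (alternatingMap_eq_zero hk e'.1).symm⟩

theorem nonempty_eigenforms_equiv {c : ℝ} {k : ℕ} (hk : k ≤ 3) (h : c = D.eigenvalue k) :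
    Nonempty (eigenforms D.fiberMap c k ≃ₗ[ℝ] ℝ) := by
  obtain ⟨u, hu⟩ := D.exists_isEigenEvaluation hk
  rw [h]
  exact hu.nonempty_equiv

/-! ### The universal covering of the surface in linear coordinates -/

/-- The diffeomorphism `((z, x), s) ↦ (z, x + i α ^ s)` from `(ℂ × ℝ) × ℝ` onto `ℂ × ℍ ⊆ ℂ × ℂ`. -/
noncomputable def expCoord (v : (ℂ × ℝ) × ℝ) : ℂ × ℂ :=
  (v.1.1, v.1.2 + ((D.α ^ v.2 : ℝ) : ℂ) * Complex.I)

/-- The inverse of `expCoord` on `ℂ × ℍ`. -/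
noncomputable def logCoord (u : ℂ × ℂ) : (ℂ × ℝ) × ℝ :=
  ((u.1, u.2.re), Real.logb D.α u.2.im)

theorem expCoord_im (v : (ℂ × ℝ) × ℝ) : (D.expCoord v).2.im = D.α ^ v.2 := by
  simp [expCoord]

theorem expCoord_im_pos (v : (ℂ × ℝ) × ℝ) : 0 < (D.expCoord v).2.im := by
  rw [expCoord_im]
  exact Real.rpow_pos_of_pos D.α_pos _

theorem logCoord_expCoord (v : (ℂ × ℝ) × ℝ) : D.logCoord (D.expCoord v) = v := by
  refine Prod.ext (Prod.ext rfl ?_) ?_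
  · simp [logCoord, expCoord]
  · change Real.logb D.α (D.expCoord v).2.im = _
    rw [expCoord_im, Real.logb_rpow D.α_pos D.one_lt_α.ne']

theorem expCoord_logCoord {u : ℂ × ℂ} (hu : 0 < u.2.im) : D.expCoord (D.logCoord u) = u := by
  refine Prod.ext rfl (Complex.ext ?_ ?_)
  · simp [logCoord, expCoord]
  · rw [expCoord_im]
    exact Real.rpow_logb D.α_pos D.one_lt_α.ne' hu

theorem contDiff_expCoord : ContDiff ℝ ∞ D.expCoord := by
  have h : ContDiff ℝ ∞ fun v : (ℂ × ℝ) × ℝ ↦ D.α ^ v.2 :=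
    contDiff_const.rpow contDiff_snd fun _ ↦ D.α_pos.ne'
  unfold expCoord
  exact (contDiff_fst.comp contDiff_fst).prodMk
    ((Complex.ofRealCLM.contDiff.comp (contDiff_snd.comp contDiff_fst)).add
      ((Complex.ofRealCLM.contDiff.comp h).mul contDiff_const))

theorem contDiffAt_logCoord {u : ℂ × ℂ} (hu : 0 < u.2.im) : ContDiffAt ℝ ∞ D.logCoord u := by
  have h : ContDiffAt ℝ ∞ (fun u : ℂ × ℂ ↦ Real.logb D.α u.2.im) u := by
    have h₁ : ContDiffAt ℝ ∞ (fun u : ℂ × ℂ ↦ u.2.im) u :=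
      (Complex.imCLM.contDiff.comp contDiff_snd).contDiffAt
    exact (h₁.log hu.ne').div_const _
  exact (contDiffAt_fst.prodMk
    (Complex.reCLM.contDiff.comp contDiff_snd).contDiffAt).prodMk h

theorem fderiv_logCoord_comp_fderiv_expCoord (v : (ℂ × ℝ) × ℝ) :
    (fderiv ℝ D.logCoord (D.expCoord v)).comp (fderiv ℝ D.expCoord v) =
      ContinuousLinearMap.id ℝ _ := by
  rw [← fderiv_comp v ((D.contDiffAt_logCoord (D.expCoord_im_pos v)).differentiableAt (by simp))
    (D.contDiff_expCoord.differentiable (by simp) v)]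
  have h : D.logCoord ∘ D.expCoord = id := funext D.logCoord_expCoord
  rw [h, fderiv_id]

/-- The covering map `(ℂ × ℝ) × ℝ → S⁰`, `((z, x), s) ↦ [z, x + i α ^ s]`. -/
noncomputable def cover (v : (ℂ × ℝ) × ℝ) : D.Surface :=
  Quotient.mk (MulAction.orbitRel D.group (ℂ × ℍ)) (v.1.1, ⟨(D.expCoord v).2, D.expCoord_im_pos v⟩)

theorem mk_smul (g : D.group) (p : ℂ × ℍ) :
    Quotient.mk (MulAction.orbitRel D.group (ℂ × ℍ)) ((g : Equiv.Perm (ℂ × ℍ)) p) =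
      Quotient.mk _ p :=
  Quotient.sound (s := MulAction.orbitRel D.group (ℂ × ℍ)) ⟨g, rfl⟩

theorem mk_eq_cover (p : ℂ × ℍ) :
    Quotient.mk (MulAction.orbitRel D.group (ℂ × ℍ)) p = D.cover (D.logCoord (p.1, p.2)) := by
  refine congrArg (Quotient.mk _) (Prod.ext rfl (UpperHalfPlane.ext ?_))
  exact (congrArg Prod.snd (D.expCoord_logCoord (u := (p.1, (p.2 : ℂ))) p.2.im_pos)).symm

theorem cover_shift (v : (ℂ × ℝ) × ℝ) : D.cover (shift D.fiberMap v) = D.cover v := by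
  refine Eq.trans ?_ (D.mk_smul ⟨D.scaling, Subgroup.subset_closure (mem_insert _ _)⟩ _)
  refine congrArg (Quotient.mk _) (Prod.ext rfl (UpperHalfPlane.ext ?_))
  change (D.expCoord _).2 = (D.α : ℂ) * (D.expCoord v).2
  simp [expCoord, shift, Real.rpow_add_one D.α_pos.ne']
  ring

theorem cover_add_lattice {m : ℂ × ℝ} (hm : m ∈ D.lattice) (v : (ℂ × ℝ) × ℝ) :
    D.cover (v + (m, 0)) = D.cover v := by
  rw [lattice, ← Submodule.mem_toAddSubgroup, Submodule.span_int_eq_addSubgroupClosure] at hm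
  induction hm using AddSubgroup.closure_induction generalizing v with
  | mem m hm =>
    obtain ⟨i, rfl⟩ := hm
    rw [latticeBasis_apply]
    refine Eq.trans ?_ (D.mk_smul ⟨D.translation i, Subgroup.subset_closure (Or.inr ⟨i, rfl⟩)⟩ _)
    refine congrArg (Quotient.mk _) (Prod.ext rfl (UpperHalfPlane.ext ?_))
    change (D.expCoord _).2 = (D.a i : ℂ) + (D.expCoord v).2
    simp [expCoord]
    ring
  | zero => rw [Prod.mk_zero_zero, add_zero]
  | add m m' _ _ hm hm' =>
    rw [← hm v, ← hm' (v + (m, 0)), add_assoc]; simp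
  | neg m _ hm =>
    rw [← hm (v + (-m, 0))]
    congr 1
    simp [Prod.ext_iff]

theorem exists_of_cover_eq {v v' : (ℂ × ℝ) × ℝ} (h : D.cover v' = D.cover v) :
    ∃ n : ℤ, ∃ m ∈ D.lattice,
      v' = ((D.β ^ n * v.1.1, D.α ^ n * v.1.2), v.2 + n) + (m, 0) := by
  obtain ⟨g, hg⟩ := Quotient.exact (s := MulAction.orbitRel D.group (ℂ × ℍ)) h
  obtain ⟨n, m, hnm⟩ := D.exists_isNormalForm g.2
  have h₁ := (hnm (v.1.1, ⟨(D.expCoord v).2, D.expCoord_im_pos v⟩)).1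
  have h₂ := (hnm (v.1.1, ⟨(D.expCoord v).2, D.expCoord_im_pos v⟩)).2
  replace hg : (g : Equiv.Perm (ℂ × ℍ)) (v.1.1, ⟨(D.expCoord v).2, D.expCoord_im_pos v⟩) =
    (v'.1.1, ⟨(D.expCoord v').2, D.expCoord_im_pos v'⟩) := hg
  rw [hg] at h₁ h₂
  replace h₂ : (D.expCoord v').2 = ((D.α ^ n : ℝ) : ℂ) * (D.expCoord v).2 +
    ((∑ i, (m i : ℝ) * D.a i : ℝ) : ℂ) := h₂
  refine ⟨n, _, D.mem_lattice.2 ⟨m, rfl⟩, Prod.ext (Prod.ext h₁ ?_) ?_⟩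
  · have := congrArg Complex.re h₂
    rw [Complex.add_re, Complex.re_ofReal_mul, Complex.ofReal_re] at this
    simpa [expCoord] using this
  · have := congrArg Complex.im h₂
    rw [Complex.add_im, Complex.im_ofReal_mul, Complex.ofReal_im, add_zero, expCoord_im,
      expCoord_im, ← Real.rpow_intCast, ← Real.rpow_add D.α_pos] at this
    have h₃ := congrArg (Real.logb D.α) this
    rw [Real.logb_rpow D.α_pos D.one_lt_α.ne', Real.logb_rpow D.α_pos D.one_lt_α.ne'] at h₃
    change v'.2 = v.2 + n + 0
    rw [h₃]; ring

/-! ### Deck transformations -/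

/-- The affine map `v ↦ A v + c` is a deck transformation of `cover`, and it preserves the invariant
forms. -/
structure IsDeck (A : ((ℂ × ℝ) × ℝ) ≃L[ℝ] ((ℂ × ℝ) × ℝ)) (c : (ℂ × ℝ) × ℝ) : Prop where
  cover_eq : ∀ v, D.cover (A v + c) = D.cover v
  pullback_eq : ∀ k, ∀ τ ∈ twistedForms D.lattice D.fiberMap 1 k, ∀ v,
    (τ (A v + c)).compContinuousLinearMap (A : (ℂ × ℝ) × ℝ →L[ℝ] (ℂ × ℝ) × ℝ) = τ v

/-- Two points are related by a deck transformation. -/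
def DeckRel (v v' : (ℂ × ℝ) × ℝ) : Prop := ∃ A c, D.IsDeck A c ∧ v' = A v + c

variable {D}

theorem DeckRel.trans {v v' v'' : (ℂ × ℝ) × ℝ} (h : D.DeckRel v v') (h' : D.DeckRel v' v'') :
    D.DeckRel v v'' := by
  obtain ⟨A, c, hA, rfl⟩ := h
  obtain ⟨A', c', hA', rfl⟩ := h'
  refine ⟨A.trans A', A' c + c', ⟨fun v ↦ ?_, fun k τ hτ v ↦ ?_⟩, ?_⟩
  · rw [← hA.cover_eq v, ← hA'.cover_eq (A v + c)]
    congr 1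
    simp [add_assoc]
  · rw [← hA.pullback_eq k τ hτ v, ← hA'.pullback_eq k τ hτ (A v + c), map_add, add_assoc]
    rfl
  · simp [add_assoc]

theorem DeckRel.symm {v v' : (ℂ × ℝ) × ℝ} (h : D.DeckRel v v') : D.DeckRel v' v := by
  obtain ⟨A, c, hA, rfl⟩ := h
  have h (w : (ℂ × ℝ) × ℝ) : A (A.symm w + -A.symm c) + c = w := by simp
  refine ⟨A.symm, -A.symm c, ⟨fun v ↦ ?_, fun k τ hτ v ↦ ?_⟩, by simp⟩
  · rw [← hA.cover_eq, h]
  · rw [← hA.pullback_eq k τ hτ, h]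
    ext u
    exact congrArg (τ v) (funext fun i ↦ A.apply_symm_apply (u i))

variable (D)

theorem shiftLinear_add (v : (ℂ × ℝ) × ℝ) :
    shiftLinear D.fiberMap v + (0, 1) = shift D.fiberMap v := by
  simp [shift, shiftLinear]

theorem isDeck_shift : D.IsDeck (shiftLinear D.fiberMap) (0, 1) where
  cover_eq v := by rw [shiftLinear_add, cover_shift]
  pullback_eq k τ hτ v := by
    rw [shiftLinear_add]
    have := congrFun (mem_twistedForms.1 hτ).2 v
    rwa [one_smul] at this

theorem isDeck_refl {m : ℂ × ℝ} (hm : m ∈ D.lattice) :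
    D.IsDeck (ContinuousLinearEquiv.refl ℝ _) (m, 0) where
  cover_eq v := D.cover_add_lattice hm v
  pullback_eq _ _ hτ v := hτ.1.2 m hm v

theorem deckRel_shift (v : (ℂ × ℝ) × ℝ) : D.DeckRel v (shift D.fiberMap v) :=
  ⟨_, _, D.isDeck_shift, (D.shiftLinear_add v).symm⟩

theorem deckRel_add {m : ℂ × ℝ} (hm : m ∈ D.lattice) (v : (ℂ × ℝ) × ℝ) :
    D.DeckRel v (v + (m, 0)) :=
  ⟨_, _, D.isDeck_refl hm, rfl⟩

/-- By the normal form of the group elements, `v'` is a lattice translate of an iterate of `shift`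
at `v`; negative iterates use the symmetry of `DeckRel`. -/
theorem deckRel_of_cover_eq {v v' : (ℂ × ℝ) × ℝ} (h : D.cover v' = D.cover v) :
    D.DeckRel v v' := by
  obtain ⟨n, m, hm, rfl⟩ := D.exists_of_cover_eq h
  refine DeckRel.trans ?_ (D.deckRel_add hm _)
  clear h hm
  induction n with
  | zero =>
    have h := D.deckRel_add (zero_mem D.lattice) v
    rw [Prod.mk_zero_zero, add_zero] at h
    simpa using h
  | succ n ih =>
    refine ih.trans ?_
    convert D.deckRel_shift _ using 1
    refine Prod.ext (Prod.ext ?_ ?_) ?_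
    · simp [shift, zpow_add_one₀ D.β_ne_zero]; ring
    · simp [shift, zpow_add_one₀ D.α_pos.ne']; ring
    · simp [shift]; ring
  | pred n ih =>
    refine ih.trans (DeckRel.symm ?_)
    convert D.deckRel_shift _ using 1
    refine Prod.ext (Prod.ext ?_ ?_) ?_
    · simp [shift, zpow_sub_one₀ D.β_ne_zero]; field_simp [D.β_ne_zero]
    · simp [shift, zpow_sub_one₀ D.α_pos.ne']; field_simp [D.α_pos.ne']
    · simp [shift]; ring

/-! ### The charts of the surface -/

/-- Whatever local section of the quotient map defines a chart, the inverse of that chart is the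
quotient map itself. All charts are thus expressed through the single map `cover`. -/
theorem chart_symm_eq {x : D.Surface} {u : ℂ × ℂ} (hu : u ∈ (extChartAt model x).target) :
    0 < u.2.im ∧ (extChartAt model x).symm u = D.cover (D.logCoord u) := by
  have hq := D.isLocalHomeomorph_mk
  set p := (Quotient.mk_surjective (s := MulAction.orbitRel D.group
    (ℂ × ℍ))).hasRightInverse.choose x
  set e := chartAt (ModelProd ℂ ℂ) p
  have hu' : u ∈ ((hq.localInverseAt p).trans e).target := by
    rw [extChartAt_target] at hu
    exact hu.1
  have hu₁ : u ∈ e.target := hu'.1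
  have h₂ : (((e.symm u).1, ((e.symm u).2 : ℂ)) : ℂ × ℂ) = u := e.right_inv hu₁
  constructor
  · rw [← h₂]
    exact (e.symm u).2.im_pos
  · change (hq.localInverseAt p).symm (e.symm u) = _
    rw [hq.localInverseAt_symm, mk_eq_cover, h₂]

/-- The point of the universal covering that corresponds to the center of the chart around `x`. -/
noncomputable def basePoint (x : D.Surface) : (ℂ × ℝ) × ℝ :=
  D.logCoord (extChartAt model x x)

theorem cover_basePoint (x : D.Surface) : D.cover (D.basePoint x) = x := by
  rw [basePoint, ← (D.chart_symm_eq (mem_extChartAt_target x)).2, extChartAt_to_inv]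

theorem expCoord_basePoint (x : D.Surface) : D.expCoord (D.basePoint x) = extChartAt model x x :=
  D.expCoord_logCoord (D.chart_symm_eq (mem_extChartAt_target x)).1

theorem isOpen_chart_target (x : D.Surface) : IsOpen (extChartAt model x).target :=
  isOpen_extChartAt_target x

theorem expCoord_mem_target (x : D.Surface) :
    ∀ᶠ v in 𝓝 (D.basePoint x), D.expCoord v ∈ (extChartAt model x).target :=
  D.contDiff_expCoord.continuous.continuousAt.eventually_mem
    ((D.isOpen_chart_target x).mem_nhds (by
      rw [expCoord_basePoint]; exact mem_extChartAt_target x))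

theorem cover_eq_chart_symm {x : D.Surface} {v : (ℂ × ℝ) × ℝ}
    (hv : D.expCoord v ∈ (extChartAt model x).target) :
    D.cover v = (extChartAt model x).symm (D.expCoord v) := by
  rw [(D.chart_symm_eq hv).2, logCoord_expCoord]

/-- At a base point, `cover` is the inverse chart after `expCoord`. Any other point is carried to a
base point by a deck transformation, under which `cover` is invariant. -/
theorem mdifferentiableAt_cover (v : (ℂ × ℝ) × ℝ) :
    MDifferentiableAt 𝓘(ℝ, (ℂ × ℝ) × ℝ) model D.cover v := by
  have h₀ (x : D.Surface) :
      MDifferentiableAt 𝓘(ℝ, (ℂ × ℝ) × ℝ) model D.cover (D.basePoint x) := by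
    have h₁ : MDifferentiableAt 𝓘(ℝ, (ℂ × ℝ) × ℝ) 𝓘(ℝ, ℂ × ℂ) D.expCoord (D.basePoint x) :=
      (D.contDiff_expCoord.differentiable (by simp) _).mdifferentiableAt
    have h₂ : MDifferentiableAt 𝓘(ℝ, ℂ × ℂ) model (extChartAt model x).symm
        (D.expCoord (D.basePoint x)) := by
      have := mdifferentiableWithinAt_extChartAt_symm (I := model)
        (D.expCoord_mem_target x).self_of_nhds
      rwa [ModelWithCorners.range_eq_univ, mdifferentiableWithinAt_univ] at this
    refine (h₂.comp _ h₁).congr_of_eventuallyEq ?_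
    filter_upwards [D.expCoord_mem_target x] with w hw using D.cover_eq_chart_symm hw
  obtain ⟨A, c, hA, hv⟩ := D.deckRel_of_cover_eq (D.cover_basePoint (D.cover v))
  have hcov : D.cover = D.cover ∘ fun v ↦ A v + c := funext fun w ↦ (hA.cover_eq w).symm
  rw [hcov]
  have hd : DifferentiableAt ℝ (fun v ↦ A v + c) v := by fun_prop
  refine MDifferentiableAt.comp v ?_ hd.mdifferentiableAt
  rw [← hv]
  exact h₀ _

/-! ### Lifting forms to the universal covering -/

/-- The derivative of `cover`. -/
noncomputable def coverDeriv (v : (ℂ × ℝ) × ℝ) : (ℂ × ℝ) × ℝ →L[ℝ] ℂ × ℂ :=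
  mfderiv 𝓘(ℝ, (ℂ × ℝ) × ℝ) model D.cover v

/-- The derivative of the chart around `x` at `x`. -/
noncomputable def chartDeriv (x : D.Surface) : ℂ × ℂ →L[ℝ] ℂ × ℂ :=
  mfderiv model 𝓘(ℝ, ℂ × ℂ) (extChartAt model x) x

/-- The pullback of a form on the surface by `cover`. -/
noncomputable def lift (k : ℕ) : FormField model D.Surface k →ₗ[ℝ]
    ((ℂ × ℝ) × ℝ → ((ℂ × ℝ) × ℝ) [⋀^Fin k]→L[ℝ] ℝ) where
  toFun σ v := ContinuousAlternatingMap.compContinuousLinearMap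
    (σ (D.cover v) : (ℂ × ℂ) [⋀^Fin k]→L[ℝ] ℝ) (D.coverDeriv v)
  map_add' _ _ := rfl
  map_smul' _ _ := rfl

theorem lift_apply {k : ℕ} (σ : FormField model D.Surface k) (v : (ℂ × ℝ) × ℝ) :
    D.lift k σ v = ContinuousAlternatingMap.compContinuousLinearMap
      (σ (D.cover v) : (ℂ × ℂ) [⋀^Fin k]→L[ℝ] ℝ) (D.coverDeriv v) := rfl

/-- Moves a form between equal points, where rewriting is obstructed by the dependence of the
tangent space on the point. -/
theorem comp_congr {k : ℕ} (σ : FormField model D.Surface k) {x y : D.Surface} (h : x = y)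
    {E : Type*} [NormedAddCommGroup E] [NormedSpace ℝ E] (T : E →L[ℝ] ℂ × ℂ) :
    ContinuousAlternatingMap.compContinuousLinearMap (σ x : (ℂ × ℂ) [⋀^Fin k]→L[ℝ] ℝ) T =
      ContinuousAlternatingMap.compContinuousLinearMap (σ y : (ℂ × ℂ) [⋀^Fin k]→L[ℝ] ℝ) T := by
  subst h; rfl

variable {D}

theorem IsDeck.coverDeriv_comp {A : ((ℂ × ℝ) × ℝ) ≃L[ℝ] ((ℂ × ℝ) × ℝ)} {c : (ℂ × ℝ) × ℝ}
    (hA : D.IsDeck A c) (v : (ℂ × ℝ) × ℝ) :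
    (D.coverDeriv (A v + c)).comp (A : (ℂ × ℝ) × ℝ →L[ℝ] (ℂ × ℝ) × ℝ) = D.coverDeriv v := by
  have h₁ : HasFDerivAt (fun v ↦ A v + c) (A : (ℂ × ℝ) × ℝ →L[ℝ] (ℂ × ℝ) × ℝ) v :=
    A.hasFDerivAt.add_const c
  have h₂ := HasMFDerivAt.comp v (D.mdifferentiableAt_cover (A v + c)).hasMFDerivAt
    h₁.hasMFDerivAt
  have h₃ : D.cover ∘ (fun v ↦ A v + c) = D.cover := funext hA.cover_eq
  rw [h₃] at h₂
  exact h₂.mfderiv.symm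

theorem IsDeck.lift_comp {A : ((ℂ × ℝ) × ℝ) ≃L[ℝ] ((ℂ × ℝ) × ℝ)} {c : (ℂ × ℝ) × ℝ}
    (hA : D.IsDeck A c) {k : ℕ} (σ : FormField model D.Surface k) (v : (ℂ × ℝ) × ℝ) :
    (D.lift k σ (A v + c)).compContinuousLinearMap (A : (ℂ × ℝ) × ℝ →L[ℝ] (ℂ × ℝ) × ℝ) =
      D.lift k σ v := by
  rw [lift_apply, lift_apply, ← hA.coverDeriv_comp v, D.comp_congr σ (hA.cover_eq v)]
  rfl

variable (D)

theorem lift_shift {k : ℕ} (σ : FormField model D.Surface k) :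
    shiftPullback D.fiberMap k (D.lift k σ) = D.lift k σ := by
  funext v
  rw [← D.isDeck_shift.lift_comp σ v, shiftLinear_add]
  rfl

theorem lift_add_lattice {k : ℕ} (σ : FormField model D.Surface k) {m : ℂ × ℝ}
    (hm : m ∈ D.lattice) (v : (ℂ × ℝ) × ℝ) : D.lift k σ (v + (m, 0)) = D.lift k σ v :=
  (D.isDeck_refl hm).lift_comp σ v

theorem chartDeriv_comp_coverDeriv (x : D.Surface) :
    (D.chartDeriv x).comp (D.coverDeriv (D.basePoint x)) = fderiv ℝ D.expCoord (D.basePoint x) := by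
  have h₀ : MDifferentiableAt model 𝓘(ℝ, ℂ × ℂ) (extChartAt model x)
      (D.cover (D.basePoint x)) := by
    rw [cover_basePoint]
    exact mdifferentiableAt_extChartAt (mem_chart_source _ x)
  have h₁ := HasMFDerivAt.comp _ h₀.hasMFDerivAt
    (D.mdifferentiableAt_cover (D.basePoint x)).hasMFDerivAt
  have h₂ : extChartAt model x ∘ D.cover =ᶠ[𝓝 (D.basePoint x)] D.expCoord := by
    filter_upwards [D.expCoord_mem_target x] with v hv
    rw [Function.comp_apply, D.cover_eq_chart_symm hv, (extChartAt model x).right_inv hv]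
  let P (y : D.Surface) : ℂ × ℂ →L[ℝ] ℂ × ℂ := mfderiv model 𝓘(ℝ, ℂ × ℂ) (extChartAt model x) y
  have h₃ : HasFDerivAt D.expCoord ((P (D.cover (D.basePoint x))).comp
      (D.coverDeriv (D.basePoint x))) (D.basePoint x) :=
    hasMFDerivAt_iff_hasFDerivAt.1 (h₁.congr_of_eventuallyEq h₂.symm)
  rw [h₃.fderiv, cover_basePoint]
  rfl

theorem mfderivWithin_chart_symm {x : D.Surface} {u : ℂ × ℂ}
    (hu : u ∈ (extChartAt model x).target) :
    (mfderivWithin 𝓘(ℝ, ℂ × ℂ) model (extChartAt model x).symm (range model) u :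
      ℂ × ℂ →L[ℝ] ℂ × ℂ) = (D.coverDeriv (D.logCoord u)).comp (fderiv ℝ D.logCoord u) := by
  rw [ModelWithCorners.range_eq_univ, mfderivWithin_univ]
  have h₀ := ((D.contDiffAt_logCoord (D.chart_symm_eq hu).1).differentiableAt
    (by simp)).hasFDerivAt.hasMFDerivAt
  have h₁ := HasMFDerivAt.comp u (D.mdifferentiableAt_cover (D.logCoord u)).hasMFDerivAt h₀
  refine (h₁.congr_of_eventuallyEq ?_).mfderiv
  filter_upwards [(D.isOpen_chart_target x).mem_nhds hu] with w hw using (D.chart_symm_eq hw).2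

theorem inChart_eq {k : ℕ} (σ : FormField model D.Surface k) {x : D.Surface} {u : ℂ × ℂ}
    (hu : u ∈ (extChartAt model x).target) :
    σ.inChart x u =
      (D.lift k σ (D.logCoord u)).compContinuousLinearMap (fderiv ℝ D.logCoord u) := by
  have h₁ := D.mfderivWithin_chart_symm hu
  refine (congrArg (ContinuousAlternatingMap.compContinuousLinearMap
    (σ ((extChartAt model x).symm u) : (ℂ × ℂ) [⋀^Fin k]→L[ℝ] ℝ)) h₁).trans ?_
  exact D.comp_congr σ (D.chart_symm_eq hu).2
    ((D.coverDeriv (D.logCoord u)).comp (fderiv ℝ D.logCoord u))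

theorem lift_eq_inChart {k : ℕ} (σ : FormField model D.Surface k) {x : D.Surface}
    {v : (ℂ × ℝ) × ℝ} (hv : D.expCoord v ∈ (extChartAt model x).target) :
    D.lift k σ v =
      (σ.inChart x (D.expCoord v)).compContinuousLinearMap (fderiv ℝ D.expCoord v) := by
  rw [D.inChart_eq σ hv, logCoord_expCoord]
  ext w
  exact congrArg (D.lift k σ v) (funext fun i ↦
    (congrArg (fun T ↦ T (w i)) (D.fderiv_logCoord_comp_fderiv_expCoord v)).symm)

theorem apply_eq_inChart {k : ℕ} (σ : FormField model D.Surface k) (x : D.Surface) :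
    (σ x : (ℂ × ℂ) [⋀^Fin k]→L[ℝ] ℝ) =
      (σ.inChart x (extChartAt model x x)).compContinuousLinearMap (D.chartDeriv x) := by
  have h := mfderivWithin_extChartAt_symm_comp_mfderiv_extChartAt' (I := model)
    (mem_extChartAt_source (I := model) x)
  have h' : (mfderivWithin 𝓘(ℝ, ℂ × ℂ) model (extChartAt model x).symm (range model)
      (extChartAt model x x) : ℂ × ℂ →L[ℝ] ℂ × ℂ).comp (D.chartDeriv x) =
      ContinuousLinearMap.id ℝ (ℂ × ℂ) := h
  have h₂ := D.comp_congr σ (extChartAt_to_inv (I := model) x) ((mfderivWithin 𝓘(ℝ, ℂ × ℂ) model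
      (extChartAt model x).symm (range model)
      (extChartAt model x x) : ℂ × ℂ →L[ℝ] ℂ × ℂ).comp (D.chartDeriv x))
  refine Eq.trans ?_ h₂.symm
  rw [h']
  rfl

/-- The value at `x` is recovered from the chart expression at the centre of the chart, which
depends only on the lift. -/
theorem lift_injective (k : ℕ) : Function.Injective (D.lift k) := by
  refine fun σ τ h ↦ funext fun x ↦ ?_
  refine (D.apply_eq_inChart σ x).trans (Eq.trans ?_ (D.apply_eq_inChart τ x).symm)
  rw [D.inChart_eq σ (mem_extChartAt_target x), D.inChart_eq τ (mem_extChartAt_target x), h]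

theorem contDiff_lift {k : ℕ} {σ : FormField model D.Surface k}
    (hσ : σ ∈ smoothForms model D.Surface k) : ContDiff ℝ ∞ (D.lift k σ) := by
  rw [contDiff_iff_contDiffAt]
  have h₀ (x : D.Surface) : ContDiffAt ℝ ∞ (D.lift k σ) (D.basePoint x) := by
    have h₁ : ContDiffAt ℝ ∞ (σ.inChart x) (D.expCoord (D.basePoint x)) :=
      (hσ x).contDiffAt ((D.isOpen_chart_target x).mem_nhds
        (D.expCoord_mem_target x).self_of_nhds)
    have h₂ := (h₁.comp _ D.contDiff_expCoord.contDiffAt).compContinuousLinearMap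
      (D.contDiff_expCoord.contDiffAt.fderiv_right (m := ∞) (by simp))
    refine h₂.congr_of_eventuallyEq ?_
    filter_upwards [D.expCoord_mem_target x] with v hv using D.lift_eq_inChart σ hv
  intro v
  obtain ⟨A, c, hA, hv⟩ := D.deckRel_of_cover_eq (D.cover_basePoint (D.cover v))
  have hl : D.lift k σ = fun v ↦ (D.lift k σ (A v + c)).compContinuousLinearMap
      (A : (ℂ × ℝ) × ℝ →L[ℝ] (ℂ × ℝ) × ℝ) := funext fun w ↦ (hA.lift_comp σ w).symm
  rw [hl]
  have hd : ContDiffAt ℝ ∞ (fun v ↦ A v + c) v := by fun_prop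
  refine ContDiffAt.compContinuousLinearMap (ContDiffAt.comp v ?_ hd) contDiffAt_const
  rw [← hv]
  exact h₀ _

theorem mem_smoothForms_of_contDiff_lift {k : ℕ} {σ : FormField model D.Surface k}
    (hσ : ContDiff ℝ ∞ (D.lift k σ)) : σ ∈ smoothForms model D.Surface k := by
  intro x
  refine ContDiffOn.congr (fun u hu ↦ ?_) fun u hu ↦ D.inChart_eq σ hu
  have h := D.contDiffAt_logCoord (D.chart_symm_eq hu).1
  exact ((hσ.contDiffAt.comp u h).compContinuousLinearMap
    (h.fderiv_right (m := ∞) (by simp))).contDiffWithinAt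

theorem lift_mem_twistedForms {k : ℕ} {σ : FormField model D.Surface k}
    (hσ : σ ∈ smoothForms model D.Surface k) :
    D.lift k σ ∈ twistedForms D.lattice D.fiberMap 1 k :=
  mem_twistedForms.2 ⟨⟨D.contDiff_lift hσ, fun _ hm v ↦ D.lift_add_lattice σ hm v⟩, by
    rw [one_smul, lift_shift]⟩

/-- Both forms are invariant under deck transformations, and every orbit contains a base point. -/
theorem lift_eq_of_basePoint {k : ℕ} {σ : FormField model D.Surface k}
    {τ : (ℂ × ℝ) × ℝ → ((ℂ × ℝ) × ℝ) [⋀^Fin k]→L[ℝ] ℝ}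
    (hτ : τ ∈ twistedForms D.lattice D.fiberMap 1 k)
    (h : ∀ x, D.lift k σ (D.basePoint x) = τ (D.basePoint x)) : D.lift k σ = τ := by
  funext v
  obtain ⟨A, c, hA, hv⟩ := D.deckRel_of_cover_eq (D.cover_basePoint (D.cover v))
  rw [← hA.lift_comp σ v, ← hA.pullback_eq k τ hτ v, ← hv, h]

/-- The derivative `FormField.d` at `x` is taken in the chart centred at `x`, so the comparison is
made at base points only; there it is naturality of `extDeriv` under `expCoord`. -/
theorem lift_d {k : ℕ} {σ : FormField model D.Surface k}
    (hσ : σ ∈ smoothForms model D.Surface k) : D.lift (k + 1) σ.d = extDeriv (D.lift k σ) := by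
  refine D.lift_eq_of_basePoint (extDeriv_mem_twistedForms (D.lift_mem_twistedForms hσ)) fun x ↦ ?_
  have h₁ : ContDiffAt ℝ ∞ (σ.inChart x) (D.expCoord (D.basePoint x)) :=
    (hσ x).contDiffAt ((D.isOpen_chart_target x).mem_nhds
      (D.expCoord_mem_target x).self_of_nhds)
  have h₂ := extDeriv_pullback (r := ∞) (h₁.differentiableAt (by simp))
    D.contDiff_expCoord.contDiffAt (by simpa using WithTop.coe_le_coe.2 (le_top : (2 : ℕ∞) ≤ ⊤))
  have h₃ : D.lift k σ =ᶠ[𝓝 (D.basePoint x)] fun v ↦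
      (σ.inChart x (D.expCoord v)).compContinuousLinearMap (fderiv ℝ D.expCoord v) := by
    filter_upwards [D.expCoord_mem_target x] with v hv using D.lift_eq_inChart σ hv
  rw [h₃.extDeriv_eq, h₂, lift_apply, D.comp_congr σ.d (D.cover_basePoint x),
    ← chartDeriv_comp_coverDeriv, expCoord_basePoint, ← extDerivWithin_univ,
    ← ModelWithCorners.range_eq_univ model]
  rfl

/-- The form is pushed down at each `x` through the chosen base point. The choice need not vary
continuously with `x`: invariance of `τ` identifies the lift with `τ` everywhere, and smoothness is
read off from the lift. -/
theorem exists_lift_eq {k : ℕ} {τ : (ℂ × ℝ) × ℝ → ((ℂ × ℝ) × ℝ) [⋀^Fin k]→L[ℝ] ℝ}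
    (hτ : τ ∈ twistedForms D.lattice D.fiberMap 1 k) :
    ∃ σ ∈ smoothForms model D.Surface k, D.lift k σ = τ := by
  let σ : FormField model D.Surface k := fun x ↦
    (τ (D.basePoint x)).compContinuousLinearMap
      ((fderiv ℝ D.logCoord (extChartAt model x x)).comp (D.chartDeriv x))
  have h : D.lift k σ = τ := by
    refine D.lift_eq_of_basePoint hτ fun x ↦ ?_
    rw [lift_apply, D.comp_congr σ (D.cover_basePoint x)]
    change ((τ (D.basePoint x)).compContinuousLinearMap
      ((fderiv ℝ D.logCoord (extChartAt model x x)).comp (D.chartDeriv x))).compContinuousLinearMap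
      _ = _
    have h₁ := D.fderiv_logCoord_comp_fderiv_expCoord (D.basePoint x)
    rw [← chartDeriv_comp_coverDeriv, expCoord_basePoint] at h₁
    ext w
    exact congrArg (τ (D.basePoint x)) (funext fun i ↦ congrArg (fun T ↦ T (w i)) h₁)
  exact ⟨σ, D.mem_smoothForms_of_contDiff_lift (h ▸ hτ.1.1), h⟩

theorem lift_wedge {k : ℕ} (η : FormField model D.Surface 1) (σ : FormField model D.Surface k)
    (v : (ℂ × ℝ) × ℝ) : D.lift (k + 1) (η.wedge σ) v = wedgeOne (D.lift 1 η v) (D.lift k σ v) := by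
  ext w
  rw [wedgeOne_apply]
  refine (wedgeOne_apply (E := ℂ × ℂ) (η (D.cover v)) (σ (D.cover v)) _).trans ?_
  refine Finset.sum_congr rfl fun i _ ↦ ?_
  have h : ![D.coverDeriv v (w i)] = ⇑(D.coverDeriv v) ∘ ![w i] := by
    ext j <;> simp
  exact congrArg (fun u ↦ (-1) ^ (i : ℕ) * ((η (D.cover v) : (ℂ × ℂ) [⋀^Fin 1]→L[ℝ] ℝ) u *
    D.lift k σ v (i.removeNth w))) h

/-! ### The lift of `ϑ` -/

theorem proj_cover (v : (ℂ × ℝ) × ℝ) :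
    (D.proj (D.cover v) : ℂ) = Complex.exp ((2 * Real.pi * v.2 : ℝ) * Complex.I) := by
  have h : D.proj (D.cover v) =
      Circle.exp (2 * Real.pi * Real.logb D.α (D.expCoord v).2.im) := rfl
  rw [h, expCoord_im, Real.logb_rpow D.α_pos D.one_lt_α.ne', Circle.coe_exp]

theorem hasFDerivAt_proj_cover (v : (ℂ × ℝ) × ℝ) :
    HasFDerivAt (fun v ↦ (D.proj (D.cover v) : ℂ))
      ((2 * Real.pi) • (ContinuousLinearMap.snd ℝ (ℂ × ℝ) ℝ).smulRight
        ((D.proj (D.cover v) : ℂ) * Complex.I)) v := by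
  simp only [proj_cover]
  have h₁ : HasFDerivAt (fun v : (ℂ × ℝ) × ℝ ↦ 2 * Real.pi * v.2)
      ((2 * Real.pi) • ContinuousLinearMap.snd ℝ (ℂ × ℝ) ℝ) v :=
    (ContinuousLinearMap.snd ℝ (ℂ × ℝ) ℝ).hasFDerivAt.const_mul (2 * Real.pi)
  have h₂ := ((Complex.ofRealCLM.hasFDerivAt.comp v h₁).mul_const Complex.I).cexp
  refine h₂.congr_fderiv ?_
  ext w <;> simp; ring

/-- On the covering the projection becomes `ζ = exp (2 π i s)`, so `dζ / (2 π i ζ)` becomes `ds`. -/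
theorem lift_vartheta (v : (ℂ × ℝ) × ℝ) : D.lift 1 D.vartheta v =
    ContinuousAlternatingMap.ofSubsingleton ℝ ((ℂ × ℝ) × ℝ) ℝ (0 : Fin 1)
      (ContinuousLinearMap.snd ℝ (ℂ × ℝ) ℝ) := by
  have hd : MDifferentiableAt model 𝓘(ℝ, ℂ) (fun y : D.Surface ↦ (D.proj y : ℂ)) (D.cover v) := by
    generalize D.cover v = x
    have h₁ : MDifferentiableAt model 𝓘(ℝ, ℂ × ℂ) (extChartAt model x) x :=
      mdifferentiableAt_extChartAt (mem_chart_source _ x)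
    have h₂ := (D.hasFDerivAt_proj_cover (D.logCoord (extChartAt model x x))).differentiableAt.comp
      (extChartAt model x x) ((D.contDiffAt_logCoord (D.chart_symm_eq (mem_extChartAt_target x)).1).differentiableAt
        (by simp))
    refine (h₂.mdifferentiableAt.comp x h₁).congr_of_eventuallyEq ?_
    filter_upwards [extChartAt_source_mem_nhds (I := model) x] with y hy
    have hy' := (extChartAt model x).map_source hy
    simp only [Function.comp_apply]
    rw [← (D.chart_symm_eq hy').2, (extChartAt model x).left_inv hy]
  let P : ℂ × ℂ →L[ℝ] ℂ := mfderiv model 𝓘(ℝ, ℂ) (fun y : D.Surface ↦ (D.proj y : ℂ)) (D.cover v)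
  have h₀ : HasFDerivAt (fun v ↦ (D.proj (D.cover v) : ℂ)) (P.comp (D.coverDeriv v)) v :=
    hasMFDerivAt_iff_hasFDerivAt.1 (HasMFDerivAt.comp (f := D.cover) v hd.hasMFDerivAt
      (D.mdifferentiableAt_cover v).hasMFDerivAt)
  have h := h₀.unique (D.hasFDerivAt_proj_cover v)
  ext w
  have hw := congrArg (fun T ↦ T (w 0)) h
  refine (congrArg (fun z : ℂ ↦ (2 * Real.pi)⁻¹ * (conj (D.proj (D.cover v) : ℂ) * z).im)
    hw).trans ?_
  have hn : conj (D.proj (D.cover v) : ℂ) * (D.proj (D.cover v) : ℂ) = 1 := by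
    rw [← Complex.normSq_eq_conj_mul_self, Circle.normSq_coe, Complex.ofReal_one]
  change (2 * Real.pi)⁻¹ * (conj (D.proj (D.cover v) : ℂ) *
    ((2 * Real.pi) • ((w 0).2 • ((D.proj (D.cover v) : ℂ) * Complex.I)))).im = _
  rw [mul_smul_comm, mul_smul_comm, ← mul_assoc, hn, one_mul]
  simp
  field_simp

end InoueData

/-! ### Conjugating the twisted differential by an exponential -/

section

open MorseNovikov

variable {E : Type*} [NormedAddCommGroup E] [NormedSpace ℝ E] {k : ℕ}

theorem extDeriv_exp_neg_smul {F : E → ℝ} {τ : E → E [⋀^Fin k]→L[ℝ] ℝ} {v : E}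
    (hF : DifferentiableAt ℝ F v) (hτ : DifferentiableAt ℝ τ v) :
    extDeriv (fun v ↦ Real.exp (-F v) • τ v) v =
      Real.exp (-F v) • (extDeriv τ v -
        wedgeOne (ContinuousAlternatingMap.ofSubsingleton ℝ E ℝ (0 : Fin 1) (fderiv ℝ F v))
          (τ v)) := by
  have h : HasFDerivAt (fun v ↦ Real.exp (-F v) • τ v)
      (Real.exp (-F v) • (fderiv ℝ τ v + (-1 : ℝ) • (fderiv ℝ F v).smulRight (τ v))) v := by
    refine (hF.hasFDerivAt.neg.exp.smul hτ.hasFDerivAt).congr_fderiv ?_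
    ext w u
    simp
    ring
  rw [extDeriv, h.fderiv, ContinuousAlternatingMap.alternatizeUncurryFin_smul,
    ContinuousAlternatingMap.alternatizeUncurryFin_add,
    ContinuousAlternatingMap.alternatizeUncurryFin_smul, neg_one_smul, ← sub_eq_add_neg]
  rfl

theorem extDeriv_zeroForm {f : E → E [⋀^Fin 0]→L[ℝ] ℝ} (v : E) :
    extDeriv f v = ContinuousAlternatingMap.ofSubsingleton ℝ E ℝ (0 : Fin 1)
      (fderiv ℝ (fun v ↦ f v ![]) v) := by
  rw [← extDeriv_constOfIsEmpty]
  congr 1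
  funext w
  ext u
  rw [Subsingleton.elim u ![]]
  rfl

end

namespace InoueData

open MappingTorus MorseNovikov

variable (D : InoueData)

/-! ### Potentials and the Morse–Novikov cohomology -/

/-- The function `F` on the universal covering is a primitive of the lift of `η`; it is invariant
under the lattice and grows by `t` under the deck transformation `shift`. -/
structure IsPotential (η : FormField model D.Surface 1) (F : (ℂ × ℝ) × ℝ → ℝ) (t : ℝ) : Prop where
  contDiff : ContDiff ℝ ∞ F
  add_lattice : ∀ m ∈ D.lattice, ∀ v, F (v + (m, 0)) = F v
  shift_eq : ∀ v, F (shift D.fiberMap v) = F v + t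
  lift_eq : ∀ v, D.lift 1 η v =
    ContinuousAlternatingMap.ofSubsingleton ℝ ((ℂ × ℝ) × ℝ) ℝ (0 : Fin 1) (fderiv ℝ F v)

/-- The exact part contributes an invariant function, so the growth `t` comes from `s ↦ t s` alone.
-/
theorem isPotential_smul_vartheta_add_d (t : ℝ) {f : FormField model D.Surface 0}
    (hf : f ∈ smoothForms model D.Surface 0) :
    D.IsPotential (t • D.vartheta + f.d) (fun v ↦ t * v.2 + D.lift 0 f v ![]) t where
  contDiff := (contDiff_const.mul contDiff_snd).add
    ((ContinuousAlternatingMap.apply ℝ ((ℂ × ℝ) × ℝ) ℝ ![]).contDiff.comp (D.contDiff_lift hf))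
  add_lattice m hm v := by
    rw [D.lift_add_lattice f hm]
    simp
  shift_eq v := by
    have h : D.lift 0 f (shift D.fiberMap v) ![] = D.lift 0 f v ![] := by
      conv_rhs => rw [← D.lift_shift f]
      exact congrArg (D.lift 0 f (shift D.fiberMap v)) (Subsingleton.elim _ _)
    rw [h]
    simp only [shift]
    ring
  lift_eq v := by
    have h₁ : DifferentiableAt ℝ (fun v ↦ D.lift 0 f v ![]) v :=
      ((ContinuousAlternatingMap.apply ℝ ((ℂ × ℝ) × ℝ) ℝ ![]).contDiff.comp
        (D.contDiff_lift hf)).differentiable (by simp) v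
    have h₂ : HasFDerivAt (fun v : (ℂ × ℝ) × ℝ ↦ t * v.2)
        (t • ContinuousLinearMap.snd ℝ (ℂ × ℝ) ℝ) v :=
      (ContinuousLinearMap.snd ℝ (ℂ × ℝ) ℝ).hasFDerivAt.const_mul t
    rw [(h₂.fun_add h₁.hasFDerivAt).fderiv, map_add, map_smul, D.lift_d hf, Pi.add_apply,
      Pi.smul_apply, lift_vartheta, extDeriv_zeroForm]
    rfl

theorem isPotential_smul_vartheta (t : ℝ) :
    D.IsPotential (t • D.vartheta) (fun v ↦ t * v.2) t := by
  have h := D.isPotential_smul_vartheta_add_d t (zero_mem (smoothForms model D.Surface 0))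
  have h₁ : (0 : FormField model D.Surface 0).d = 0 := by
    simpa using FormField.d_smul (0 : ℝ) (0 : FormField model D.Surface 0)
  simpa [h₁] using h

variable {D} {η : FormField model D.Surface 1} {F : (ℂ × ℝ) × ℝ → ℝ} {t : ℝ}

/-- Two primitives differ by a constant, so they grow equally under `shift`. -/
theorem IsPotential.unique {F' : (ℂ × ℝ) × ℝ → ℝ} {t' : ℝ} (h : D.IsPotential η F t)
    (h' : D.IsPotential η F' t') : t = t' := by
  have hd (v : (ℂ × ℝ) × ℝ) : fderiv ℝ (F - F') v = 0 := by
    rw [fderiv_sub (h.contDiff.differentiable (by simp) v)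
      (h'.contDiff.differentiable (by simp) v), sub_eq_zero]
    exact (ContinuousAlternatingMap.ofSubsingleton ℝ ((ℂ × ℝ) × ℝ) ℝ (0 : Fin 1)).injective
      ((h.lift_eq v).symm.trans (h'.lift_eq v))
  have h₁ := is_const_of_fderiv_eq_zero ((h.contDiff.differentiable (by simp)).sub
    (h'.contDiff.differentiable (by simp))) hd (shift D.fiberMap 0) 0
  rw [Pi.sub_apply, Pi.sub_apply, h.shift_eq, h'.shift_eq] at h₁
  linarith

variable (D) in
/-- The lift of forms to the universal covering, multiplied by `exp (-F)`. -/
noncomputable def expLift (F : (ℂ × ℝ) × ℝ → ℝ) (k : ℕ) : FormField model D.Surface k →ₗ[ℝ]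
    ((ℂ × ℝ) × ℝ → ((ℂ × ℝ) × ℝ) [⋀^Fin k]→L[ℝ] ℝ) where
  toFun σ v := Real.exp (-F v) • D.lift k σ v
  map_add' σ τ := by
    funext v
    rw [map_add, Pi.add_apply, smul_add]
    rfl
  map_smul' c σ := by
    funext v
    rw [map_smul, Pi.smul_apply, smul_comm]
    rfl

theorem expLift_apply {k : ℕ} (σ : FormField model D.Surface k) (v : (ℂ × ℝ) × ℝ) :
    D.expLift F k σ v = Real.exp (-F v) • D.lift k σ v := rfl

theorem expLift_injective (k : ℕ) : Function.Injective (D.expLift F k) := by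
  refine fun σ τ h ↦ D.lift_injective k (funext fun v ↦ ?_)
  exact smul_right_injective _ (Real.exp_ne_zero (-F v)) (congrFun h v)

theorem IsPotential.expLift_mem (h : D.IsPotential η F t) {k : ℕ}
    {σ : FormField model D.Surface k} (hσ : σ ∈ smoothForms model D.Surface k) :
    D.expLift F k σ ∈ twistedForms D.lattice D.fiberMap (Real.exp (-t)) k := by
  refine mem_twistedForms.2 ⟨⟨h.contDiff.neg.exp.smul (D.contDiff_lift hσ), fun m hm v ↦ ?_⟩, ?_⟩
  · rw [expLift_apply, expLift_apply, h.add_lattice m hm, D.lift_add_lattice σ hm]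
  · funext v
    rw [Pi.smul_apply, expLift_apply, ← D.lift_shift σ, smul_smul, ← Real.exp_add]
    change Real.exp (-F (shift D.fiberMap v)) • shiftPullback D.fiberMap k (D.lift k σ) v = _
    rw [h.shift_eq, neg_add_rev]

theorem IsPotential.exists_expLift_eq (h : D.IsPotential η F t) {k : ℕ}
    {τ : (ℂ × ℝ) × ℝ → ((ℂ × ℝ) × ℝ) [⋀^Fin k]→L[ℝ] ℝ}
    (hτ : τ ∈ twistedForms D.lattice D.fiberMap (Real.exp (-t)) k) :
    ∃ σ ∈ smoothForms model D.Surface k, D.expLift F k σ = τ := by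
  obtain ⟨σ, hσ, hl⟩ := D.exists_lift_eq (τ := fun v ↦ Real.exp (F v) • τ v) (by
    refine mem_twistedForms.2 ⟨⟨h.contDiff.exp.smul hτ.1.1, fun m hm v ↦ ?_⟩, ?_⟩
    · change Real.exp (F _) • τ _ = Real.exp (F _) • τ _
      rw [h.add_lattice m hm, hτ.1.2 m hm]
    · funext v
      have h₁ := congrFun (mem_twistedForms.1 hτ).2 v
      change (Real.exp (F (shift D.fiberMap v)) • shiftPullback D.fiberMap k τ v) = (1 : ℝ) • _
      rw [h₁, h.shift_eq, one_smul, Pi.smul_apply, smul_smul, ← Real.exp_add, add_neg_cancel_right])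
  refine ⟨σ, hσ, funext fun v ↦ ?_⟩
  rw [expLift_apply, hl, smul_smul, ← Real.exp_add, neg_add_cancel, Real.exp_zero, one_smul]

theorem IsPotential.expLift_twistedD (h : D.IsPotential η F t) {k : ℕ}
    (σ : smoothForms model D.Surface k) :
    D.expLift F (k + 1) (twistedD η k σ) = extDeriv (D.expLift F k σ) := by
  funext v
  refine Eq.trans ?_ (extDeriv_exp_neg_smul (h.contDiff.differentiable (by simp) v)
    ((D.contDiff_lift σ.2).differentiable (by simp) v)).symm
  rw [expLift_apply, ← h.lift_eq, ← D.lift_wedge, ← D.lift_d σ.2, ← Pi.sub_apply, ← map_sub]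
  rfl

theorem IsPotential.mem_cocycles_iff (h : D.IsPotential η F t) {k : ℕ}
    (σ : smoothForms model D.Surface k) :
    σ ∈ cocycles η k ↔ extDeriv (D.expLift F k σ) = 0 := by
  rw [← h.expLift_twistedD, cocycles, LinearMap.mem_ker]
  exact ((D.expLift F (k + 1)).map_eq_zero_iff (expLift_injective _)).symm

/-- Smooth forms on the surface correspond to twisted forms on the universal covering. -/
noncomputable def IsPotential.formsEquiv (h : D.IsPotential η F t) (k : ℕ) :
    smoothForms model D.Surface k ≃ₗ[ℝ]
      twistedForms D.lattice D.fiberMap (Real.exp (-t)) k :=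
  LinearEquiv.ofBijective
    (((D.expLift F k).domRestrict _).codRestrict _ fun σ ↦ h.expLift_mem σ.2)
    ⟨fun σ τ hστ ↦ Subtype.ext (expLift_injective k (congrArg Subtype.val hστ)), fun τ ↦ by
      obtain ⟨σ, hσ, hl⟩ := h.exists_expLift_eq τ.2
      exact ⟨⟨σ, hσ⟩, Subtype.ext hl⟩⟩

theorem IsPotential.expLift_formsEquiv_symm (h : D.IsPotential η F t) {k : ℕ}
    (τ : twistedForms D.lattice D.fiberMap (Real.exp (-t)) k) :
    D.expLift F k ((h.formsEquiv k).symm τ) = τ :=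
  congrArg Subtype.val ((h.formsEquiv k).apply_symm_apply τ)

/-- Closed twisted forms depending linearly on a parameter define cocycles on the surface. -/
noncomputable def IsPotential.toCocycles (h : D.IsPotential η F t) {k : ℕ} {X : Type*}
    [AddCommMonoid X] [Module ℝ X]
    (φ : X →ₗ[ℝ] twistedForms D.lattice D.fiberMap (Real.exp (-t)) k)
    (hφ : ∀ x, extDeriv (φ x : (ℂ × ℝ) × ℝ → ((ℂ × ℝ) × ℝ) [⋀^Fin k]→L[ℝ] ℝ) = 0) :
    X →ₗ[ℝ] cocycles η k :=
  ((h.formsEquiv k).symm.toLinearMap ∘ₗ φ).codRestrict _ fun x ↦ by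
    rw [h.mem_cocycles_iff]
    exact (congrArg extDeriv (h.expLift_formsEquiv_symm (φ x))).trans (hφ x)

theorem IsPotential.expLift_toCocycles (h : D.IsPotential η F t) {k : ℕ} {X : Type*}
    [AddCommMonoid X] [Module ℝ X]
    (φ : X →ₗ[ℝ] twistedForms D.lattice D.fiberMap (Real.exp (-t)) k)
    (hφ : ∀ x, extDeriv (φ x : (ℂ × ℝ) × ℝ → ((ℂ × ℝ) × ℝ) [⋀^Fin k]→L[ℝ] ℝ) = 0) (x : X) :
    D.expLift F k (h.toCocycles φ hφ x).1.1 = φ x :=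
  h.expLift_formsEquiv_symm (φ x)

theorem IsPotential.nonempty_cohomology_zero_equiv (h : D.IsPotential η F t) :
    Nonempty (eigenforms D.fiberMap (Real.exp (-t)) 0 ≃ₗ[ℝ] Cohomology η 0) := by
  let φ : eigenforms D.fiberMap (Real.exp (-t)) 0 →ₗ[ℝ]
      twistedForms D.lattice D.fiberMap (Real.exp (-t)) 0 :=
    ((MappingTorus.cylinder 0).domRestrict _).codRestrict _ fun e ↦ cylinder_mem_twistedForms e.2
  let ψ := h.toCocycles φ fun e ↦ extDeriv_cylinder e.1
  have hψ (e) : D.expLift F 0 (ψ e).1.1 = MappingTorus.cylinder 0 e.1 := h.expLift_toCocycles φ _ e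
  let g : eigenforms D.fiberMap (Real.exp (-t)) 0 →ₗ[ℝ] Cohomology η 0 :=
    ((coboundaries η 0).submoduleOf (cocycles η 0)).mkQ ∘ₗ ψ
  refine ⟨LinearEquiv.ofBijective g ⟨?_, ?_⟩⟩
  · suffices hker : ∀ e, g e = 0 → e = 0 from fun e₁ e₂ he ↦
      sub_eq_zero.1 (hker _ ((g.map_sub e₁ e₂).trans (sub_eq_zero.2 he)))
    intro e he
    have h₁ : ψ e ∈ (coboundaries η 0).submoduleOf (cocycles η 0) :=
      (Submodule.Quotient.mk_eq_zero _).1 he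
    have h₂ : (ψ e).1 = 0 := h₁
    have h₃ := hψ e
    rw [h₂, Submodule.coe_zero, map_zero] at h₃
    exact Subtype.ext (cylinder_injective (h₃.symm.trans (map_zero _).symm))
  · intro q
    obtain ⟨z, rfl⟩ := Submodule.Quotient.mk_surjective _ q
    obtain ⟨e, he, hz⟩ := exists_eq_cylinder_of_extDeriv_eq_zero (h.expLift_mem z.1.2)
      ((h.mem_cocycles_iff z.1).1 z.2)
    refine ⟨⟨e, he⟩, congrArg (Submodule.Quotient.mk) (Subtype.ext (Subtype.ext ?_))⟩
    exact expLift_injective 0 ((hψ _).trans hz.symm)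

/-- The pair `(e, e')` goes to the class of the form on the surface whose `expLift` is `e + ds ∧
e'`. Injectivity and surjectivity are the two results on the twisted complex, carried back through
`expLift`. -/
theorem IsPotential.nonempty_cohomology_succ_equiv (h : D.IsPotential η F t) (k : ℕ) :
    Nonempty ((eigenforms D.fiberMap (Real.exp (-t)) (k + 1) ×
      eigenforms D.fiberMap (Real.exp (-t)) k) ≃ₗ[ℝ] Cohomology η (k + 1)) := by
  have hc := Real.exp_ne_zero (-t)
  have hss := D.disjoint_eigenforms (Real.exp (-t)) k
  let φ : (eigenforms D.fiberMap (Real.exp (-t)) (k + 1) ×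
      eigenforms D.fiberMap (Real.exp (-t)) k) →ₗ[ℝ]
      twistedForms D.lattice D.fiberMap (Real.exp (-t)) (k + 1) :=
    (((MappingTorus.cylinder (k + 1)).domRestrict _).coprod ((dsWedge k).domRestrict _)).codRestrict _
      fun e ↦ add_mem (cylinder_mem_twistedForms e.1.2) (dsWedge_mem_twistedForms e.2.2)
  let ψ := h.toCocycles φ fun e ↦ by
    change extDeriv (MappingTorus.cylinder (k + 1) e.1.1 + dsWedge k e.2.1) = 0
    rw [extDeriv_add_of_mem (cylinder_mem_periodicForms D.lattice e.1.1)
      (dsWedge_mem_twistedForms e.2.2).1, extDeriv_cylinder, extDeriv_dsWedge, add_zero]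
  have hψ (e) : D.expLift F (k + 1) (ψ e).1.1 = MappingTorus.cylinder (k + 1) e.1.1 + dsWedge k e.2.1 :=
    h.expLift_toCocycles φ _ e
  let g : (eigenforms D.fiberMap (Real.exp (-t)) (k + 1) ×
      eigenforms D.fiberMap (Real.exp (-t)) k) →ₗ[ℝ] Cohomology η (k + 1) :=
    ((coboundaries η (k + 1)).submoduleOf (cocycles η (k + 1))).mkQ ∘ₗ ψ
  refine ⟨LinearEquiv.ofBijective g ⟨?_, ?_⟩⟩
  · suffices hker : ∀ e, g e = 0 → e = 0 from fun e₁ e₂ he ↦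
      sub_eq_zero.1 (hker _ ((g.map_sub e₁ e₂).trans (sub_eq_zero.2 he)))
    intro e he
    have h₁ : ψ e ∈ (coboundaries η (k + 1)).submoduleOf (cocycles η (k + 1)) :=
      (Submodule.Quotient.mk_eq_zero _).1 he
    obtain ⟨ρ, hρ⟩ : ∃ ρ, twistedD η k ρ = (ψ e).1.1 := h₁
    have h₂ := h.expLift_twistedD ρ
    rw [hρ, hψ] at h₂
    obtain ⟨h₃, h₄⟩ := eq_zero_of_cylinder_add_dsWedge_eq_extDeriv hc D.fiberMap_mem_lattice hss
      e.2.2 (h.expLift_mem ρ.2) h₂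
    exact Prod.ext (Subtype.ext h₃) (Subtype.ext h₄)
  · intro q
    obtain ⟨z, rfl⟩ := Submodule.Quotient.mk_surjective _ q
    obtain ⟨e, he, e', he', τ, hτ, hz⟩ := exists_eq_cylinder_add_dsWedge_add_extDeriv hc
      D.fiberMap_mem_lattice hss (h.expLift_mem z.1.2) ((h.mem_cocycles_iff z.1).1 z.2)
    obtain ⟨ρ, hρ, rfl⟩ := h.exists_expLift_eq hτ
    refine ⟨(⟨e, he⟩, ⟨e', he'⟩), ((Submodule.Quotient.eq _).2 ?_).symm⟩
    refine ⟨⟨ρ, hρ⟩, expLift_injective (F := F) (k + 1) ?_⟩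
    rw [h.expLift_twistedD]
    change _ = D.expLift F (k + 1) (z.1.1 - (ψ _).1.1)
    rw [map_sub, hψ, hz]
    exact (add_sub_cancel_left _ _).symm

theorem IsPotential.nonempty_cohomology_equiv (h : D.IsPotential η F t)
    {η' : FormField model D.Surface 1} {F' : (ℂ × ℝ) × ℝ → ℝ} (h' : D.IsPotential η' F' t) (i : ℕ) :
    Nonempty (Cohomology η i ≃ₗ[ℝ] Cohomology η' i) := by
  cases i with
  | zero =>
    obtain ⟨e⟩ := h.nonempty_cohomology_zero_equiv
    obtain ⟨e'⟩ := h'.nonempty_cohomology_zero_equiv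
    exact ⟨e.symm.trans e'⟩
  | succ k =>
    obtain ⟨e⟩ := h.nonempty_cohomology_succ_equiv k
    obtain ⟨e'⟩ := h'.nonempty_cohomology_succ_equiv k
    exact ⟨e.symm.trans e'⟩

/-- Only eigenforms of degrees `i` and `i - 1` contribute to degree `i`. -/
theorem IsPotential.subsingleton_cohomology (h : D.IsPotential η F t) {i : ℕ}
    (hi : ∀ k ≤ 3, k = i ∨ k + 1 = i → Real.exp (-t) ≠ D.eigenvalue k) :
    Subsingleton (Cohomology η i) := by
  cases i with
  | zero =>
    obtain ⟨e⟩ := h.nonempty_cohomology_zero_equiv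
    have := D.subsingleton_eigenforms fun hk ↦ hi 0 hk (Or.inl rfl)
    exact e.symm.toEquiv.subsingleton
  | succ k =>
    obtain ⟨e⟩ := h.nonempty_cohomology_succ_equiv k
    have := D.subsingleton_eigenforms fun hk ↦ hi (k + 1) hk (Or.inl rfl)
    have := D.subsingleton_eigenforms fun hk ↦ hi k hk (Or.inr rfl)
    exact e.symm.toEquiv.subsingleton

theorem IsPotential.nonempty_cohomology_equiv_real (h : D.IsPotential η F t) {k : ℕ} (hk : k ≤ 3)
    (hc : Real.exp (-t) = D.eigenvalue k)
    (hne : ∀ j, j + 1 = k → Real.exp (-t) ≠ D.eigenvalue j) :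
    Nonempty (Cohomology η k ≃ₗ[ℝ] ℝ) := by
  obtain ⟨f⟩ := D.nonempty_eigenforms_equiv hk hc
  cases k with
  | zero =>
    obtain ⟨e⟩ := h.nonempty_cohomology_zero_equiv
    exact ⟨e.symm.trans f⟩
  | succ k =>
    obtain ⟨e⟩ := h.nonempty_cohomology_succ_equiv k
    have := D.subsingleton_eigenforms fun _ ↦ hne k rfl
    have := Unique.mk' (eigenforms D.fiberMap (Real.exp (-t)) k)
    exact ⟨(e.symm.trans LinearEquiv.prodUnique).trans f⟩

theorem IsPotential.nonempty_cohomology_succ_equiv_real (h : D.IsPotential η F t) {k : ℕ}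
    (hk : k ≤ 3) (hc : Real.exp (-t) = D.eigenvalue k)
    (hne : k + 1 ≤ 3 → Real.exp (-t) ≠ D.eigenvalue (k + 1)) :
    Nonempty (Cohomology η (k + 1) ≃ₗ[ℝ] ℝ) := by
  obtain ⟨f⟩ := D.nonempty_eigenforms_equiv hk hc
  obtain ⟨e⟩ := h.nonempty_cohomology_succ_equiv k
  have := D.subsingleton_eigenforms hne
  have := Unique.mk' (eigenforms D.fiberMap (Real.exp (-t)) (k + 1))
  exact ⟨(e.symm.trans LinearEquiv.uniqueProd).trans f⟩

variable (D)

theorem isClosedOneForm_vartheta : IsClosedOneForm D.vartheta := by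
  have h : D.vartheta ∈ smoothForms model D.Surface 1 :=
    D.mem_smoothForms_of_contDiff_lift (by
      rw [funext D.lift_vartheta]
      exact contDiff_const)
  refine ⟨h, D.lift_injective 2 ?_⟩
  rw [D.lift_d h, funext D.lift_vartheta, map_zero]
  funext v
  rw [extDeriv, fderiv_fun_const]
  exact map_zero (ContinuousAlternatingMap.alternatizeUncurryFinCLM ℝ _ _)

-- The lift of a closed one-form is a closed twisted form for `c = 1`. Since `α ≠ 1` there are no
-- invariant constant one-forms on the fibre, so only a multiple of `ds` and an exact form remain.
variable {D} in
theorem exists_eq_smul_vartheta_add_d (hη : IsClosedOneForm η) :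
    ∃ t : ℝ, ∃ f ∈ smoothForms model D.Surface 0, η = t • D.vartheta + f.d := by
  have hd : extDeriv (D.lift 1 η) = 0 := by rw [← D.lift_d hη.1, hη.2, map_zero]
  obtain ⟨e, he, e', -, τ, hτ, hz⟩ := exists_eq_cylinder_add_dsWedge_add_extDeriv one_ne_zero
    D.fiberMap_mem_lattice (D.disjoint_eigenforms 1 0) (D.lift_mem_twistedForms hη.1) hd
  obtain ⟨f, hf, rfl⟩ := D.exists_lift_eq hτ
  have := D.subsingleton_eigenforms (c := 1) (k := 1) fun _ ↦ D.one_lt_α.ne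
  have he0 : e = 0 := congrArg Subtype.val (Subsingleton.elim (⟨e, he⟩ : eigenforms _ _ _) 0)
  have hz' : D.lift 1 η = dsWedge 0 e' + extDeriv (D.lift 0 f) := by
    rw [hz, he0, map_zero]
    exact congrArg (· + extDeriv (D.lift 0 f)) (zero_add (dsWedge 0 e'))
  -- A degree-zero form `e'` is the number `e' ![]`, so `ds ∧ e'` is that multiple of `ds`, the lift
  -- of `ϑ`.
  refine ⟨e' ![], f, hf, D.lift_injective 1 ?_⟩
  rw [hz', map_add, map_smul, D.lift_d hf]
  congr 1
  funext v
  have h₁ : (fun v : (ℂ × ℝ) × ℝ ↦ slant 0 e' v ![]) = fun v ↦ v.2 * e' ![] := by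
    funext v
    change v.2 * e' _ = _
    congr 2
    exact Subsingleton.elim _ _
  have h₂ : HasFDerivAt (fun v : (ℂ × ℝ) × ℝ ↦ v.2 * e' ![])
      (e' ![] • ContinuousLinearMap.snd ℝ (ℂ × ℝ) ℝ) v :=
    (ContinuousLinearMap.snd ℝ (ℂ × ℝ) ℝ).hasFDerivAt.mul_const (e' ![])
  rw [dsWedge_apply, extDeriv_zeroForm, Pi.smul_apply, lift_vartheta, h₁, h₂.fderiv]
  rfl

end InoueData

open MorseNovikov in
theorem mainTheorem2 (D : InoueData) :
    IsClosedOneForm D.vartheta ∧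
    -- `t ≠ 0, ± ln α`: all cohomology groups vanish
    (∀ t : ℝ, t ≠ 0 → t ≠ Real.log D.α → t ≠ -Real.log D.α →
      ∀ i : ℕ, Subsingleton (Cohomology (t • D.vartheta) i)) ∧
    -- `t = - ln α`
    (Nonempty (Cohomology (-Real.log D.α • D.vartheta) 1 ≃ₗ[ℝ] ℝ) ∧
      Nonempty (Cohomology (-Real.log D.α • D.vartheta) 2 ≃ₗ[ℝ] ℝ) ∧
      ∀ i : ℕ, i ≠ 1 → i ≠ 2 → Subsingleton (Cohomology (-Real.log D.α • D.vartheta) i)) ∧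
    -- `t = ln α`
    (Nonempty (Cohomology (Real.log D.α • D.vartheta) 2 ≃ₗ[ℝ] ℝ) ∧
      Nonempty (Cohomology (Real.log D.α • D.vartheta) 3 ≃ₗ[ℝ] ℝ) ∧
      ∀ i : ℕ, i ≠ 2 → i ≠ 3 → Subsingleton (Cohomology (Real.log D.α • D.vartheta) i)) ∧
    -- `t = 0`: de Rham cohomology
    ((∀ i ∈ ({0, 1, 3, 4} : Set ℕ),
        Nonempty (Cohomology (0 : FormField InoueData.model D.Surface 1) i ≃ₗ[ℝ] ℝ)) ∧
      ∀ i ∉ ({0, 1, 3, 4} : Set ℕ),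
        Subsingleton (Cohomology (0 : FormField InoueData.model D.Surface 1) i)) ∧
    -- every closed one-form is `t ϑ + df` for a unique `t`, and its cohomology is that of `t ϑ`
    ∀ η : FormField InoueData.model D.Surface 1, IsClosedOneForm η →
      (∃! t : ℝ, ∃ f ∈ smoothForms InoueData.model D.Surface 0, η = t • D.vartheta + f.d) ∧
      ∀ t : ℝ, ∀ f ∈ smoothForms InoueData.model D.Surface 0, η = t • D.vartheta + f.d →
        ∀ i : ℕ, Nonempty (Cohomology η i ≃ₗ[ℝ] Cohomology (t • D.vartheta) i) := by
  have hα := D.one_lt_α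
  have hα' : D.α⁻¹ < 1 := inv_lt_one_of_one_lt₀ hα
  have e₀ : D.eigenvalue 0 = 1 := rfl
  have e₁ : D.eigenvalue 1 = D.α := rfl
  have e₂ : D.eigenvalue 2 = D.α⁻¹ := rfl
  have e₃ : D.eigenvalue 3 = 1 := rfl
  have hneg : Real.exp (-(-Real.log D.α)) = D.α := by rw [neg_neg, Real.exp_log D.α_pos]
  have hpos : Real.exp (-Real.log D.α) = D.α⁻¹ := by rw [Real.exp_neg, Real.exp_log D.α_pos]
  have hzero : Real.exp (-0) = 1 := by simp
  have h0 : D.IsPotential 0 (fun v ↦ 0 * v.2) 0 := by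
    simpa only [zero_smul] using D.isPotential_smul_vartheta 0
  refine ⟨D.isClosedOneForm_vartheta, fun t h₀ h₁ h₂ i ↦ ?_, ⟨?_, ?_, fun i hi hi' ↦ ?_⟩,
    ⟨?_, ?_, fun i hi hi' ↦ ?_⟩, ⟨fun i hi ↦ ?_, fun i hi ↦ ?_⟩, fun η hη ↦ ⟨?_, ?_⟩⟩
  · refine (D.isPotential_smul_vartheta t).subsingleton_cohomology fun k hk _ h ↦ ?_
    -- The twisting factor is `exp (-t)`, so the eigenvalue `α` belongs to `t = -ln α` and `α⁻¹` to
    -- `t = ln α`.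
    have ht : t = -Real.log (D.eigenvalue k) := by rw [← h, Real.log_exp, neg_neg]
    interval_cases k
    · exact h₀ (by rw [ht, e₀, Real.log_one, neg_zero])
    · exact h₂ ht
    · exact h₁ (by rw [ht, e₂, Real.log_inv, neg_neg])
    · exact h₀ (by rw [ht, e₃, Real.log_one, neg_zero])
  · refine (D.isPotential_smul_vartheta _).nonempty_cohomology_equiv_real (by simp) hneg ?_
    rintro j hj
    obtain rfl : j = 0 := by omega
    rw [hneg, e₀]
    exact hα.ne'
  · refine (D.isPotential_smul_vartheta _).nonempty_cohomology_succ_equiv_real (by simp) hneg ?_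
    intro _
    rw [hneg, e₂]
    linarith
  · refine (D.isPotential_smul_vartheta _).subsingleton_cohomology fun k hk hki ↦ ?_
    rw [hneg]
    interval_cases k
    · exact hα.ne'
    · omega
    · rw [e₂]; linarith
    · exact hα.ne'
  · refine (D.isPotential_smul_vartheta _).nonempty_cohomology_equiv_real (by simp) hpos ?_
    rintro j hj
    obtain rfl : j = 1 := by omega
    rw [hpos, e₁]
    linarith
  · refine (D.isPotential_smul_vartheta _).nonempty_cohomology_succ_equiv_real (by simp) hpos ?_
    intro _
    rw [hpos]
    exact hα'.ne
  · refine (D.isPotential_smul_vartheta _).subsingleton_cohomology fun k hk hki ↦ ?_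
    rw [hpos]
    interval_cases k
    · exact hα'.ne
    · rw [e₁]; linarith
    · omega
    · exact hα'.ne
  · simp only [mem_insert_iff, mem_singleton_iff] at hi
    rcases hi with rfl | rfl | rfl | rfl
    · exact h0.nonempty_cohomology_equiv_real (by simp) hzero (by simp)
    · refine h0.nonempty_cohomology_succ_equiv_real (by simp) hzero fun _ ↦ ?_
      rw [hzero]
      exact hα.ne
    · refine h0.nonempty_cohomology_equiv_real le_rfl hzero fun j hj ↦ ?_
      obtain rfl : j = 2 := by omega
      rw [hzero]
      exact hα'.ne'
    · exact h0.nonempty_cohomology_succ_equiv_real le_rfl hzero (by simp)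
  · refine h0.subsingleton_cohomology fun k hk hki ↦ ?_
    simp only [mem_insert_iff, mem_singleton_iff, not_or] at hi
    rw [hzero]
    interval_cases k
    · omega
    · exact hα.ne
    · exact hα'.ne'
    · omega
  · obtain ⟨t, f, hf, h⟩ := InoueData.exists_eq_smul_vartheta_add_d hη
    refine ⟨t, ⟨f, hf, h⟩, ?_⟩
    rintro t' ⟨f', hf', h'⟩
    -- Two decompositions give two potentials of the same form, whose growths must agree.
    exact (h' ▸ D.isPotential_smul_vartheta_add_d t' hf').unique
      (h ▸ D.isPotential_smul_vartheta_add_d t hf)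
  · rintro t f hf rfl i
    exact (D.isPotential_smul_vartheta_add_d t hf).nonempty_cohomology_equiv
      (D.isPotential_smul_vartheta t) i
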